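/- Let $d\ge 1$ and let $\Omega\subset\mathbb R^d$ be a bounded Lipschitz domain whose boundary is the disjoint union of $\Gamma_D$ and $\Gamma_N$, with $\Gamma_D$ measurable of positive surface measure; let $T>0$, $Q_T=\Omega\times(0,T)$ and $V=\{v\in H^1(\Omega): v=0 \text{ on }\Gamma_D\}$. **Data.** $\Phi,D\in L^\infty(\Omega)$ and $\mathbb K\in L^\infty(\Omega)^{d\times d}$, with $0<\phi_m\le\Phi\le\phi_M$, $D\ge D_0>0$ and $k_m|\xi|^2\le\mathbb K(x)\xi\cdot\xi\le k_M|\xi|^2$ ($0<k_m\le k_M$) for a.e. $x$ and all $\xi$; $\mathbf g\in\mathbb R^d$. The mobilities are $\lambda_l=kr_l/\mu_l$, $\lambda_g=kr_g/\mu_g$ with $\mu_l,\mu_g>0$, where $kr_l,kr_g\in C([0,1])$, $kr_l$ is non-decreasing, $kr_g$ is non-increasing, $kr_l(0)=0=kr_g(1)$, and $kr_l+kr_g\ge kr_m>0$, $kr_l(S)\ge a_lS^2$ with $a_l>0$; $\lambda=\lambda_l+\lambda_g$. The function $p_c\in C^1(0,1)\cap C((0,1])\cap L^1(0,1)$ is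 strictly decreasing, positive on $(0,1)$, with $p_c(1)=0$, $p_c'\le -M_0<0$ on $(0,1)$ and $p_c(s)\to\infty$ as $s\to0^+$; its inverse $p_c^{-1}:[0,\infty)\to(0,1]$ is extended by $1$ to negative arguments. Put $\gamma=\sqrt{\lambda_l\lambda_g/\lambda}$, $\alpha=-\gamma p_c'$, $\beta(S)=\int_0^S\alpha$, and assume $\alpha>0$ on $(0,1)$ and $\alpha(s)\to0$ as $s\to0^+$ and as $s\to1^-$. Let $\rho_l^{std}>0$. The function $\hat u\in C^1(\mathbb R)$ is strictly increasing and bounded on $[0,\infty)$, with $\hat u(0)=0$ and $0<\hat u'\le M_g$ on $[0,\infty)$, and $-u_{min}\le\hat u(\sigma)<0$ for all $\sigma<0$, where $0<u_{min}<\rho_l^{std}$. The function $\hat\rho_g\in C(\mathbb R)$ vanishes on $(-\infty,0]$ and is strictly increasing and bounded on $[0,\infty)$. Finally $F_I,F_P\in L^2(Q_T)$ are nonnegative a.e. For pressures $p_l,p_g$ write $S_l=p_c^{-1}(p_g-p_l)$, $u=\hat u(p_g)$, $\rho_g=\hat\rho_g(p_g)$, $\rho_l=\rho_l^{std}+u$,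 $r=uS_l+\rho_g(1-S_l)$, and $p=p_l-\int_{S_l}^1\frac{\lambda_g}{\lambda}p_c'\,ds$ (the global pressure). **(i) Discrete case.** Let $\eta>0$, $1\le k\le M$, $\delta t=T/M$, $F_I^k=\frac1{\delta t}\int_{(k-1)\delta t}^{k\delta t}F_I\,dt$, and similarly $F_P^k$. Let $p_l^{k-1},p_g^{k-1}\in L^2(\Omega)$ with $p_g^{k-1}\ge0$ a.e. in $\Omega$, and let $p_l^k,p_g^k\in V$, with $u^k=\hat u(p_g^k)\in V$, satisfy for all $\varphi,\psi\in V$ $$\frac1{\delta t}\int_\Omega\Phi(S_l^k-S_l^{k-1})\varphi+\int_\Omega\Big[\lambda_l(S_l^k)\mathbb K\nabla p_l^k-\Phi S_l^k\frac1{\rho_l^k}D\nabla u^k\Big]\cdot\nabla\varphi-\eta\int_\Omega\nabla(p_g^k-p_l^k)\cdot\nabla\varphi+\int_\Omega S_l^kF_P^k\varphi=\int_\Omega F_I^k\varphi+\int_\Omega\rho_l^k\lambda_l(S_l^k)\mathbb K\mathbf g\cdot\nabla\varphi,$$ $$\frac1{\delta t}\int_\Omega\Phi(r^k-r^{k-1})\psi+\int_\Omega\Big[u^k\lambda_l(S_l^k)\mathbb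 K\nabla p_l^k+\rho_g^k\lambda_g(S_l^k)\mathbb K\nabla p_g^k+\Phi S_l^k\frac{\rho_l^{std}}{\rho_l^k}D\nabla u^k\Big]\cdot\nabla\psi+\eta\int_\Omega(\rho_g^k-u^k)\nabla(p_g^k-p_l^k)\cdot\nabla\psi+\int_\Omega r^kF_P^k\psi=\int_\Omega\big(\rho_l^ku^k\lambda_l(S_l^k)+(\rho_g^k)^2\lambda_g(S_l^k)\big)\mathbb K\mathbf g\cdot\nabla\psi.$$ Then $p_g^k\ge0$ a.e. in $\Omega$. **(ii) Continuous case.** Let $p_l^0,p_g^0\in L^2(\Omega)$ with $p_g^0\ge0$ a.e., and let $s_0$ and $r_0$ be the values of $S_l$ and $r$ at $(p_l^0,p_g^0)$. Let $p_l,p_g\in L^2(Q_T)$ be such that $p,u\in L^2(0,T;V)$, $\beta(S_l)\in L^2(0,T;H^1(\Omega))$ and $\Phi\partial_tS_l,\ \Phi\partial_tr\in L^2(0,T;V')$, and such that for all $\varphi,\psi\in L^2(0,T;V)$ $$\int_0^T\langle\Phi\partial_tS_l,\varphi\rangle dt+\int_{Q_T}\Big[\lambda_l(S_l)\mathbb K\nabla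 p_l-\Phi S_l\frac1{\rho_l}D\nabla u\Big]\cdot\nabla\varphi+\int_{Q_T}S_lF_P\varphi=\int_{Q_T}F_I\varphi+\int_{Q_T}\rho_l\lambda_l(S_l)\mathbb K\mathbf g\cdot\nabla\varphi,$$ $$\int_0^T\langle\Phi\partial_tr,\psi\rangle dt+\int_{Q_T}\Big[u\lambda_l(S_l)\mathbb K\nabla p_l+\rho_g\lambda_g(S_l)\mathbb K\nabla p_g+\Phi S_l\frac{\rho_l^{std}}{\rho_l}D\nabla u\Big]\cdot\nabla\psi+\int_{Q_T}rF_P\psi=\int_{Q_T}\big(\rho_lu\lambda_l(S_l)+\rho_g^2\lambda_g(S_l)\big)\mathbb K\mathbf g\cdot\nabla\psi,$$ where $\lambda_l(S_l)\nabla p_l:=\lambda_l(S_l)\nabla p+\gamma(S_l)\nabla\beta(S_l)$ and $\lambda_g(S_l)\nabla p_g:=\lambda_g(S_l)\nabla p-\gamma(S_l)\nabla\beta(S_l)$. Suppose moreover that for every $\psi\in V$ the functions $t\mapsto\int_\Omega\Phi S_l\psi\,dx$ and $t\mapsto\int_\Omega\Phi r\psi\,dx$ are continuous on $[0,T]$ (after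 modification on a null set), with values $\int_\Omega\Phi s_0\psi\,dx$ and $\int_\Omega\Phi r_0\psi\,dx$ at $t=0$. Then $p_g\ge0$ a.e. in $Q_T$. -/

import Mathlib

open MeasureTheory Set Filter Topology
open scoped ENNReal ContDiff

noncomputable section

namespace TwoPhase

/-- Euclidean space `ℝ^d`. -/
abbrev E (d : ℕ) : Type := EuclideanSpace ℝ (Fin d)

/-! ### Domains and Sobolev spaces -/

/-- A bounded Lipschitz domain: a bounded, open, connected, nonempty set which near each of its
boundary points is, in a suitable orthonormal system of coordinates with last axis `ν`, the set of
points strictly above the graph of a Lipschitz function on the hyperplane orthogonal to `ν`. -/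
structure IsBoundedLipschitzDomain {d : ℕ} (Ω : Set (E d)) : Prop where
  isOpen : IsOpen Ω
  isBounded : Bornology.IsBounded Ω
  isConnected : IsConnected Ω
  lipschitz_boundary : ∀ x ∈ frontier Ω, ∃ (ν : E d) (r : ℝ) (C : NNReal)
    (h : (Submodule.span ℝ {ν})ᗮ → ℝ), ‖ν‖ = 1 ∧ 0 < r ∧ LipschitzWith C h ∧
      ∀ y ∈ Metric.ball x r,
        (y ∈ Ω ↔ h ((Submodule.span ℝ {ν})ᗮ.orthogonalProjectionOnto y) < inner ℝ ν y)

/-- `G` is the weak gradient of `f` on the open set `Ω`. -/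
def IsWeakGrad {d : ℕ} (Ω : Set (E d)) (f : E d → ℝ) (G : E d → E d) : Prop :=
  ∀ φ : E d → ℝ, ContDiff ℝ ∞ φ → HasCompactSupport φ → tsupport φ ⊆ Ω →
    ∫ x in Ω, f x • gradient φ x = -∫ x in Ω, φ x • G x

/-- `L²(Ω) × L²(Ω)^d` with the Hilbert norm `(‖f‖² + ‖G‖²)^{1/2}`. -/
abbrev L2Pair {d : ℕ} (Ω : Set (E d)) : Type :=
  WithLp 2 (Lp ℝ 2 (volume.restrict Ω) × Lp (E d) 2 (volume.restrict Ω))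

theorem Lp2_integrable_smul {d : ℕ} {Ω : Set (E d)} {F : Type*} [NormedAddCommGroup F]
    [NormedSpace ℝ F] (f : Lp F 2 (volume.restrict Ω)) (φ : E d → ℝ) (hφ : Continuous φ)
    (hc : HasCompactSupport φ) : Integrable (fun x => φ x • f x) (volume.restrict Ω) :=
  memLp_one_iff_integrable.1 ((Lp.memLp f).smul (r := 1)
    ((hφ.memLp_of_hasCompactSupport (p := 2) (μ := volume) hc).restrict Ω))

theorem continuous_gradient {d : ℕ} {φ : E d → ℝ} (hφ : ContDiff ℝ 1 φ) :
    Continuous (gradient φ) :=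
  (InnerProductSpace.toDual ℝ (E d)).symm.continuous.comp (hφ.continuous_fderiv one_ne_zero)

theorem hasCompactSupport_gradient {d : ℕ} {φ : E d → ℝ} (hc : HasCompactSupport φ) :
    HasCompactSupport (gradient φ) :=
  (hc.fderiv (𝕜 := ℝ)).comp_left (g := (InnerProductSpace.toDual ℝ (E d)).symm) (map_zero _)

theorem Lp2_integrable_smul_grad {d : ℕ} {Ω : Set (E d)} (f : Lp ℝ 2 (volume.restrict Ω))
    (φ : E d → ℝ) (hφ : ContDiff ℝ 1 φ) (hc : HasCompactSupport φ) :
    Integrable (fun x => f x • gradient φ x) (volume.restrict Ω) :=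
  memLp_one_iff_integrable.1 (MemLp.smul (r := 1)
    (((continuous_gradient hφ).memLp_of_hasCompactSupport (p := 2) (μ := volume)
      (hasCompactSupport_gradient hc)).restrict Ω) (Lp.memLp f))

/-- The Sobolev space `H¹(Ω)`: its elements are pairs (function, weak gradient), both
square-integrable, with the usual norm. -/
def H1 {d : ℕ} (Ω : Set (E d)) : Submodule ℝ (L2Pair Ω) where
  carrier := {v | IsWeakGrad Ω v.fst v.snd}
  zero_mem' := by
    intro φ _ _ _
    have h1 : ∫ x in Ω, (0 : Lp ℝ 2 (volume.restrict Ω)) x • gradient φ x = 0 := by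
      refine integral_eq_zero_of_ae ?_
      filter_upwards [Lp.coeFn_zero ℝ 2 (volume.restrict Ω)] with x hx
      rw [hx]; simp
    have h2 : ∫ x in Ω, φ x • (0 : Lp (E d) 2 (volume.restrict Ω)) x = 0 := by
      refine integral_eq_zero_of_ae ?_
      filter_upwards [Lp.coeFn_zero (E d) 2 (volume.restrict Ω)] with x hx
      rw [hx]; simp
    exact h1.trans (by rw [WithLp.zero_snd, h2, neg_zero])
  add_mem' := by
    intro v w hv hw φ h1 h2 h3
    have hφ1 : ContDiff ℝ 1 φ := h1.of_le (by exact_mod_cast le_top)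
    have e1 : ∫ x in Ω, (v + w).fst x • gradient φ x
        = ∫ x in Ω, (v.fst x • gradient φ x + w.fst x • gradient φ x) := by
      refine integral_congr_ae ?_
      filter_upwards [Lp.coeFn_add v.fst w.fst] with x hx
      rw [WithLp.add_fst, hx, Pi.add_apply, add_smul]
    have e2 : ∫ x in Ω, φ x • (v + w).snd x
        = ∫ x in Ω, (φ x • v.snd x + φ x • w.snd x) := by
      refine integral_congr_ae ?_
      filter_upwards [Lp.coeFn_add v.snd w.snd] with x hx
      rw [WithLp.add_snd, hx, Pi.add_apply, smul_add]
    rw [e1, e2, integral_add (Lp2_integrable_smul_grad _ _ hφ1 h2)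
        (Lp2_integrable_smul_grad _ _ hφ1 h2),
      integral_add (Lp2_integrable_smul _ _ hφ1.continuous h2)
        (Lp2_integrable_smul _ _ hφ1.continuous h2), hv φ h1 h2 h3, hw φ h1 h2 h3, neg_add]
  smul_mem' := by
    intro c v hv φ h1 h2 h3
    have e1 : ∫ x in Ω, (c • v).fst x • gradient φ x
        = ∫ x in Ω, c • (v.fst x • gradient φ x) := by
      refine integral_congr_ae ?_
      filter_upwards [Lp.coeFn_smul c v.fst] with x hx
      rw [WithLp.smul_fst, hx, Pi.smul_apply, smul_assoc]
    have e2 : ∫ x in Ω, φ x • (c • v).snd x = ∫ x in Ω, c • (φ x • v.snd x) := by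
      refine integral_congr_ae ?_
      filter_upwards [Lp.coeFn_smul c v.snd] with x hx
      rw [WithLp.smul_snd, hx, Pi.smul_apply, smul_comm]
    rw [e1, e2, integral_smul, integral_smul, hv φ h1 h2 h3, smul_neg]

/-- Surface measure on `∂Ω`: the `(d-1)`-dimensional Hausdorff measure. -/
def surfaceMeasure {d : ℕ} (Ω : Set (E d)) : Measure (E d) :=
  (Measure.hausdorffMeasure ((d : ℝ) - 1)).restrict (frontier Ω)

/-- `g ∈ L²(∂Ω)` is the trace of `v = (f, ∇f)`: there are `C¹` functions converging to `f`
in `H¹(Ω)` whose boundary values converge to `g` in `L²(∂Ω)`. -/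
def HasTrace {d : ℕ} (Ω : Set (E d)) (v : L2Pair Ω) (g : E d → ℝ) : Prop :=
  MemLp g 2 (surfaceMeasure Ω) ∧
  ∃ φ : ℕ → E d → ℝ, (∀ n, ContDiff ℝ 1 (φ n)) ∧
    Tendsto (fun n => eLpNorm (φ n - (v.fst : E d → ℝ)) 2 (volume.restrict Ω)) atTop (𝓝 0) ∧
    Tendsto (fun n => eLpNorm (gradient (φ n) - (v.snd : E d → E d)) 2 (volume.restrict Ω)) atTop (𝓝 0) ∧
    Tendsto (fun n => eLpNorm (φ n - g) 2 (surfaceMeasure Ω)) atTop (𝓝 0)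

theorem tendsto_eLpNorm_add {d : ℕ} {F : Type*} [NormedAddCommGroup F] {μ : Measure (E d)}
    {a b : ℕ → E d → F} {a' b' c' : E d → F}
    (ha : ∀ n, AEStronglyMeasurable (a n) μ) (hb : ∀ n, AEStronglyMeasurable (b n) μ)
    (ha' : AEStronglyMeasurable a' μ) (hb' : AEStronglyMeasurable b' μ) (hc : c' =ᵐ[μ] a' + b')
    (h1 : Tendsto (fun n => eLpNorm (a n - a') 2 μ) atTop (𝓝 0))
    (h2 : Tendsto (fun n => eLpNorm (b n - b') 2 μ) atTop (𝓝 0)) :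
    Tendsto (fun n => eLpNorm (a n + b n - c') 2 μ) atTop (𝓝 0) := by
  refine tendsto_of_tendsto_of_tendsto_of_le_of_le tendsto_const_nhds
    (by simpa using h1.add h2) (fun _ => zero_le) (fun n => ?_)
  have : eLpNorm (a n + b n - c') 2 μ = eLpNorm ((a n - a') + (b n - b')) 2 μ := by
    refine eLpNorm_congr_ae ?_
    filter_upwards [hc] with x hx
    simp only [Pi.sub_apply, Pi.add_apply, hx]
    abel
  rw [this]
  exact eLpNorm_add_le ((ha n).sub ha') ((hb n).sub hb') (by norm_num)

theorem tendsto_eLpNorm_smul {d : ℕ} {F : Type*} [NormedAddCommGroup F] [NormedSpace ℝ F]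
    {μ : Measure (E d)} {a : ℕ → E d → F} {a' c' : E d → F} (c : ℝ) (hc : c' =ᵐ[μ] c • a')
    (h1 : Tendsto (fun n => eLpNorm (a n - a') 2 μ) atTop (𝓝 0)) :
    Tendsto (fun n => eLpNorm (c • a n - c') 2 μ) atTop (𝓝 0) := by
  have : ∀ n, eLpNorm (c • a n - c') 2 μ = ‖c‖ₑ * eLpNorm (a n - a') 2 μ := by
    intro n
    rw [← eLpNorm_const_smul]
    refine eLpNorm_congr_ae ?_
    filter_upwards [hc] with x hx
    simp only [Pi.sub_apply, Pi.smul_apply, hx, smul_sub]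
  simp only [this]
  simpa using ENNReal.Tendsto.const_mul h1 (Or.inr (by simp))

theorem gradient_add_eq {d : ℕ} {φ ψ : E d → ℝ} (hφ : ContDiff ℝ 1 φ) (hψ : ContDiff ℝ 1 ψ) :
    gradient (φ + ψ) = gradient φ + gradient ψ := by
  funext x
  simp only [gradient, Pi.add_apply]
  rw [fderiv_add (hφ.differentiable one_ne_zero x) (hψ.differentiable one_ne_zero x), map_add]

theorem gradient_smul_eq {d : ℕ} {φ : E d → ℝ} (c : ℝ) (hφ : ContDiff ℝ 1 φ) :
    gradient (c • φ) = c • gradient φ := by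
  funext x
  simp only [gradient, Pi.smul_apply]
  rw [fderiv_const_smul (hφ.differentiable one_ne_zero x)]
  simp

theorem HasTrace.zero {d : ℕ} (Ω : Set (E d)) : HasTrace Ω (0 : L2Pair Ω) 0 := by
  refine ⟨MemLp.zero, fun _ => 0, fun _ => contDiff_const, ?_, ?_, by simp⟩
  · have : ∀ n : ℕ, eLpNorm ((0 : E d → ℝ) - ((0 : L2Pair Ω).fst : E d → ℝ)) 2 (volume.restrict Ω) = 0 := by
      intro n
      rw [WithLp.zero_fst, eLpNorm_congr_ae (g := 0), eLpNorm_zero]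
      filter_upwards [Lp.coeFn_zero ℝ 2 (volume.restrict Ω)] with x hx
      rw [Pi.sub_apply, hx, Pi.zero_apply, sub_zero]
    exact tendsto_const_nhds.congr fun n => (this n).symm
  · have hg : gradient (0 : E d → ℝ) = 0 := by
      funext x
      simp [gradient]
    have : ∀ n : ℕ,
        eLpNorm (gradient (0 : E d → ℝ) - ((0 : L2Pair Ω).snd : E d → E d)) 2 (volume.restrict Ω) = 0 := by
      intro n
      rw [WithLp.zero_snd, hg, eLpNorm_congr_ae (g := 0), eLpNorm_zero]
      filter_upwards [Lp.coeFn_zero (E d) 2 (volume.restrict Ω)] with x hx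
      rw [Pi.sub_apply, hx, Pi.zero_apply, sub_zero]
    exact tendsto_const_nhds.congr fun n => (this n).symm

theorem HasTrace.add {d : ℕ} {Ω : Set (E d)} {v w : L2Pair Ω} {g h : E d → ℝ}
    (hv : HasTrace Ω v g) (hw : HasTrace Ω w h) : HasTrace Ω (v + w) (g + h) := by
  obtain ⟨mg, φ, c1, a1, a2, a3⟩ := hv
  obtain ⟨mh, ψ, c2, b1, b2, b3⟩ := hw
  refine ⟨mg.add mh, fun n => φ n + ψ n, fun n => (c1 n).add (c2 n), ?_, ?_, ?_⟩
  · exact tendsto_eLpNorm_add (fun n => (c1 n).continuous.aestronglyMeasurable)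
      (fun n => (c2 n).continuous.aestronglyMeasurable) (Lp.aestronglyMeasurable _)
      (Lp.aestronglyMeasurable _) (by rw [WithLp.add_fst]; exact Lp.coeFn_add _ _) a1 b1
  · simp only [gradient_add_eq (c1 _) (c2 _)]
    exact tendsto_eLpNorm_add (fun n => (continuous_gradient (c1 n)).aestronglyMeasurable)
      (fun n => (continuous_gradient (c2 n)).aestronglyMeasurable) (Lp.aestronglyMeasurable _)
      (Lp.aestronglyMeasurable _) (by rw [WithLp.add_snd]; exact Lp.coeFn_add _ _) a2 b2
  · exact tendsto_eLpNorm_add (fun n => (c1 n).continuous.aestronglyMeasurable)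
      (fun n => (c2 n).continuous.aestronglyMeasurable) mg.1 mh.1 (ae_eq_refl _) a3 b3

theorem HasTrace.smul {d : ℕ} {Ω : Set (E d)} {v : L2Pair Ω} {g : E d → ℝ} (c : ℝ)
    (hv : HasTrace Ω v g) : HasTrace Ω (c • v) (c • g) := by
  obtain ⟨mg, φ, c1, a1, a2, a3⟩ := hv
  refine ⟨mg.const_smul c, fun n => c • φ n, fun n => (c1 n).const_smul c, ?_, ?_, ?_⟩
  · exact tendsto_eLpNorm_smul c (by rw [WithLp.smul_fst]; exact Lp.coeFn_smul _ _) a1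
  · simp only [gradient_smul_eq c (c1 _)]
    exact tendsto_eLpNorm_smul c (by rw [WithLp.smul_snd]; exact Lp.coeFn_smul _ _) a2
  · exact tendsto_eLpNorm_smul c (ae_eq_refl _) a3

/-- `V = {v ∈ H¹(Ω) : v = 0 on Γ}` in the sense of traces, with the `H¹(Ω)` norm. -/
def V {d : ℕ} (Ω Γ : Set (E d)) : Submodule ℝ (L2Pair Ω) where
  carrier := {v | v ∈ H1 Ω ∧ ∃ g, HasTrace Ω v g ∧ ∀ᵐ x ∂(surfaceMeasure Ω), x ∈ Γ → g x = 0}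
  zero_mem' := ⟨(H1 Ω).zero_mem, 0, HasTrace.zero Ω, by simp⟩
  add_mem' := by
    rintro v w ⟨hv, g, hg, hg0⟩ ⟨hw, h, hh, hh0⟩
    refine ⟨(H1 Ω).add_mem hv hw, g + h, hg.add hh, ?_⟩
    filter_upwards [hg0, hh0] with x h1 h2 hx
    simp [h1 hx, h2 hx]
  smul_mem' := by
    rintro c v ⟨hv, g, hg, hg0⟩
    refine ⟨(H1 Ω).smul_mem c hv, c • g, hg.smul c, ?_⟩
    filter_upwards [hg0] with x h1 hx
    simp [h1 hx]

/-- A representative of the function underlying an element of a subspace `W` of `H¹(Ω)`. -/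
def fn {d : ℕ} {Ω : Set (E d)} {W : Submodule ℝ (L2Pair Ω)} (v : W) : E d → ℝ :=
  (v : L2Pair Ω).fst

/-- A representative of the weak gradient of an element of a subspace `W` of `H¹(Ω)`. -/
def grad {d : ℕ} {Ω : Set (E d)} {W : Submodule ℝ (L2Pair Ω)} (v : W) : E d → E d :=
  (v : L2Pair Ω).snd

/-! ### Data of the two-phase, two-component flow model -/

/-- The data of the model; the conditions on them are collected in `FlowData.Admissible`. -/
structure FlowData (d : ℕ) where
  /-- porous domain -/
  Ω : Set (E d)
  /-- Dirichlet part of the boundary -/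
  ΓD : Set (E d)
  /-- Neumann part of the boundary -/
  ΓN : Set (E d)
  /-- final time -/
  T : ℝ
  /-- porosity -/
  Φ : E d → ℝ
  /-- diffusion coefficient -/
  D : E d → ℝ
  /-- absolute permeability tensor -/
  K : E d → E d →L[ℝ] E d
  /-- liquid relative permeability, a function of the liquid saturation -/
  krl : ℝ → ℝ
  /-- gas relative permeability, a function of the liquid saturation -/
  krg : ℝ → ℝ
  /-- liquid viscosity -/
  μl : ℝ
  /-- gas viscosity -/
  μg : ℝ
  /-- capillary pressure, a function of the liquid saturation -/
  pc : ℝ → ℝ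
  /-- concentration of the dissolved gas as a function of the gas pseudo-pressure -/
  uhat : ℝ → ℝ
  /-- gas mass density as a function of the gas pseudo-pressure -/
  ρhat : ℝ → ℝ
  /-- standard density of the liquid component -/
  ρstd : ℝ
  /-- gravity acceleration -/
  gravity : E d
  /-- injection rate, as a function of `t` and `x` -/
  FI : ℝ → E d → ℝ
  /-- production rate, as a function of `t` and `x` -/
  FP : ℝ → E d → ℝ

namespace FlowData

variable {d : ℕ} (m : FlowData d)

/-- Lebesgue measure on `Ω`. -/
def vol : Measure (E d) := volume.restrict m.Ω

/-- Lebesgue measure on `(0,T)`. -/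
def time : Measure ℝ := volume.restrict (Ioo 0 m.T)

/-- Lebesgue measure on `Q_T`, as a set of pairs `(t, x)`. -/
def volQ : Measure (ℝ × E d) := m.time.prod m.vol

/-- The space `V = {φ ∈ H¹(Ω) : φ = 0 on Γ_D}`. -/
abbrev VD : Submodule ℝ (L2Pair m.Ω) := V m.Ω m.ΓD

/-- Liquid mobility. -/
def mobL (s : ℝ) : ℝ := m.krl s / m.μl

/-- Gas mobility. -/
def mobG (s : ℝ) : ℝ := m.krg s / m.μg

/-- Total mobility. -/
def mob (s : ℝ) : ℝ := m.mobL s + m.mobG s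

/-- The inverse of the capillary pressure curve, extended by one to nonpositive arguments. -/
def pcInv (σ : ℝ) : ℝ := if σ ≤ 0 then 1 else Function.invFunOn m.pc (Ioc 0 1) σ

/-- `γ = (λ_l λ_g / λ)^{1/2}`. -/
def γ (s : ℝ) : ℝ := Real.sqrt (m.mobL s * m.mobG s / m.mob s)

/-- `α = -γ p_c'`. -/
def α (s : ℝ) : ℝ := -(m.γ s * deriv m.pc s)

/-- `β(s) = ∫_0^s α`. -/
def β (s : ℝ) : ℝ := ∫ σ in (0 : ℝ)..s, m.α σ

/-- The liquid saturation as a function of the phase pressures. -/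
def sat (pl pg : ℝ) : ℝ := m.pcInv (pg - pl)

/-- The liquid density as a function of the gas pseudo-pressure. -/
def ρl (pg : ℝ) : ℝ := m.ρstd + m.uhat pg

/-- The total mass concentration of the gas component, `u S_l + ρ_g S_g`. -/
def gasMass (pl pg : ℝ) : ℝ :=
  m.uhat pg * m.sat pl pg + m.ρhat pg * (1 - m.sat pl pg)

/-- The global pressure `p = p_l - ∫_{S_l}^1 (λ_g / λ) p_c'`. -/
def globalPressure (pl pg : ℝ) : ℝ :=
  pl - ∫ s in (m.sat pl pg)..1, m.mobG s / m.mob s * deriv m.pc s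

/-- The conditions on the data. -/
structure Admissible : Prop where
  domain : IsBoundedLipschitzDomain m.Ω
  boundary : m.ΓD ∪ m.ΓN = frontier m.Ω
  boundary_disjoint : Disjoint m.ΓD m.ΓN
  measurable_ΓD : MeasurableSet m.ΓD
  ΓD_pos : 0 < surfaceMeasure m.Ω m.ΓD
  T_pos : 0 < m.T
  -- porosity and diffusion coefficient
  Φ_meas : AEStronglyMeasurable m.Φ m.vol
  Φ_bounds : ∃ φm φM : ℝ, 0 < φm ∧ φm ≤ φM ∧ ∀ᵐ x ∂m.vol, φm ≤ m.Φ x ∧ m.Φ x ≤ φM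
  D_mem : MemLp m.D ∞ m.vol
  D_lower : ∃ D0 : ℝ, 0 < D0 ∧ ∀ᵐ x ∂m.vol, D0 ≤ m.D x
  -- permeability tensor
  K_mem : MemLp m.K ∞ m.vol
  K_bounds : ∃ km kM : ℝ, 0 < km ∧ km ≤ kM ∧ ∀ᵐ x ∂m.vol, ∀ ξ : E d,
    km * ‖ξ‖ ^ 2 ≤ inner ℝ (m.K x ξ) ξ ∧ inner ℝ (m.K x ξ) ξ ≤ kM * ‖ξ‖ ^ 2
  -- relative permeabilities and viscosities
  μl_pos : 0 < m.μl
  μg_pos : 0 < m.μg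
  krl_cont : ContinuousOn m.krl (Icc 0 1)
  krg_cont : ContinuousOn m.krg (Icc 0 1)
  krl_zero : m.krl 0 = 0
  krg_one : m.krg 1 = 0
  krl_mono : MonotoneOn m.krl (Icc 0 1)
  krg_anti : AntitoneOn m.krg (Icc 0 1)
  kr_lower : ∃ krm : ℝ, 0 < krm ∧ ∀ s ∈ Icc (0 : ℝ) 1, krm ≤ m.krl s + m.krg s
  krl_lower : ∃ al : ℝ, 0 < al ∧ ∀ s ∈ Icc (0 : ℝ) 1, al * s ^ 2 ≤ m.krl s
  -- capillary pressure; it maps `(0,1]` onto `[0,∞)`, so that its inverse is defined there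
  pc_contDiffOn : ContDiffOn ℝ 1 m.pc (Ioo 0 1)
  pc_cont : ContinuousOn m.pc (Ioc 0 1)
  pc_anti : StrictAntiOn m.pc (Ioc 0 1)
  pc_one : m.pc 1 = 0
  pc_pos : ∀ s ∈ Ioo (0 : ℝ) 1, 0 < m.pc s
  pc_deriv : ∃ M0 : ℝ, 0 < M0 ∧ ∀ s ∈ Ioo (0 : ℝ) 1, deriv m.pc s ≤ -M0
  pc_integrable : IntervalIntegrable m.pc volume 0 1
  pc_atTop : Tendsto m.pc (𝓝[>] 0) atTop
  -- dissolved gas concentration, with its extension to negative pseudo-pressures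
  uhat_contDiff : ContDiff ℝ 1 m.uhat
  uhat_zero : m.uhat 0 = 0
  uhat_strictMonoOn : StrictMonoOn m.uhat (Ici 0)
  uhat_bounded : ∃ umax : ℝ, 0 < umax ∧ ∀ σ : ℝ, 0 ≤ σ → |m.uhat σ| ≤ umax
  uhat_deriv : ∃ Mg : ℝ, 0 < Mg ∧ ∀ σ : ℝ, 0 ≤ σ → 0 < deriv m.uhat σ ∧ deriv m.uhat σ ≤ Mg
  uhat_neg : ∀ σ : ℝ, σ < 0 → m.uhat σ < 0
  uhat_lower : ∃ umin : ℝ, 0 < umin ∧ umin < m.ρstd ∧ ∀ σ : ℝ, σ < 0 → -umin ≤ m.uhat σ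
  ρstd_pos : 0 < m.ρstd
  -- gas density
  ρhat_cont : Continuous m.ρhat
  ρhat_strictMonoOn : StrictMonoOn m.ρhat (Ici 0)
  ρhat_nonpos : ∀ σ : ℝ, σ ≤ 0 → m.ρhat σ = 0
  ρhat_bounded : ∃ ρM : ℝ, 0 < ρM ∧ ∀ σ : ℝ, 0 ≤ σ → 0 ≤ m.ρhat σ ∧ m.ρhat σ ≤ ρM
  -- sources
  FI_mem : MemLp (Function.uncurry m.FI) 2 m.volQ
  FP_mem : MemLp (Function.uncurry m.FP) 2 m.volQ
  FI_nonneg : ∀ᵐ z ∂m.volQ, 0 ≤ m.FI z.1 z.2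
  FP_nonneg : ∀ᵐ z ∂m.volQ, 0 ≤ m.FP z.1 z.2
  -- `α` extends to a continuous function on `[0,1]` which vanishes exactly at the end points
  α_zero : Tendsto m.α (𝓝[>] 0) (𝓝 0)
  α_one : Tendsto m.α (𝓝[<] 1) (𝓝 0)
  α_pos : ∀ s ∈ Ioo (0 : ℝ) 1, 0 < m.α s

/-! ### The time-discrete regularized problem -/

/-- The mean value of `F(·, x)` over the time interval `((k-1)δt, kδt]`. -/
def timeAvg (F : ℝ → E d → ℝ) (δt : ℝ) (k : ℕ) (x : E d) : ℝ :=
  δt⁻¹ * ∫ t in (((k : ℝ) - 1) * δt)..(k * δt), F t x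

/-- `(pl, pg)` solves the `k`-th elliptic problem of the time discretization with step `δt` of the
`η`-regularized system, `plPrev`, `pgPrev` being the pressures at time level `k - 1`.
The condition that the concentration `û(pg)` has a representative `u` in `V` gives `∇u` its
meaning. -/
def IsDiscreteSolution (η δt : ℝ) (k : ℕ) (plPrev pgPrev : E d → ℝ) (pl pg : m.VD) : Prop :=
  ∃ u : m.VD, (fn u =ᵐ[m.vol] fun x => m.uhat (fn pg x)) ∧
  let S : E d → ℝ := fun x => m.sat (fn pl x) (fn pg x)
  let SPrev : E d → ℝ := fun x => m.sat (plPrev x) (pgPrev x)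
  let ρL : E d → ℝ := fun x => m.ρl (fn pg x)
  let ρG : E d → ℝ := fun x => m.ρhat (fn pg x)
  let R : E d → ℝ := fun x => m.gasMass (fn pl x) (fn pg x)
  let RPrev : E d → ℝ := fun x => m.gasMass (plPrev x) (pgPrev x)
  (∀ φ : m.VD,
    δt⁻¹ * ∫ x, m.Φ x * (S x - SPrev x) * fn φ x ∂m.vol
    + ∫ x, inner ℝ (m.mobL (S x) • m.K x (grad pl x)
        - (m.Φ x * S x * (ρL x)⁻¹ * m.D x) • grad u x) (grad φ x) ∂m.vol
    - η * ∫ x, inner ℝ (grad pg x - grad pl x) (grad φ x) ∂m.vol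
    + ∫ x, S x * timeAvg m.FP δt k x * fn φ x ∂m.vol
    = ∫ x, timeAvg m.FI δt k x * fn φ x ∂m.vol
    + ∫ x, inner ℝ ((ρL x * m.mobL (S x)) • m.K x m.gravity) (grad φ x) ∂m.vol) ∧
  (∀ ψ : m.VD,
    δt⁻¹ * ∫ x, m.Φ x * (R x - RPrev x) * fn ψ x ∂m.vol
    + ∫ x, inner ℝ ((fn u x * m.mobL (S x)) • m.K x (grad pl x)
        + (ρG x * m.mobG (S x)) • m.K x (grad pg x)) (grad ψ x) ∂m.vol
    + ∫ x, inner ℝ ((m.Φ x * S x * (m.ρstd / ρL x) * m.D x) • grad u x) (grad ψ x) ∂m.vol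
    + η * ∫ x, inner ℝ ((ρG x - fn u x) • (grad pg x - grad pl x)) (grad ψ x) ∂m.vol
    + ∫ x, R x * timeAvg m.FP δt k x * fn ψ x ∂m.vol
    = ∫ x, inner ℝ ((ρL x * fn u x * m.mobL (S x) + ρG x ^ 2 * m.mobG (S x)) •
        m.K x m.gravity) (grad ψ x) ∂m.vol)

/-! ### Weak solutions of the evolution problem -/

/-- `ξ = Φ ∂_t w` as a `V'`-valued distribution on `(0,T)`. -/
def IsWeightedTimeDeriv (w : ℝ → E d → ℝ) (ξ : ℝ → m.VD →L[ℝ] ℝ) : Prop :=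
  ∀ ζ : ℝ → ℝ, ContDiff ℝ ∞ ζ → HasCompactSupport ζ → tsupport ζ ⊆ Ioo 0 m.T → ∀ ψ : m.VD,
    ∫ t, ζ t * ξ t ψ ∂m.time
      = -∫ t, deriv ζ t * ∫ x, m.Φ x * w t x * fn ψ x ∂m.vol ∂m.time

/-- For every `ψ ∈ V` the function `t ↦ ∫_Ω Φ w(t) ψ` is (after modification on a null set)
continuous on `[0,T]`, with value `∫_Ω Φ w₀ ψ` at `t = 0`. -/
def HasWeakInitialValue (w : ℝ → E d → ℝ) (w0 : E d → ℝ) : Prop :=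
  ∀ ψ : m.VD, ∃ c : ℝ → ℝ, ContinuousOn c (Icc 0 m.T) ∧
    (∀ᵐ t ∂m.time, c t = ∫ x, m.Φ x * w t x * fn ψ x ∂m.vol) ∧
    c 0 = ∫ x, m.Φ x * w0 x * fn ψ x ∂m.vol

/-- `(pl, pg)` is a weak solution of the two-phase, two-component flow problem with initial
pressures `pl0`, `pg0`. Here `p`, `u`, `b` are the global pressure, the dissolved gas concentration
and `β(S_l)`, and the degenerate products `λ_l ∇p_l` and `λ_g ∇p_g` stand, as usual, for
`λ_l ∇p + γ ∇b` and `λ_g ∇p - γ ∇b`; `ξS` and `ξR` are `Φ ∂_t S_l` and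
`Φ ∂_t (u S_l + ρ_g S_g)`. -/
def IsWeakSolution (pl0 pg0 : E d → ℝ) (pl pg : ℝ → E d → ℝ) : Prop :=
  ∃ (p u : ℝ → m.VD) (b : ℝ → H1 m.Ω) (ξS ξR : ℝ → m.VD →L[ℝ] ℝ),
  let S : ℝ → E d → ℝ := fun t x => m.sat (pl t x) (pg t x)
  let ρL : ℝ → E d → ℝ := fun t x => m.ρl (pg t x)
  let ρG : ℝ → E d → ℝ := fun t x => m.ρhat (pg t x)
  let R : ℝ → E d → ℝ := fun t x => m.gasMass (pl t x) (pg t x)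
  let flowL : ℝ → E d → E d := fun t x =>
    m.mobL (S t x) • grad (p t) x + m.γ (S t x) • grad (b t) x
  let flowG : ℝ → E d → E d := fun t x =>
    m.mobG (S t x) • grad (p t) x - m.γ (S t x) • grad (b t) x
  MemLp (Function.uncurry pl) 2 m.volQ ∧ MemLp (Function.uncurry pg) 2 m.volQ ∧
  MemLp p 2 m.time ∧ MemLp u 2 m.time ∧ MemLp b 2 m.time ∧
  (∀ᵐ t ∂m.time, fn (p t) =ᵐ[m.vol] fun x => m.globalPressure (pl t x) (pg t x)) ∧
  (∀ᵐ t ∂m.time, fn (u t) =ᵐ[m.vol] fun x => m.uhat (pg t x)) ∧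
  (∀ᵐ t ∂m.time, fn (b t) =ᵐ[m.vol] fun x => m.β (S t x)) ∧
  MemLp ξS 2 m.time ∧ m.IsWeightedTimeDeriv S ξS ∧
  MemLp ξR 2 m.time ∧ m.IsWeightedTimeDeriv R ξR ∧
  (∀ φ : ℝ → m.VD, MemLp φ 2 m.time →
    ∫ t, ξS t (φ t) ∂m.time
    + ∫ t, ∫ x, inner ℝ (m.K x (flowL t x)
        - (m.Φ x * S t x * (ρL t x)⁻¹ * m.D x) • grad (u t) x) (grad (φ t) x) ∂m.vol ∂m.time
    + ∫ t, ∫ x, S t x * m.FP t x * fn (φ t) x ∂m.vol ∂m.time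
    = ∫ t, ∫ x, m.FI t x * fn (φ t) x ∂m.vol ∂m.time
    + ∫ t, ∫ x, inner ℝ ((ρL t x * m.mobL (S t x)) • m.K x m.gravity)
        (grad (φ t) x) ∂m.vol ∂m.time) ∧
  (∀ ψ : ℝ → m.VD, MemLp ψ 2 m.time →
    ∫ t, ξR t (ψ t) ∂m.time
    + ∫ t, ∫ x, inner ℝ (fn (u t) x • m.K x (flowL t x) + ρG t x • m.K x (flowG t x)
        + (m.Φ x * S t x * (m.ρstd / ρL t x) * m.D x) • grad (u t) x)
        (grad (ψ t) x) ∂m.vol ∂m.time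
    + ∫ t, ∫ x, R t x * m.FP t x * fn (ψ t) x ∂m.vol ∂m.time
    = ∫ t, ∫ x, inner ℝ ((ρL t x * fn (u t) x * m.mobL (S t x)
        + ρG t x ^ 2 * m.mobG (S t x)) • m.K x m.gravity) (grad (ψ t) x) ∂m.vol ∂m.time) ∧
  m.HasWeakInitialValue S (fun x => m.sat (pl0 x) (pg0 x)) ∧
  m.HasWeakInitialValue R (fun x => m.gasMass (pl0 x) (pg0 x))

end FlowData

end TwoPhase

end

noncomputable section

namespace TwoPhase

/-! ### Superposition operators -/

/-! Since `û` has the sign of its argument, it suffices to show `u⁻ = 0`. Where `u < 0` the gas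
density vanishes, so the gas mass is `r = u S_l`, and the gas flux is `u` times the liquid flux plus
diffusion. The gas equation is tested with `h(u)` and the liquid equation with `H(u)`, where `h(s) =
-(s⁻)²/2` and `H(s) = (s⁻)³/3`. The choice is governed by `H' = s h'`: in the difference of the two
tested equations every flux carried along by the liquid (convection, gravity, the `η` terms) cancels
pointwise, whatever its form. What remains is the diffusion, with integrand `Φ S_l D u⁻ |∇u|² ≥ 0`
because `ρ_l = ρ_l^std + u`. This is `flux_difference_nonneg`.

The other terms involve the convex function `E(s) = s h(s) - H(s) = (s⁻)³/6`, for which `E' = h`.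
Production contributes `F_P S_l E(u) ≥ 0`, and injection contributes `F_I H(u) ≥ 0` on the same
side. For the time terms, convexity of `E` and `r ≥ u S_l` at the earlier time give `(r - r') h(u) -
(S - S') H(u) ≥ S E(u) - S' E(u')` (`negEnergy_step`). At a discrete step `E(u') = 0`, so `∫ Φ S_l
E(u) ≤ 0`. As `S_l > 0` everywhere, `E(u) = 0`, that is `u ≥ 0`.

In the continuous case no time derivative of `u` is available, only those of `Φ S_l` and `Φ r` in
`V'`. The time terms are therefore obtained as limits of backward difference quotients
(`tendsto_difference_quotient`), to which `negEnergy_step` applies for each step `δ`. The test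
functions carry the weight `e^{-t}`. Shifting time by `δ` then costs a factor `e^{-δ}`, so the
differences dominate `(1 - e^{-δ}) ∫ e^{-t} Φ S_l E(u)`. Dividing by `δ` and letting `δ → 0` bounds
the whole space-time energy, without values at individual times.

Two supporting facts are needed. `h(u)` and `H(u)` must be admissible test functions: `h` and `H`
are `C¹`, and truncating their derivatives at a height `c` with `û ≥ -c` makes them globally
Lipschitz without changing them on the range of `u`. Moreover, gradients given separately at each
time must have jointly measurable representatives (`exists_jointRep`), so that the tested equations
become integrals over `Q_T` and can be compared pointwise. -/

theorem tendsto_eLpNorm_dominated {α F : Type*} [MeasurableSpace α] [NormedAddCommGroup F]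
    {μ : Measure α} {f : ℕ → α → F} {bound : α → ℝ} (hf : ∀ n, AEStronglyMeasurable (f n) μ)
    (hb : MemLp bound 2 μ) (h_bound : ∀ n, ∀ᵐ x ∂μ, ‖f n x‖ ≤ bound x)
    (h_lim : ∀ᵐ x ∂μ, Tendsto (fun n => f n x) atTop (𝓝 0)) :
    Tendsto (fun n => eLpNorm (f n) 2 μ) atTop (𝓝 0) := by
  have h2 : (2 : ℝ≥0∞).toReal = 2 := by norm_num
  simp only [eLpNorm_eq_lintegral_rpow_enorm_toReal two_ne_zero ENNReal.ofNat_ne_top, h2]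
  have hfin : ∫⁻ x, ‖bound x‖ₑ ^ (2 : ℝ) ∂μ ≠ ⊤ := by
    have := lintegral_rpow_enorm_lt_top_of_eLpNorm_lt_top two_ne_zero ENNReal.ofNat_ne_top
      hb.eLpNorm_lt_top
    rw [h2] at this
    exact this.ne
  have key : Tendsto (fun n => ∫⁻ x, ‖f n x‖ₑ ^ (2 : ℝ) ∂μ) atTop (𝓝 (∫⁻ _, 0 ∂μ)) := by
    refine tendsto_lintegral_of_dominated_convergence' (fun x => ‖bound x‖ₑ ^ (2 : ℝ))
      (fun n => (hf n).enorm.pow_const _) (fun n => ?_) hfin ?_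
    · filter_upwards [h_bound n] with x hx
      refine ENNReal.rpow_le_rpow ?_ (by norm_num)
      rw [enorm_le_iff_norm_le]
      exact hx.trans (le_abs_self _)
    · filter_upwards [h_lim] with x hx
      have h0 : Tendsto (fun n => ‖f n x‖ₑ) atTop (𝓝 0) := by simpa using hx.enorm
      simpa using h0.ennrpow_const 2
  simp only [lintegral_zero] at key
  simpa using key.ennrpow_const (1 / 2)

/-- The difference splits as `g(a_n)(b_n - b') + (g(a_n) - g(a')) b'`. Boundedness of `g` handles
the first term. In the second, `g` is merely continuous, so every subsequence is thinned until `a_n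
→ a'` almost everywhere, and dominated convergence with majorant `2C‖b'‖` applies. This is the
continuity of the chain-rule gradient `g(f)∇f` in `L²`. -/
theorem tendsto_eLpNorm_comp_smul {α F : Type*} [MeasurableSpace α] [NormedAddCommGroup F]
    [NormedSpace ℝ F] {μ : Measure α} {g : ℝ → ℝ} {C : ℝ} (hg : Continuous g)
    (hC : ∀ s, |g s| ≤ C) {a : ℕ → α → ℝ} {a' : α → ℝ} {b : ℕ → α → F} {b' : α → F}
    (ha : ∀ n, AEStronglyMeasurable (a n) μ) (ha' : AEStronglyMeasurable a' μ)
    (hb : ∀ n, AEStronglyMeasurable (b n) μ) (hb' : MemLp b' 2 μ)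
    (h1 : Tendsto (fun n => eLpNorm (a n - a') 2 μ) atTop (𝓝 0))
    (h2 : Tendsto (fun n => eLpNorm (b n - b') 2 μ) atTop (𝓝 0)) :
    Tendsto (fun n => eLpNorm (fun x => g (a n x) • b n x - g (a' x) • b' x) 2 μ) atTop (𝓝 0) := by
  have hA : Tendsto (fun n => eLpNorm (fun x => g (a n x) • (b n x - b' x)) 2 μ) atTop (𝓝 0) := by
    refine tendsto_of_tendsto_of_tendsto_of_le_of_le (h := fun n =>
      ENNReal.ofReal C * eLpNorm (b n - b') 2 μ) tendsto_const_nhds ?_ (fun _ => zero_le)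
      (fun n => ?_)
    · simpa using ENNReal.Tendsto.const_mul h2 (Or.inr ENNReal.ofReal_ne_top)
    · refine eLpNorm_le_mul_eLpNorm_of_ae_le_mul (.of_forall fun x => ?_) 2
      rw [norm_smul]
      exact mul_le_mul_of_nonneg_right (hC _) (norm_nonneg _)
  have hB : Tendsto (fun n => eLpNorm (fun x => (g (a n x) - g (a' x)) • b' x) 2 μ) atTop
      (𝓝 0) := by
    refine tendsto_of_subseq_tendsto fun ns hns => ?_
    have hm : TendstoInMeasure μ (fun n => a (ns n)) atTop a' :=
      tendstoInMeasure_of_tendsto_eLpNorm two_ne_zero (fun n => ha _) ha' (h1.comp hns)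
    obtain ⟨ms, -, hms⟩ := hm.exists_seq_tendsto_ae
    refine ⟨ms, tendsto_eLpNorm_dominated (bound := fun x => 2 * C * ‖b' x‖) (fun n => ?_)
      (hb'.norm.const_mul _) (fun n => .of_forall fun x => ?_) ?_⟩
    · exact ((hg.comp_aestronglyMeasurable (ha _)).sub (hg.comp_aestronglyMeasurable ha')).smul
        hb'.1
    · rw [norm_smul]
      refine mul_le_mul_of_nonneg_right ?_ (norm_nonneg _)
      have := abs_sub (g (a (ns (ms n)) x)) (g (a' x))
      rw [Real.norm_eq_abs]
      linarith [hC (a (ns (ms n)) x), hC (a' x)]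
    · filter_upwards [hms] with x hx
      have : Tendsto (fun n => g (a (ns (ms n)) x) - g (a' x)) atTop (𝓝 (g (a' x) - g (a' x))) :=
        ((hg.tendsto _).comp hx).sub tendsto_const_nhds
      simpa using this.smul_const (b' x)
  refine tendsto_of_tendsto_of_tendsto_of_le_of_le tendsto_const_nhds (by simpa using hA.add hB)
    (fun _ => zero_le) (fun n => ?_)
  have : (fun x => g (a n x) • b n x - g (a' x) • b' x)
      = (fun x => g (a n x) • (b n x - b' x)) + fun x => (g (a n x) - g (a' x)) • b' x := by
    funext x
    simp only [Pi.add_apply, smul_sub, sub_smul]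
    abel
  rw [this]
  exact eLpNorm_add_le ((hg.comp_aestronglyMeasurable (ha _)).smul ((hb n).sub hb'.1))
    (((hg.comp_aestronglyMeasurable (ha _)).sub (hg.comp_aestronglyMeasurable ha')).smul hb'.1)
    (by norm_num)

/-- `g` is the bounded continuous derivative of `G`, and `G` vanishes at the origin. -/
structure IsC1Lip (G g : ℝ → ℝ) (C : ℝ) : Prop where
  cont : Continuous g
  bound : ∀ s, |g s| ≤ C
  deriv : ∀ s, HasDerivAt G (g s) s
  zero : G 0 = 0

/-! ### Composition with `C¹` functions of bounded derivative -/

namespace IsC1Lip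

variable {G g : ℝ → ℝ} {C : ℝ}

theorem contDiff (h : IsC1Lip G g C) : ContDiff ℝ 1 G := by
  rw [contDiff_one_iff_deriv]
  refine ⟨fun s => (h.deriv s).differentiableAt, ?_⟩
  have : _root_.deriv G = g := funext fun s => (h.deriv s).deriv
  rw [this]
  exact h.cont

theorem abs_sub_le (h : IsC1Lip G g C) (s t : ℝ) : |G s - G t| ≤ C * |s - t| := by
  have := Convex.norm_image_sub_le_of_norm_hasDerivWithin_le (f := G) (f' := g) (s := univ)
    (x := t) (y := s) (fun x _ => (h.deriv x).hasDerivWithinAt) (fun x _ => h.bound x) convex_univ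
    (mem_univ _) (mem_univ _)
  simpa using this

theorem abs_le (h : IsC1Lip G g C) (s : ℝ) : |G s| ≤ C * |s| := by
  simpa [h.zero] using h.abs_sub_le s 0

theorem memLp_comp {α : Type*} [MeasurableSpace α] {μ : Measure α} (h : IsC1Lip G g C)
    {p : ℝ≥0∞} {f : α → ℝ} (hf : MemLp f p μ) : MemLp (fun x => G (f x)) p μ :=
  hf.of_le_mul (c := C) (h.contDiff.continuous.comp_aestronglyMeasurable hf.1)
    (.of_forall fun x => h.abs_le (f x))

theorem memLp_smul {α F : Type*} [MeasurableSpace α] [NormedAddCommGroup F] [NormedSpace ℝ F]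
    {μ : Measure α} (h : IsC1Lip G g C) {f : α → ℝ} (hf : AEStronglyMeasurable f μ) {b : α → F}
    (hb : MemLp b 2 μ) : MemLp (fun x => g (f x) • b x) 2 μ := by
  refine hb.of_le_mul (c := C) ((h.cont.comp_aestronglyMeasurable hf).smul hb.1)
    (.of_forall fun x => ?_)
  rw [norm_smul]
  exact mul_le_mul_of_nonneg_right (h.bound _) (norm_nonneg _)

theorem tendsto_comp {α : Type*} [MeasurableSpace α] {μ : Measure α} (h : IsC1Lip G g C)
    {f : ℕ → α → ℝ} {f' : α → ℝ} (hf : Tendsto (fun n => eLpNorm (f n - f') 2 μ) atTop (𝓝 0)) :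
    Tendsto (fun n => eLpNorm ((fun x => G (f n x)) - fun x => G (f' x)) 2 μ) atTop (𝓝 0) := by
  refine tendsto_of_tendsto_of_tendsto_of_le_of_le (h := fun n =>
    ENNReal.ofReal C * eLpNorm (f n - f') 2 μ) tendsto_const_nhds ?_ (fun _ => zero_le)
    (fun n => ?_)
  · simpa using ENNReal.Tendsto.const_mul hf (Or.inr ENNReal.ofReal_ne_top)
  · exact eLpNorm_le_mul_eLpNorm_of_ae_le_mul (.of_forall fun x => h.abs_sub_le _ _) 2

theorem gradient_comp {d : ℕ} (h : IsC1Lip G g C) {φ : E d → ℝ} (hφ : ContDiff ℝ 1 φ) (x : E d) :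
    gradient (fun y => G (φ y)) x = g (φ x) • gradient φ x := by
  have h1 := (h.deriv (φ x)).comp_hasFDerivAt x
    (hφ.differentiable one_ne_zero x).hasFDerivAt
  have h2 : fderiv ℝ (fun y => G (φ y)) x = g (φ x) • fderiv ℝ φ x := h1.fderiv
  simp only [gradient]
  rw [h2]
  simp

end IsC1Lip

/-- Integration by parts for a `C¹` function against a test function supported in `Ω`. -/
theorem isWeakGrad_of_contDiff {d : ℕ} {Ω : Set (E d)} {f : E d → ℝ} (hf : ContDiff ℝ 1 f) :
    IsWeakGrad Ω f (gradient f) := by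
  intro φ h1 h2 h3
  have hφ : ContDiff ℝ 1 φ := h1.of_le (by exact_mod_cast le_top)
  have cg := hasCompactSupport_gradient h2
  have i1 : Integrable (fun x => f x • gradient φ x) volume :=
    (hf.continuous.smul (continuous_gradient hφ)).integrable_of_hasCompactSupport cg.smul_left
  have i2 : Integrable (fun x => φ x • gradient f x) volume :=
    (hφ.continuous.smul (continuous_gradient hf)).integrable_of_hasCompactSupport h2.smul_right
  have i3 : Integrable (fun x => f x * φ x) volume :=
    (hf.continuous.mul hφ.continuous).integrable_of_hasCompactSupport h2.mul_left
  -- The support of `φ` lies in `Ω`, so both integrals extend to the whole space and no boundary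
  -- term can appear.
  have e1 : ∫ x in Ω, f x • gradient φ x = ∫ x, f x • gradient φ x := by
    refine setIntegral_eq_integral_of_forall_compl_eq_zero fun x hx => ?_
    have : gradient φ x = 0 := by
      simp only [gradient]
      rw [fderiv_of_notMem_tsupport ℝ (fun h => hx (h3 h)), map_zero]
    rw [this, smul_zero]
  have e2 : ∫ x in Ω, φ x • gradient f x = ∫ x, φ x • gradient f x := by
    refine setIntegral_eq_integral_of_forall_compl_eq_zero fun x hx => ?_
    rw [image_eq_zero_of_notMem_tsupport (fun h => hx (h3 h)), zero_smul]
  rw [e1, e2]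
  -- Pairing with a fixed vector reduces the identity to scalar integration by parts for directional
  -- derivatives.
  refine ext_inner_left ℝ fun v => ?_
  rw [inner_neg_right, ← integral_inner i1, ← integral_inner i2]
  have hv : ∀ (k : E d → ℝ) (x : E d), inner ℝ v (gradient k x) = fderiv ℝ k x v := by
    intro k x
    rw [real_inner_comm, gradient]
    exact InnerProductSpace.toDual_symm_apply
  simp only [inner_smul_right, hv]
  have := integral_mul_fderiv_eq_neg_fderiv_mul_of_integrable (μ := (volume : Measure (E d)))
    (f := f) (g := φ) (v := v) ?_ ?_ i3
    (fun x _ => hf.differentiable one_ne_zero x) (fun x _ => hφ.differentiable one_ne_zero x)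
  · rw [this]
    simp only [mul_comm]
  · have := i2.const_inner v (𝕜 := ℝ)
    simpa only [inner_smul_right, hv, mul_comm] using this
  · have := i1.const_inner v (𝕜 := ℝ)
    simpa only [inner_smul_right, hv] using this

/-- Weak gradients pass to limits in `L²`. -/
theorem isWeakGrad_of_tendsto {d : ℕ} {Ω : Set (E d)} {f : E d → ℝ} {F : E d → E d}
    {φ : ℕ → E d → ℝ} (hf : MemLp f 2 (volume.restrict Ω)) (hF : MemLp F 2 (volume.restrict Ω))
    (hφ : ∀ n, ContDiff ℝ 1 (φ n))
    (h1 : Tendsto (fun n => eLpNorm (φ n - f) 2 (volume.restrict Ω)) atTop (𝓝 0))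
    (h2 : Tendsto (fun n => eLpNorm (gradient (φ n) - F) 2 (volume.restrict Ω)) atTop (𝓝 0)) :
    IsWeakGrad Ω f F := by
  intro χ c1 c2 c3
  have hχ : ContDiff ℝ 1 χ := c1.of_le (by exact_mod_cast le_top)
  have cg := hasCompactSupport_gradient c2
  have mχ : MemLp χ 2 (volume.restrict Ω) :=
    (hχ.continuous.memLp_of_hasCompactSupport (p := 2) (μ := volume) c2).restrict Ω
  have mg : MemLp (gradient χ) 2 (volume.restrict Ω) :=
    ((continuous_gradient hχ).memLp_of_hasCompactSupport (p := 2) (μ := volume) cg).restrict Ω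
  have t1 : Tendsto (fun n => ∫ x in Ω, φ n x • gradient χ x) atTop
      (𝓝 (∫ x in Ω, f x • gradient χ x)) := by
    refine tendsto_integral_of_L1' _ (hf.1.smul mg.1) (.of_forall fun n => ?_) ?_
    · exact (((hφ n).continuous.smul (continuous_gradient hχ)).integrable_of_hasCompactSupport
        cg.smul_left).restrict
    · refine tendsto_of_tendsto_of_tendsto_of_le_of_le (h := fun n =>
        eLpNorm (φ n - f) 2 (volume.restrict Ω) * eLpNorm (gradient χ) 2 (volume.restrict Ω))
        tendsto_const_nhds ?_ (fun _ => zero_le) (fun n => ?_)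
      · simpa using ENNReal.Tendsto.mul_const h1 (Or.inr mg.2.ne)
      · have : ((fun x => φ n x • gradient χ x) - f • gradient χ)
            = (φ n - f) • gradient χ := by
          funext x
          simp [sub_smul]
        rw [this]
        exact eLpNorm_smul_le_mul_eLpNorm mg.1
          ((hφ n).continuous.aestronglyMeasurable.sub hf.1)
  have t2 : Tendsto (fun n => ∫ x in Ω, χ x • gradient (φ n) x) atTop
      (𝓝 (∫ x in Ω, χ x • F x)) := by
    refine tendsto_integral_of_L1' _ (mχ.1.smul hF.1) (.of_forall fun n => ?_) ?_
    · exact ((hχ.continuous.smul (continuous_gradient (hφ n))).integrable_of_hasCompactSupport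
        c2.smul_right).restrict
    · refine tendsto_of_tendsto_of_tendsto_of_le_of_le (h := fun n =>
        eLpNorm χ 2 (volume.restrict Ω) * eLpNorm (gradient (φ n) - F) 2 (volume.restrict Ω))
        tendsto_const_nhds ?_ (fun _ => zero_le) (fun n => ?_)
      · simpa using ENNReal.Tendsto.const_mul h2 (Or.inr mχ.2.ne)
      · have : ((fun x => χ x • gradient (φ n) x) - χ • F)
            = χ • (gradient (φ n) - F) := by
          funext x
          simp [smul_sub]
        rw [this]
        exact eLpNorm_smul_le_mul_eLpNorm
          ((continuous_gradient (hφ n)).aestronglyMeasurable.sub hF.1) mχ.1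
  refine tendsto_nhds_unique t1 ?_
  simp only [isWeakGrad_of_contDiff (Ω := Ω) (hφ _) χ c1 c2 c3]
  exact t2.neg

/-! ### Superposition on `H¹(Ω)` and on `V` -/

variable {d : ℕ} {Ω Γ : Set (E d)} {G g : ℝ → ℝ} {C : ℝ}

/-- The pair `(G ∘ f, g(f) ∇f)`. -/
def superposition (h : IsC1Lip G g C) (v : L2Pair Ω) : L2Pair Ω :=
  WithLp.toLp 2 ((h.memLp_comp (Lp.memLp v.fst)).toLp _,
    (h.memLp_smul (Lp.aestronglyMeasurable v.fst) (Lp.memLp v.snd)).toLp _)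

theorem superposition_fst (h : IsC1Lip G g C) (v : L2Pair Ω) :
    (superposition h v).fst =ᵐ[volume.restrict Ω] fun x => G (v.fst x) :=
  MemLp.coeFn_toLp (h.memLp_comp (Lp.memLp v.fst))

theorem superposition_snd (h : IsC1Lip G g C) (v : L2Pair Ω) :
    (superposition h v).snd =ᵐ[volume.restrict Ω] fun x => g (v.fst x) • v.snd x :=
  MemLp.coeFn_toLp (h.memLp_smul (Lp.aestronglyMeasurable v.fst) (Lp.memLp v.snd))

/-- Continuity serves measurability in time: it makes `t ↦ G(u(t))` strongly measurable with values
in `V` whenever `u` is. -/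
theorem continuous_superposition (h : IsC1Lip G g C) :
    Continuous (superposition (Ω := Ω) h) := by
  rw [continuous_iff_seqContinuous]
  intro v w hv
  have c1 : Continuous (fun v : L2Pair Ω => v.fst) := by fun_prop
  have c2 : Continuous (fun v : L2Pair Ω => v.snd) := by fun_prop
  have v1 := (Lp.tendsto_Lp_iff_tendsto_eLpNorm' _ _).1 ((c1.tendsto w).comp hv)
  have v2 := (Lp.tendsto_Lp_iff_tendsto_eLpNorm' _ _).1 ((c2.tendsto w).comp hv)
  refine ((WithLp.prod_continuous_toLp 2 _ _).tendsto _).comp (Tendsto.prodMk_nhds ?_ ?_)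
  · rw [Lp.tendsto_Lp_iff_tendsto_eLpNorm'']
    exact h.tendsto_comp v1
  · rw [Lp.tendsto_Lp_iff_tendsto_eLpNorm'']
    exact tendsto_eLpNorm_comp_smul h.cont h.bound (fun n => Lp.aestronglyMeasurable _)
      (Lp.aestronglyMeasurable _) (fun n => Lp.aestronglyMeasurable _) (Lp.memLp _) v1 v2

/-- If `C¹` functions `φ_n` approximate `v` in `H¹(Ω)` and on the boundary, then the functions `G ∘
φ_n` are again `C¹` and approximate `G ∘ v` in the same sense. The chain rule for weak gradients
comes from the same approximation by passing to the limit. That `G` is `C¹`, not just Lipschitz,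
keeps the approximants in the admissible class. -/
theorem HasTrace.superposition (h : IsC1Lip G g C) {v : L2Pair Ω} {k : E d → ℝ}
    (hv : HasTrace Ω v k) : HasTrace Ω (superposition h v) (fun x => G (k x)) ∧
      IsWeakGrad Ω (TwoPhase.superposition h v).fst (TwoPhase.superposition h v).snd := by
  obtain ⟨mk, φ, c, a1, a2, a3⟩ := hv
  have c' : ∀ n, ContDiff ℝ 1 fun x => G (φ n x) := fun n => h.contDiff.comp (c n)
  have b1 : Tendsto (fun n => eLpNorm ((fun x => G (φ n x)) -
      ((TwoPhase.superposition h v).fst : E d → ℝ)) 2 (volume.restrict Ω)) atTop (𝓝 0) := by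
    refine (h.tendsto_comp a1).congr fun n => eLpNorm_congr_ae ?_
    filter_upwards [superposition_fst h v] with x hx
    simp [hx]
  have b2 : Tendsto (fun n => eLpNorm (gradient (fun x => G (φ n x)) -
      ((TwoPhase.superposition h v).snd : E d → E d)) 2 (volume.restrict Ω)) atTop (𝓝 0) := by
    refine (tendsto_eLpNorm_comp_smul h.cont h.bound
      (fun n => (c n).continuous.aestronglyMeasurable) (Lp.aestronglyMeasurable _)
      (fun n => (continuous_gradient (c n)).aestronglyMeasurable) (Lp.memLp _) a1 a2).congr
      fun n => eLpNorm_congr_ae ?_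
    filter_upwards [superposition_snd h v] with x hx
    simp [hx, h.gradient_comp (c n)]
  exact ⟨⟨h.memLp_comp mk, _, c', b1, b2, h.tendsto_comp a3⟩,
    isWeakGrad_of_tendsto (Lp.memLp _) (Lp.memLp _) c' b1 b2⟩

/-- The superposition operator `v ↦ G ∘ v` on `V`. -/
def superpositionV (h : IsC1Lip G g C) (v : V Ω Γ) : V Ω Γ :=
  ⟨superposition h v, by
    obtain ⟨-, k, hk, hk0⟩ := v.2
    refine ⟨(hk.superposition h).2, _, (hk.superposition h).1, ?_⟩
    filter_upwards [hk0] with x hx hxΓ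
    rw [hx hxΓ, h.zero]⟩

theorem fn_superpositionV (h : IsC1Lip G g C) (v : V Ω Γ) :
    fn (superpositionV h v) =ᵐ[volume.restrict Ω] fun x => G (fn v x) :=
  superposition_fst h (v : L2Pair Ω)

theorem grad_superpositionV (h : IsC1Lip G g C) (v : V Ω Γ) :
    grad (superpositionV h v) =ᵐ[volume.restrict Ω] fun x => g (fn v x) • grad v x :=
  superposition_snd h (v : L2Pair Ω)

theorem continuous_superpositionV (h : IsC1Lip G g C) :
    Continuous (superpositionV (Ω := Ω) (Γ := Γ) h) :=
  ((continuous_superposition h).comp continuous_subtype_val).subtype_mk _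

theorem norm_superpositionV_le (h : IsC1Lip G g C) (v : V Ω Γ) :
    ‖superpositionV h v‖ ≤ C * ‖v‖ := by
  have hC : 0 ≤ C := (abs_nonneg _).trans (h.bound 0)
  have n1 : ‖(superposition h (v : L2Pair Ω)).fst‖ ≤ C * ‖(v : L2Pair Ω).fst‖ := by
    refine Lp.norm_le_mul_norm_of_ae_le_mul ?_
    filter_upwards [superposition_fst h (v : L2Pair Ω)] with x hx
    rw [hx]
    exact h.abs_le _
  have n2 : ‖(superposition h (v : L2Pair Ω)).snd‖ ≤ C * ‖(v : L2Pair Ω).snd‖ := by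
    refine Lp.norm_le_mul_norm_of_ae_le_mul ?_
    filter_upwards [superposition_snd h (v : L2Pair Ω)] with x hx
    rw [hx, norm_smul]
    exact mul_le_mul_of_nonneg_right (h.bound _) (norm_nonneg _)
  change ‖superposition h (v : L2Pair Ω)‖ ≤ C * ‖(v : L2Pair Ω)‖
  refine le_of_sq_le_sq ?_ (by positivity)
  rw [mul_pow, WithLp.prod_norm_sq_eq_of_L2, WithLp.prod_norm_sq_eq_of_L2, mul_add, ← mul_pow,
    ← mul_pow]
  gcongr

theorem memLp_superpositionV {μ : Measure ℝ} (h : IsC1Lip G g C) {v : ℝ → V Ω Γ}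
    (hv : MemLp v 2 μ) : MemLp (fun t => superpositionV h (v t)) 2 μ :=
  hv.of_le_mul (c := C) ((continuous_superpositionV h).comp_aestronglyMeasurable hv.1)
    (.of_forall fun _ => norm_superpositionV_le h _)

end TwoPhase
end

noncomputable section

namespace TwoPhase

/-! ### The truncated negative part and its primitives -/

/-- The negative part of `s`, truncated at height `c`. -/
def truncNeg (c s : ℝ) : ℝ := min (max (-s) 0) c

/-- The primitive of `truncNeg c` which vanishes at the origin. -/
def negPrim (c s : ℝ) : ℝ := ∫ σ in (0 : ℝ)..s, truncNeg c σ

/-- The primitive of `-(truncNeg c)²` which vanishes at the origin. -/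
def negPrimSq (c s : ℝ) : ℝ := ∫ σ in (0 : ℝ)..s, -truncNeg c σ ^ 2

theorem continuous_truncNeg (c : ℝ) : Continuous (truncNeg c) := by
  unfold truncNeg
  fun_prop

theorem truncNeg_of_nonneg {c s : ℝ} (hc : 0 ≤ c) (hs : 0 ≤ s) : truncNeg c s = 0 := by
  rw [truncNeg, max_eq_right (by linarith), min_eq_left hc]

theorem truncNeg_of_nonpos {c s : ℝ} (hs : s ≤ 0) (hcs : -c ≤ s) : truncNeg c s = -s := by
  rw [truncNeg, max_eq_left (by linarith), min_eq_left (by linarith)]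

theorem truncNeg_nonneg {c : ℝ} (hc : 0 ≤ c) (s : ℝ) : 0 ≤ truncNeg c s :=
  le_min (le_max_right _ _) hc

theorem truncNeg_le (c s : ℝ) : truncNeg c s ≤ c := min_le_right _ _

theorem isC1Lip_negPrim {c : ℝ} (hc : 0 ≤ c) : IsC1Lip (negPrim c) (truncNeg c) c where
  cont := continuous_truncNeg c
  bound s := by
    rw [abs_of_nonneg (truncNeg_nonneg hc s)]
    exact truncNeg_le c s
  deriv s := (continuous_truncNeg c).integral_hasStrictDerivAt 0 s |>.hasDerivAt
  zero := by simp [negPrim]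

theorem isC1Lip_negPrimSq {c : ℝ} (hc : 0 ≤ c) :
    IsC1Lip (negPrimSq c) (fun s => -truncNeg c s ^ 2) (c ^ 2) where
  cont := ((continuous_truncNeg c).pow 2).neg
  bound s := by
    rw [abs_neg, abs_of_nonneg (sq_nonneg _)]
    exact pow_le_pow_left₀ (truncNeg_nonneg hc s) (truncNeg_le c s) 2
  deriv s := ((continuous_truncNeg c).pow 2).neg.integral_hasStrictDerivAt 0 s |>.hasDerivAt
  zero := by simp [negPrimSq]

/-- Above `-c` the truncation is invisible: it only serves to bound the derivative on the whole
line. -/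
theorem negPrim_eq {c s : ℝ} (hc : 0 ≤ c) (hcs : -c ≤ s) :
    negPrim c s = -(max (-s) 0) ^ 2 / 2 := by
  rcases le_total 0 s with hs | hs
  · have : negPrim c s = ∫ σ in (0 : ℝ)..s, (0 : ℝ) := by
      refine intervalIntegral.integral_congr fun σ hσ => ?_
      rw [uIcc_of_le hs] at hσ
      exact truncNeg_of_nonneg hc hσ.1
    rw [this, max_eq_right (by linarith)]
    simp
  · have : negPrim c s = ∫ σ in (0 : ℝ)..s, -σ := by
      refine intervalIntegral.integral_congr fun σ hσ => ?_
      rw [uIcc_of_ge hs] at hσ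
      exact truncNeg_of_nonpos hσ.2 (hcs.trans hσ.1)
    rw [this, max_eq_left (by linarith), intervalIntegral.integral_neg, integral_id]
    ring

theorem negPrimSq_eq {c s : ℝ} (hc : 0 ≤ c) (hcs : -c ≤ s) :
    negPrimSq c s = (max (-s) 0) ^ 3 / 3 := by
  rcases le_total 0 s with hs | hs
  · have : negPrimSq c s = ∫ σ in (0 : ℝ)..s, (0 : ℝ) := by
      refine intervalIntegral.integral_congr fun σ hσ => ?_
      rw [uIcc_of_le hs] at hσ
      simp [truncNeg_of_nonneg hc hσ.1]
    rw [this, max_eq_right (by linarith)]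
    simp
  · have : negPrimSq c s = ∫ σ in (0 : ℝ)..s, -σ ^ 2 := by
      refine intervalIntegral.integral_congr fun σ hσ => ?_
      rw [uIcc_of_ge hs] at hσ
      simp [truncNeg_of_nonpos hσ.2 (hcs.trans hσ.1)]
    rw [this, max_eq_left (by linarith), intervalIntegral.integral_neg, integral_pow]
    norm_num
    ring

/-- The energy density `(s⁻)³ / 6`, the Legendre-type transform `s h(s) - H(s)` of the pair
`h = negPrim`, `H = negPrimSq`. -/
def negEnergy (s : ℝ) : ℝ := (max (-s) 0) ^ 3 / 6

theorem negEnergy_nonneg (s : ℝ) : 0 ≤ negEnergy s := by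
  unfold negEnergy
  positivity

theorem negEnergy_of_nonneg {s : ℝ} (hs : 0 ≤ s) : negEnergy s = 0 := by
  rw [negEnergy, max_eq_right (by linarith)]
  norm_num

theorem nonneg_of_negEnergy_eq_zero {s : ℝ} (h : negEnergy s = 0) : 0 ≤ s := by
  by_contra! hs
  rw [negEnergy, max_eq_left (by linarith)] at h
  have : 0 < (-s) ^ 3 := pow_pos (by linarith) 3
  linarith

theorem negPrim_nonpos {c s : ℝ} (hc : 0 ≤ c) (hcs : -c ≤ s) : negPrim c s ≤ 0 := by
  rw [negPrim_eq hc hcs]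
  linarith [sq_nonneg (max (-s) 0)]

theorem negPrimSq_nonneg {c s : ℝ} (hc : 0 ≤ c) (hcs : -c ≤ s) : 0 ≤ negPrimSq c s := by
  rw [negPrimSq_eq hc hcs]
  positivity

/-- Behind the computation is `H' = s h'` on `[-c, ∞)`, so that the derivative of `s h - H` is `h`
itself. As `h` is nondecreasing, the energy density is convex, and its tangent at `s` is `t ↦ t h(s)
- H(s)`. -/
theorem mul_negPrim_sub_negPrimSq {c s : ℝ} (hc : 0 ≤ c) (hcs : -c ≤ s) :
    s * negPrim c s - negPrimSq c s = negEnergy s := by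
  rw [negPrim_eq hc hcs, negPrimSq_eq hc hcs, negEnergy]
  rcases le_total 0 s with hs | hs
  · rw [max_eq_right (by linarith)]
    ring
  · rw [max_eq_left (by linarith)]
    ring

/-- Convexity of the energy density. -/
theorem negPrim_mul_le {c s t : ℝ} (hc : 0 ≤ c) (hcs : -c ≤ s) :
    t * negPrim c s - negPrimSq c s ≤ negEnergy t := by
  rw [negPrim_eq hc hcs, negPrimSq_eq hc hcs, negEnergy]
  have h1 : -t ≤ max (-t) 0 := le_max_left _ _
  have h2 : 0 ≤ max (-t) 0 := le_max_right _ _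
  have h3 : 0 ≤ max (-s) 0 := le_max_right _ _
  generalize max (-t) 0 = a at *
  generalize max (-s) 0 = b at *
  -- Six times the difference of the two sides is `a³ + 2b³ + 3tb² = (a - b)²(a + 2b) + 3(a + t)b²`.
  nlinarith [mul_nonneg (sq_nonneg (a - b)) (by linarith : 0 ≤ a + 2 * b),
    mul_nonneg (by linarith : 0 ≤ a + t) (sq_nonneg b)]

/-- The discrete counterpart of `h ∂_t r - H ∂_t S ≥ ∂_t (S E)`. -/
theorem negEnergy_step {c u u' S S' R R' : ℝ} (hc : 0 ≤ c) (hu : -c ≤ u) (hS' : 0 ≤ S')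
    (hR : u < 0 → R = u * S) (hR' : u' * S' ≤ R') :
    S * negEnergy u - S' * negEnergy u'
      ≤ (R - R') * negPrim c u - (S - S') * negPrimSq c u := by
  have h1 : R * negPrim c u - S * negPrimSq c u = S * negEnergy u := by
    rw [← mul_negPrim_sub_negPrimSq hc hu]
    rcases lt_or_ge u 0 with h | h
    · rw [hR h]
      ring
    · rw [negPrim_eq hc hu, negPrimSq_eq hc hu, max_eq_right (by linarith)]
      ring
  -- The tangent inequality at `u` is weighted by `S' ≥ 0`; the excess of `R'` over `u' S'` has the
  -- right sign because `h(u) ≤ 0`.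
  nlinarith [mul_le_mul_of_nonneg_left (negPrim_mul_le (t := u') hc hu) hS',
    mul_nonneg (sub_nonneg.2 hR') (neg_nonneg.2 (negPrim_nonpos hc hu))]

/-- The difference of the gas flux tested with `h(u)` and the liquid flux tested with `H(u)`
reduces to the diffusive dissipation, which is nonnegative. -/
theorem flux_difference_nonneg {d : ℕ} {c u ρG ρL ρstd a : ℝ} (hc : 0 ≤ c) (hu : -c ≤ u)
    (hρ : u < 0 → ρG = 0) (hρL : ρL = ρstd + u) (hpos : 0 < ρL) (ha : 0 ≤ a) (JL JG GU : E d) :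
    0 ≤ inner ℝ (u • JL + ρG • JG + (a * (ρstd / ρL)) • GU) (truncNeg c u • GU)
      - inner ℝ (JL - (a * ρL⁻¹) • GU) ((-truncNeg c u ^ 2) • GU) := by
  rcases lt_or_ge u 0 with h | h
  · rw [hρ h, truncNeg_of_nonpos h.le hu]
    have hL : ρL ≠ 0 := hpos.ne'
    -- The coefficient of `JL` is `u u⁻ + (u⁻)² = 0`. That of `‖GU‖²` is `(a / ρL) u⁻ (ρstd - u⁻)`,
    -- which equals `a u⁻` since `ρL = ρstd - u⁻`.
    have : inner ℝ (u • JL + (0 : ℝ) • JG + (a * (ρstd / ρL)) • GU) ((-u) • GU)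
        - inner ℝ (JL - (a * ρL⁻¹) • GU) ((-(-u) ^ 2) • GU) = a * (-u) * ‖GU‖ ^ 2 := by
      simp only [inner_add_left, inner_sub_left, inner_smul_left, inner_smul_right,
        real_inner_self_eq_norm_sq, RCLike.conj_to_real]
      field_simp
      rw [hρL]
      ring
    rw [this]
    have : 0 ≤ -u := by linarith
    positivity
  · rw [truncNeg_of_nonneg hc h]
    simp

/-! ### Consequences of the conditions on the data -/

namespace FlowData.Admissible

variable {d : ℕ} {m : FlowData d}

instance isFiniteMeasure_time : IsFiniteMeasure m.time := by
  unfold FlowData.time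
  infer_instance

theorem isFiniteMeasure_vol (hm : m.Admissible) : IsFiniteMeasure m.vol := by
  rw [FlowData.vol]
  exact ⟨by simpa using hm.domain.isBounded.measure_lt_top⟩

/-- The intermediate value theorem between `1`, where `p_c` vanishes, and a point near `0`, where
`p_c` exceeds `σ`. -/
theorem mem_image_pc (hm : m.Admissible) {σ : ℝ} (hσ : 0 < σ) : σ ∈ m.pc '' Ioc 0 1 := by
  obtain ⟨a, ha, h0, h1⟩ : ∃ a, σ ≤ m.pc a ∧ 0 < a ∧ a < 1 := by
    have h1 : ∀ᶠ a in 𝓝[>] (0 : ℝ), a ∈ Ioo (0 : ℝ) 1 := Ioo_mem_nhdsGT one_pos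
    obtain ⟨a, h, h'⟩ := ((hm.pc_atTop.eventually_ge_atTop σ).and h1).exists
    exact ⟨a, h, h'.1, h'.2⟩
  have hc : ContinuousOn m.pc (Icc a 1) := hm.pc_cont.mono fun x hx => ⟨h0.trans_le hx.1, hx.2⟩
  obtain ⟨x, hx, rfl⟩ := intermediate_value_Icc' h1.le hc ⟨by rw [hm.pc_one]; exact hσ.le, ha⟩
  exact ⟨x, ⟨h0.trans_le hx.1, hx.2⟩, rfl⟩

theorem pcInv_mem (hm : m.Admissible) (σ : ℝ) : m.pcInv σ ∈ Ioc (0 : ℝ) 1 := by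
  unfold FlowData.pcInv
  split_ifs with h
  · simp
  · exact Function.invFunOn_mem (hm.mem_image_pc (not_le.1 h))

/-- Monotonicity is all that is needed of the inverse: it already yields the measurability of the
saturation. -/
theorem antitone_pcInv (hm : m.Admissible) : Antitone m.pcInv := by
  intro σ τ h
  rcases le_or_gt σ 0 with hσ | hσ
  · conv_rhs => rw [FlowData.pcInv, if_pos hσ]
    exact (hm.pcInv_mem τ).2
  · have e : ∀ ρ, 0 < ρ → m.pc (m.pcInv ρ) = ρ := by
      intro ρ hρ
      rw [FlowData.pcInv, if_neg (not_le.2 hρ)]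
      exact Function.invFunOn_eq (hm.mem_image_pc hρ)
    by_contra! hlt
    have := hm.pc_anti (hm.pcInv_mem σ) (hm.pcInv_mem τ) hlt
    rw [e σ hσ, e τ (hσ.trans_le h)] at this
    exact absurd h (not_le.2 this)

theorem measurable_sat (hm : m.Admissible) : Measurable fun z : ℝ × ℝ => m.sat z.1 z.2 :=
  hm.antitone_pcInv.measurable.comp (measurable_snd.sub measurable_fst)

theorem sat_mem (hm : m.Admissible) (pl pg : ℝ) : m.sat pl pg ∈ Ioc (0 : ℝ) 1 := hm.pcInv_mem _

theorem uhat_nonneg (hm : m.Admissible) {σ : ℝ} (hσ : 0 ≤ σ) : 0 ≤ m.uhat σ := by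
  rw [← hm.uhat_zero]
  exact hm.uhat_strictMonoOn.monotoneOn (mem_Ici.2 le_rfl) hσ hσ

theorem nonneg_of_uhat_nonneg (hm : m.Admissible) {σ : ℝ} (hσ : 0 ≤ m.uhat σ) : 0 ≤ σ := by
  by_contra! h
  linarith [hm.uhat_neg σ h]

theorem ρhat_nonneg (hm : m.Admissible) (σ : ℝ) : 0 ≤ m.ρhat σ := by
  rcases le_total 0 σ with h | h
  · obtain ⟨_, _, h'⟩ := hm.ρhat_bounded
    exact (h' σ h).1
  · exact (hm.ρhat_nonpos σ h).ge

theorem ρhat_eq_zero (hm : m.Admissible) {σ : ℝ} (hσ : m.uhat σ < 0) : m.ρhat σ = 0 := by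
  refine hm.ρhat_nonpos σ ?_
  by_contra! h
  linarith [hm.uhat_nonneg h.le]

theorem gasMass_eq (hm : m.Admissible) {pl pg : ℝ} (h : m.uhat pg < 0) :
    m.gasMass pl pg = m.uhat pg * m.sat pl pg := by
  rw [FlowData.gasMass, hm.ρhat_eq_zero h]
  ring

/-- Holds for either sign of `û`, unlike the preceding equality. It is the only information on the
gas mass used at the earlier time level. -/
theorem le_gasMass (hm : m.Admissible) (pl pg : ℝ) :
    m.uhat pg * m.sat pl pg ≤ m.gasMass pl pg := by
  rw [FlowData.gasMass]
  have := mul_nonneg (hm.ρhat_nonneg pg) (sub_nonneg.2 (hm.sat_mem pl pg).2)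
  linarith

/-- Uniform bounds on `û`, with a lower bound above `-ρ_l^std`. -/
theorem exists_uhat_bounds (hm : m.Admissible) : ∃ c C : ℝ, 0 ≤ c ∧ c < m.ρstd ∧
    (∀ σ, -c ≤ m.uhat σ) ∧ ∀ σ, |m.uhat σ| ≤ C := by
  obtain ⟨umin, h1, h2, h3⟩ := hm.uhat_lower
  obtain ⟨umax, h4, h5⟩ := hm.uhat_bounded
  have hlow : ∀ σ, -umin ≤ m.uhat σ := by
    intro σ
    rcases lt_or_ge σ 0 with h | h
    · exact h3 σ h
    · linarith [hm.uhat_nonneg h]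
  refine ⟨umin, max umin umax, h1.le, h2, hlow, fun σ => ?_⟩
  rcases lt_or_ge σ 0 with h | h
  · rw [abs_of_neg (hm.uhat_neg σ h)]
    exact le_max_of_le_left (by linarith [h3 σ h])
  · exact le_max_of_le_right (h5 σ h)

/-! ### Bounds and measurability of the coefficients -/

section Lp

variable {α : Type*} [MeasurableSpace α] {μ : Measure α}

theorem memLp_top_of_norm_le {F : Type*} [NormedAddCommGroup F] {f : α → F} {C : ℝ}
    (hf : AEStronglyMeasurable f μ) (hC : ∀ x, ‖f x‖ ≤ C) : MemLp f ∞ μ :=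
  MeasureTheory.memLp_top_of_bound hf C (.of_forall hC)

theorem memLp_uhat (hm : m.Admissible) {f : α → ℝ} (hf : AEStronglyMeasurable f μ) :
    MemLp (fun x => m.uhat (f x)) ∞ μ := by
  obtain ⟨c, C, -, -, -, hC⟩ := hm.exists_uhat_bounds
  exact memLp_top_of_norm_le (hm.uhat_contDiff.continuous.comp_aestronglyMeasurable hf)
    fun x => hC (f x)

theorem memLp_ρhat (hm : m.Admissible) {f : α → ℝ} (hf : AEStronglyMeasurable f μ) :
    MemLp (fun x => m.ρhat (f x)) ∞ μ := by
  obtain ⟨ρM, h0, hC⟩ := hm.ρhat_bounded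
  refine memLp_top_of_norm_le (C := ρM) (hm.ρhat_cont.comp_aestronglyMeasurable hf) fun x => ?_
  rw [Real.norm_eq_abs, abs_of_nonneg (hm.ρhat_nonneg _)]
  rcases le_total 0 (f x) with h | h
  · exact (hC _ h).2
  · rw [hm.ρhat_nonpos _ h]
    exact h0.le

theorem memLp_ρl [IsFiniteMeasure μ] (hm : m.Admissible) {f : α → ℝ}
    (hf : AEStronglyMeasurable f μ) :
    MemLp (fun x => m.ρl (f x)) ∞ μ :=
  (memLp_const m.ρstd).add (hm.memLp_uhat hf)

theorem ρl_pos (hm : m.Admissible) (σ : ℝ) : 0 < m.ρl σ := by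
  obtain ⟨c, C, -, h1, h2, -⟩ := hm.exists_uhat_bounds
  rw [FlowData.ρl]
  linarith [h2 σ]

theorem memLp_ρl_inv (hm : m.Admissible) {f : α → ℝ} (hf : AEStronglyMeasurable f μ) :
    MemLp (fun x => (m.ρl (f x))⁻¹) ∞ μ := by
  obtain ⟨c, C, -, h1, h2, -⟩ := hm.exists_uhat_bounds
  refine memLp_top_of_norm_le (C := (m.ρstd - c)⁻¹) ?_ fun x => ?_
  · exact ((measurable_const.add hm.uhat_contDiff.continuous.measurable).inv.comp_aemeasurable
      hf.aemeasurable).aestronglyMeasurable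
  · rw [norm_inv, Real.norm_eq_abs, abs_of_pos (hm.ρl_pos _)]
    refine inv_anti₀ (by linarith) ?_
    rw [FlowData.ρl]
    linarith [h2 (f x)]

theorem aestronglyMeasurable_sat (hm : m.Admissible) {f g : α → ℝ}
    (hf : AEStronglyMeasurable f μ) (hg : AEStronglyMeasurable g μ) :
    AEStronglyMeasurable (fun x => m.sat (f x) (g x)) μ :=
  (hm.measurable_sat.comp_aemeasurable
    (hf.aemeasurable.prodMk hg.aemeasurable)).aestronglyMeasurable

theorem memLp_sat (hm : m.Admissible) {f g : α → ℝ} (hf : AEStronglyMeasurable f μ)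
    (hg : AEStronglyMeasurable g μ) : MemLp (fun x => m.sat (f x) (g x)) ∞ μ := by
  refine memLp_top_of_norm_le (C := 1) (hm.aestronglyMeasurable_sat hf hg) fun x => ?_
  rw [Real.norm_eq_abs, abs_of_pos (hm.sat_mem _ _).1]
  exact (hm.sat_mem _ _).2

theorem memLp_gasMass [IsFiniteMeasure μ] (hm : m.Admissible) {f g : α → ℝ}
    (hf : AEStronglyMeasurable f μ) (hg : AEStronglyMeasurable g μ) :
    MemLp (fun x => m.gasMass (f x) (g x)) ∞ μ :=
  ((hm.memLp_sat hf hg).mul (hm.memLp_uhat hg)).add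
    (((memLp_const (1 : ℝ)).sub (hm.memLp_sat hf hg)).mul (hm.memLp_ρhat hg))

theorem memLp_comp_of_continuousOn {k : ℝ → ℝ} (hk : ContinuousOn k (Icc 0 1)) {S : α → ℝ}
    (hS : AEStronglyMeasurable S μ) (hS' : ∀ x, S x ∈ Icc (0 : ℝ) 1) :
    MemLp (fun x => k (S x)) ∞ μ := by
  obtain ⟨C, hC⟩ := isCompact_Icc.exists_bound_of_continuousOn hk
  -- Outside `[0,1]` the function `k` is arbitrary; its continuous extension agrees with it on the
  -- values of `S` and gives measurability.
  have e : (fun x => k (S x)) = fun x => IccExtend zero_le_one (domRestrict (Icc 0 1) k) (S x) := by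
    funext x
    rw [IccExtend_of_mem _ _ (hS' x)]
    rfl
  refine memLp_top_of_norm_le (C := C) ?_ fun x => hC _ (hS' x)
  rw [e]
  exact (continuous_IccExtend_iff.2 hk.domRestrict).comp_aestronglyMeasurable hS

theorem krl_nonneg (hm : m.Admissible) {s : ℝ} (hs : s ∈ Icc (0 : ℝ) 1) : 0 ≤ m.krl s := by
  rw [← hm.krl_zero]
  exact hm.krl_mono ⟨le_rfl, zero_le_one⟩ hs hs.1

theorem krg_nonneg (hm : m.Admissible) {s : ℝ} (hs : s ∈ Icc (0 : ℝ) 1) : 0 ≤ m.krg s := by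
  rw [← hm.krg_one]
  exact hm.krg_anti hs ⟨zero_le_one, le_rfl⟩ hs.2

theorem continuousOn_mobL (hm : m.Admissible) : ContinuousOn m.mobL (Icc 0 1) :=
  hm.krl_cont.div_const _

theorem continuousOn_mobG (hm : m.Admissible) : ContinuousOn m.mobG (Icc 0 1) :=
  hm.krg_cont.div_const _

theorem mob_pos (hm : m.Admissible) {s : ℝ} (hs : s ∈ Icc (0 : ℝ) 1) : 0 < m.mob s := by
  obtain ⟨k, hk, hk'⟩ := hm.kr_lower
  have h1 := hm.krl_nonneg hs
  have h2 := hm.krg_nonneg hs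
  have h3 := hk' s hs
  have e1 : 0 ≤ m.krl s / m.μl := div_nonneg h1 hm.μl_pos.le
  have e2 : 0 ≤ m.krg s / m.μg := div_nonneg h2 hm.μg_pos.le
  rw [FlowData.mob, FlowData.mobL, FlowData.mobG]
  rcases h1.eq_or_lt with h | h
  · have : 0 < m.krg s / m.μg := div_pos (by linarith) hm.μg_pos
    linarith
  · have : 0 < m.krl s / m.μl := div_pos h hm.μl_pos
    linarith

theorem continuousOn_γ (hm : m.Admissible) : ContinuousOn m.γ (Icc 0 1) :=
  ((hm.continuousOn_mobL.mul hm.continuousOn_mobG).div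
    (hm.continuousOn_mobL.add hm.continuousOn_mobG) fun _ hs => (hm.mob_pos hs).ne').sqrt

end Lp

end FlowData.Admissible

/-- A bounded operator field maps square-integrable fields to such fields. -/
theorem memLp_clm_apply {α F : Type*} [MeasurableSpace α] {μ : Measure α} [NormedAddCommGroup F]
    [NormedSpace ℝ F] {K : α → F →L[ℝ] F} {f : α → F} (hK : MemLp K ∞ μ) (hf : MemLp f 2 μ) :
    MemLp (fun x => K x (f x)) 2 μ := by
  refine hf.of_le_mul (c := (eLpNorm K ∞ μ).toReal) ?_ ?_
  · exact (ContinuousLinearMap.id ℝ (F →L[ℝ] F)).aestronglyMeasurable_comp₂ hK.1 hf.1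
  · have := ae_le_eLpNormEssSup (f := K) (μ := μ)
    filter_upwards [this] with x hx
    refine ((K x).le_opNorm _).trans (mul_le_mul_of_nonneg_right ?_ (norm_nonneg _))
    rw [← toReal_enorm]
    exact ENNReal.toReal_mono hK.2.ne (by rwa [eLpNorm_exponent_top])

/-- `f` is integrable with integral `I`. -/
structure HasInt {α : Type*} [MeasurableSpace α] (μ : Measure α) (f : α → ℝ) (I : ℝ) : Prop where
  integrable : Integrable f μ
  eq : ∫ x, f x ∂μ = I

namespace HasInt

variable {α : Type*} [MeasurableSpace α] {μ : Measure α} {f g : α → ℝ} {I J : ℝ}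

theorem add (hf : HasInt μ f I) (hg : HasInt μ g J) : HasInt μ (fun x => f x + g x) (I + J) :=
  ⟨hf.1.add hg.1, by rw [integral_add hf.1 hg.1, hf.2, hg.2]⟩

theorem sub (hf : HasInt μ f I) (hg : HasInt μ g J) : HasInt μ (fun x => f x - g x) (I - J) :=
  ⟨hf.1.sub hg.1, by rw [integral_sub hf.1 hg.1, hf.2, hg.2]⟩

theorem const_mul (c : ℝ) (hf : HasInt μ f I) : HasInt μ (fun x => c * f x) (c * I) :=
  ⟨hf.1.const_mul c, by rw [integral_const_mul, hf.2]⟩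

/-- A nonnegative minorant of a function with nonpositive integral vanishes. -/
theorem ae_eq_zero {e : α → ℝ} (hf : HasInt μ f I) (hI : I ≤ 0)
    (h : ∀ᵐ x ∂μ, 0 ≤ e x ∧ e x ≤ f x) : ∀ᵐ x ∂μ, e x = 0 := by
  have h0 : 0 ≤ᵐ[μ] f := h.mono fun x hx => hx.1.trans hx.2
  have h1 : ∫ x, f x ∂μ = 0 := le_antisymm (hf.2.trans_le hI) (integral_nonneg_of_ae h0)
  filter_upwards [h, (integral_eq_zero_iff_of_nonneg_ae h0 hf.1).1 h1] with x hx h2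
  rw [Pi.zero_apply] at h2
  linarith [hx.1, hx.2]

end HasInt

theorem hasInt_of_integrable {α : Type*} [MeasurableSpace α] {μ : Measure α} {f : α → ℝ}
    (hf : Integrable f μ) : HasInt μ f (∫ x, f x ∂μ) := ⟨hf, rfl⟩

end TwoPhase
end

noncomputable section

namespace TwoPhase
namespace FlowData.Admissible

variable {d : ℕ} {m : FlowData d}

/-! ### The time-discrete problem -/

/-- A time slab is a restriction of `Q_T` up to the null set `t = T`, so null sets and integrability
pass from `Q_T` to the slab. -/
theorem ae_step_nonneg (hm : m.Admissible) {a b : ℝ} (h0 : 0 ≤ a) (hb : b ≤ m.T) :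
    (volume.restrict (Ioc a b)).prod m.vol ≪ m.volQ ∧
      (volume.restrict (Ioc a b)).prod m.vol ≤ m.volQ := by
  have := hm.isFiniteMeasure_vol
  have e : (volume.restrict (Ioc a b)).prod m.vol = m.volQ.restrict (Ioc a b ×ˢ univ) := by
    rw [FlowData.volQ, ← Measure.prod_restrict, Measure.restrict_univ, FlowData.time,
      restrict_Ioo_eq_restrict_Ioc, Measure.restrict_restrict measurableSet_Ioc,
      inter_eq_left.2 (Ioc_subset_Ioc h0 hb)]
  rw [e]
  exact ⟨Measure.restrict_le_self.absolutelyContinuous, Measure.restrict_le_self⟩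

/-- Fubini on the time slab. Integrability of the mean over `Ω` suffices, because the test functions
used are bounded. -/
theorem timeAvg_integrable_and_nonneg (hm : m.Admissible) {F : ℝ → E d → ℝ}
    (hF : MemLp (Function.uncurry F) 2 m.volQ) (hF0 : ∀ᵐ z ∂m.volQ, 0 ≤ F z.1 z.2)
    {M k : ℕ} (hk : 1 ≤ k) (hkM : k ≤ M) :
    Integrable (FlowData.timeAvg F (m.T / M) k) m.vol ∧
      ∀ᵐ x ∂m.vol, 0 ≤ FlowData.timeAvg F (m.T / M) k x := by
  have := hm.isFiniteMeasure_vol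
  have hM : (0 : ℝ) < M := by exact_mod_cast hk.trans hkM
  have hk' : (1 : ℝ) ≤ k := by exact_mod_cast hk
  have hkM' : (k : ℝ) ≤ M := by exact_mod_cast hkM
  have hT := hm.T_pos
  have hδ : 0 < m.T / M := div_pos hT hM
  have h0 : 0 ≤ ((k : ℝ) - 1) * (m.T / M) := mul_nonneg (by linarith) hδ.le
  have hab : ((k : ℝ) - 1) * (m.T / M) ≤ k * (m.T / M) :=
    mul_le_mul_of_nonneg_right (by linarith) hδ.le
  have hb : k * (m.T / M) ≤ m.T := by
    rw [mul_div_assoc', div_le_iff₀ hM, mul_comm]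
    exact mul_le_mul_of_nonneg_left hkM' hT.le
  obtain ⟨hac, hle⟩ := hm.ae_step_nonneg h0 hb
  have hvolQ : IsFiniteMeasure m.volQ := by
    unfold FlowData.volQ
    infer_instance
  have hi := (hF.integrable one_le_two).mono_measure hle
  constructor
  · unfold FlowData.timeAvg
    simp only [intervalIntegral.integral_of_le hab]
    exact hi.integral_prod_right.const_mul _
  · have h1 : ∀ᵐ z ∂(volume.restrict (Ioc (((k : ℝ) - 1) * (m.T / M)) (k * (m.T / M)))).prod m.vol,
        0 ≤ F z.1 z.2 := hac.ae_le hF0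
    have h2 : ∀ᵐ z ∂m.vol.prod
        (volume.restrict (Ioc (((k : ℝ) - 1) * (m.T / M)) (k * (m.T / M)))), 0 ≤ F z.2 z.1 :=
      Measure.measurePreserving_swap.quasiMeasurePreserving.ae h1
    filter_upwards [Measure.ae_ae_of_ae_prod h2] with x hx
    unfold FlowData.timeAvg
    rw [intervalIntegral.integral_of_le hab]
    exact mul_nonneg (inv_nonneg.2 hδ.le) (integral_nonneg_of_ae hx)

section Products

variable {α : Type*} [MeasurableSpace α] {μ : Measure α} {p : ℝ≥0∞}

theorem memLp_mul_of_top {a b : α → ℝ} (ha : MemLp a ∞ μ) (hb : MemLp b p μ) :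
    MemLp (fun x => a x * b x) p μ := hb.mul ha

theorem memLp_mul_of_top_right {a b : α → ℝ} (ha : MemLp a p μ) (hb : MemLp b ∞ μ) :
    MemLp (fun x => a x * b x) p μ := hb.mul ha

theorem memLp_smul_of_top {F : Type*} [NormedAddCommGroup F] [NormedSpace ℝ F] {a : α → ℝ}
    {b : α → F} (ha : MemLp a ∞ μ) (hb : MemLp b p μ) : MemLp (fun x => a x • b x) p μ := hb.smul ha

theorem integrable_inner {d : ℕ} {a b : α → E d} (ha : MemLp a 2 μ) (hb : MemLp b 2 μ) :
    Integrable (fun x => inner ℝ (a x) (b x)) μ :=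
  (ha.norm.integrable_mul hb.norm).mono' (ha.1.inner hb.1)
    (.of_forall fun x => norm_inner_le_norm (a x) (b x))

end Products

theorem memLp_fn {W : Submodule ℝ (L2Pair m.Ω)} (v : W) : MemLp (fn v) 2 m.vol := Lp.memLp _

theorem memLp_grad {W : Submodule ℝ (L2Pair m.Ω)} (v : W) : MemLp (grad v) 2 m.vol := Lp.memLp _

theorem memLp_Φ (hm : m.Admissible) : MemLp m.Φ ∞ m.vol := by
  obtain ⟨a, b, h0, -, h⟩ := hm.Φ_bounds
  refine MeasureTheory.memLp_top_of_bound hm.Φ_meas b ?_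
  filter_upwards [h] with x hx
  rw [Real.norm_eq_abs, abs_of_pos (h0.trans_le hx.1)]
  exact hx.2

theorem Φ_pos (hm : m.Admissible) : ∀ᵐ x ∂m.vol, 0 < m.Φ x := by
  obtain ⟨a, b, h0, -, h⟩ := hm.Φ_bounds
  filter_upwards [h] with x hx using h0.trans_le hx.1

theorem D_pos (hm : m.Admissible) : ∀ᵐ x ∂m.vol, 0 < m.D x := by
  obtain ⟨a, h0, h⟩ := hm.D_lower
  filter_upwards [h] with x hx using h0.trans_le hx

/-- Nonnegativity of the gas pressure at a step of the time-discrete scheme. -/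
theorem discrete_nonneg (hm : m.Admissible) {η : ℝ} {M k : ℕ} (hk : 1 ≤ k) (hkM : k ≤ M)
    {plPrev pgPrev : E d → ℝ} (hpl : MemLp plPrev 2 m.vol) (hpg : MemLp pgPrev 2 m.vol)
    (hpos : ∀ᵐ x ∂m.vol, 0 ≤ pgPrev x) {pl pg : m.VD}
    (hsol : m.IsDiscreteSolution η (m.T / M) k plPrev pgPrev pl pg) :
    ∀ᵐ x ∂m.vol, 0 ≤ fn pg x := by
  have := hm.isFiniteMeasure_vol
  obtain ⟨c, C, hc, hcρ, hlow, -⟩ := hm.exists_uhat_bounds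
  obtain ⟨u, hu, hL, hG⟩ := hsol
  obtain ⟨iP, nP⟩ := hm.timeAvg_integrable_and_nonneg hm.FP_mem hm.FP_nonneg hk hkM
  obtain ⟨iI, nI⟩ := hm.timeAvg_integrable_and_nonneg hm.FI_mem hm.FI_nonneg hk hkM
  have hδ : 0 < (m.T / M)⁻¹ :=
    inv_pos.2 (div_pos hm.T_pos (by exact_mod_cast hk.trans hkM))
  have h := isC1Lip_negPrim hc
  have H := isC1Lip_negPrimSq hc
  -- The test functions `h(u)` for the gas equation and `H(u)` for the liquid equation.
  set ψ := superpositionV h u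
  set φ := superpositionV H u
  have eψ : fn ψ =ᵐ[m.vol] fun x => negPrim c (m.uhat (fn pg x)) := by
    filter_upwards [fn_superpositionV h u, hu] with x h1 h2
    rw [h1, h2]
  have eφ : fn φ =ᵐ[m.vol] fun x => negPrimSq c (m.uhat (fn pg x)) := by
    filter_upwards [fn_superpositionV H u, hu] with x h1 h2
    rw [h1, h2]
  have gψ : grad ψ =ᵐ[m.vol] fun x => truncNeg c (m.uhat (fn pg x)) • grad u x := by
    filter_upwards [grad_superpositionV h u, hu] with x h1 h2
    rw [h1, h2]
  have gφ : grad φ =ᵐ[m.vol] fun x => (-truncNeg c (m.uhat (fn pg x)) ^ 2) • grad u x := by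
    filter_upwards [grad_superpositionV H u, hu] with x h1 h2
    rw [h1, h2]
  have ml : AEStronglyMeasurable (fn pl) m.vol := (memLp_fn pl).1
  have mg : AEStronglyMeasurable (fn pg) m.vol := (memLp_fn pg).1
  have bS := hm.memLp_sat ml mg
  have bR := hm.memLp_gasMass ml mg
  have bS' := hm.memLp_sat hpl.1 hpg.1
  have bR' := hm.memLp_gasMass hpl.1 hpg.1
  have bρL := hm.memLp_ρl mg
  have bρL' := hm.memLp_ρl_inv mg
  have bρG := hm.memLp_ρhat mg
  have bu : MemLp (fn u) ∞ m.vol := (memLp_congr_ae hu).2 (hm.memLp_uhat mg)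
  have bψ : MemLp (fn ψ) ∞ m.vol := (memLp_congr_ae eψ).2 (h.memLp_comp (hm.memLp_uhat mg))
  have bφ : MemLp (fn φ) ∞ m.vol := (memLp_congr_ae eφ).2 (H.memLp_comp (hm.memLp_uhat mg))
  have sS : ∀ x, m.sat (fn pl x) (fn pg x) ∈ Icc (0 : ℝ) 1 := fun x =>
    Ioc_subset_Icc_self (hm.sat_mem _ _)
  have bL := memLp_comp_of_continuousOn hm.continuousOn_mobL bS.1 sS
  have bG := memLp_comp_of_continuousOn hm.continuousOn_mobG bS.1 sS
  have bΦ := hm.memLp_Φ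
  have Kl := memLp_clm_apply hm.K_mem (memLp_grad pl)
  have Kg := memLp_clm_apply hm.K_mem (memLp_grad pg)
  have Kv := memLp_clm_apply hm.K_mem (memLp_const (μ := m.vol) (p := 2) m.gravity)
  have bdiff := memLp_mul_of_top (memLp_mul_of_top (memLp_mul_of_top bΦ bS) bρL') hm.D_mem
  have bdiff' := memLp_mul_of_top (memLp_mul_of_top (memLp_mul_of_top bΦ bS)
    (memLp_mul_of_top (memLp_const m.ρstd) bρL')) hm.D_mem
  simp only [← div_eq_mul_inv] at bdiff'
  -- Each term of the two tested equations is recorded with its integrability, so that all of them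
  -- can be merged into one integral and compared pointwise.
  have L0 := hasInt_of_integrable ((memLp_mul_of_top (memLp_mul_of_top bΦ (bS.sub bS'))
    bφ).integrable le_top)
  have L1 := hasInt_of_integrable (integrable_inner ((memLp_smul_of_top bL Kl).sub
    (memLp_smul_of_top bdiff (memLp_grad u))) (memLp_grad φ))
  have L2 := hasInt_of_integrable (integrable_inner ((memLp_grad pg).sub (memLp_grad pl))
    (memLp_grad φ))
  have L3 := hasInt_of_integrable (memLp_one_iff_integrable.1 (memLp_mul_of_top_right
    (memLp_mul_of_top bS (memLp_one_iff_integrable.2 iP)) bφ))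
  have L4 := hasInt_of_integrable (memLp_one_iff_integrable.1 (memLp_mul_of_top_right
    (memLp_one_iff_integrable.2 iI) bφ))
  have L5 := hasInt_of_integrable (integrable_inner (memLp_smul_of_top
    (memLp_mul_of_top bρL bL) Kv) (memLp_grad φ))
  have G0 := hasInt_of_integrable ((memLp_mul_of_top (memLp_mul_of_top bΦ (bR.sub bR'))
    bψ).integrable le_top)
  have G1 := hasInt_of_integrable (integrable_inner ((memLp_smul_of_top
    (memLp_mul_of_top bu bL) Kl).add (memLp_smul_of_top (memLp_mul_of_top bρG bG) Kg))
    (memLp_grad ψ))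
  have G2 := hasInt_of_integrable (integrable_inner (memLp_smul_of_top bdiff' (memLp_grad u))
    (memLp_grad ψ))
  have G3 := hasInt_of_integrable (integrable_inner (memLp_smul_of_top (bρG.sub bu)
    ((memLp_grad pg).sub (memLp_grad pl))) (memLp_grad ψ))
  have G4 := hasInt_of_integrable (memLp_one_iff_integrable.1 (memLp_mul_of_top_right
    (memLp_mul_of_top bR (memLp_one_iff_integrable.2 iP)) bψ))
  have G5 := hasInt_of_integrable (integrable_inner (memLp_smul_of_top
    ((memLp_mul_of_top (memLp_mul_of_top bρL bu) bL).add
      (memLp_mul_of_top (memLp_mul_of_top bρG bρG) bG)) Kv) (memLp_grad ψ))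
  -- Gas equation minus liquid equation, with all terms on one side: the integral is zero. Its
  -- integrand dominates the nonnegative energy density, which therefore vanishes.
  have tot := ((((((G0.const_mul (m.T / M)⁻¹).add G1).add G2).add (G3.const_mul η)).add G4).sub
    G5).sub ((((((L0.const_mul (m.T / M)⁻¹).add L1).sub (L2.const_mul η)).add L3).sub L4).sub L5)
  have zero := tot.ae_eq_zero (e := fun x => (m.T / M)⁻¹ * (m.Φ x * (m.sat (fn pl x) (fn pg x) *
    negEnergy (m.uhat (fn pg x))))) ?_ ?_
  · filter_upwards [zero, hm.Φ_pos] with x hx hΦ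
    -- The saturation never reaches zero, so the energy density vanishes only where `(u⁻)³` does.
    have hS := (hm.sat_mem (fn pl x) (fn pg x)).1
    refine hm.nonneg_of_uhat_nonneg (nonneg_of_negEnergy_eq_zero ?_)
    simpa [hΦ.ne', hS.ne'] using (mul_eq_zero.1 hx).resolve_left hδ.ne'
  · have hL' := hL φ
    have hG' := hG ψ
    simp only [Pi.sub_apply, Pi.add_apply, ← sq] at hL' hG' ⊢
    linarith
  · filter_upwards [hu, eψ, eφ, gψ, gφ, hm.Φ_pos, hm.D_pos, nP, nI, hpos]
      with x hu eψ eφ gψ gφ hΦ hD nP nI hpos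
    simp only [Pi.sub_apply, Pi.add_apply]
    rw [hu, eψ, eφ, gψ, gφ]
    have hS := hm.sat_mem (fn pl x) (fn pg x)
    have hS' := hm.sat_mem (plPrev x) (pgPrev x)
    have hU := hlow (fn pg x)
    have hR : m.uhat (fn pg x) < 0 → _ := hm.gasMass_eq (pl := fn pl x) (pg := fn pg x)
    have s1 := negEnergy_step hc hU hS'.1.le hR (hm.le_gasMass _ _)
    -- Here the sign of the previous gas pressure enters: the energy at level `k - 1` is zero.
    rw [negEnergy_of_nonneg (hm.uhat_nonneg hpos), mul_zero, sub_zero] at s1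
    -- With a vanishing earlier state the step inequality reads `S E(u) ≤ r h(u) - S H(u)`, which
    -- gives the production term its sign.
    have s2 := negEnergy_step (S' := 0) (R' := 0) (u' := 0) hc hU le_rfl hR (by simp)
    -- Gravity and the `η` terms are absorbed into the two fluxes: the `η` part of the gas equation
    -- is `η (ρ_g - u) ∇(p_g - p_l)`, so it enters the liquid flux with a minus sign and the gas
    -- flux with a plus sign.
    have s3 := flux_difference_nonneg (ρL := m.ρl (fn pg x)) hc hU hm.ρhat_eq_zero rfl (hm.ρl_pos (fn pg x))
      (mul_nonneg (mul_nonneg hΦ.le hS.1.le) hD.le)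
      (m.mobL (m.sat (fn pl x) (fn pg x)) • m.K x (grad pl x) - η • (grad pg x - grad pl x)
        - (m.ρl (fn pg x) * m.mobL (m.sat (fn pl x) (fn pg x))) • m.K x m.gravity)
      (m.mobG (m.sat (fn pl x) (fn pg x)) • m.K x (grad pg x) + η • (grad pg x - grad pl x)
        - (m.ρhat (fn pg x) * m.mobG (m.sat (fn pl x) (fn pg x))) • m.K x m.gravity) (grad u x)
    have hE := negEnergy_nonneg (m.uhat (fn pg x))
    have hH := negPrimSq_nonneg hc hU
    have n1 := mul_nonneg hS.1.le hE
    refine ⟨mul_nonneg hδ.le (mul_nonneg hΦ.le n1), ?_⟩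
    have t1 := mul_le_mul_of_nonneg_left (mul_le_mul_of_nonneg_left s1 hΦ.le) hδ.le
    have t2 := mul_nonneg nP (by linarith : (0 : ℝ) ≤
      m.gasMass (fn pl x) (fn pg x) * negPrim c (m.uhat (fn pg x))
        - m.sat (fn pl x) (fn pg x) * negPrimSq c (m.uhat (fn pg x)))
    have t3 := mul_nonneg nI hH
    simp only [inner_add_left, inner_sub_left, real_inner_smul_left, real_inner_smul_right]
      at s3 ⊢
    linarith

end FlowData.Admissible
end TwoPhase
end

noncomputable section

namespace TwoPhase

/-! ### Joint representatives of `L²(Ω)`-valued functions -/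

section Joint

variable {α β F : Type*} [MeasurableSpace α] [MeasurableSpace β] [NormedAddCommGroup F]
  {μ : Measure α} {ν : Measure β}

/-- `g` is a jointly measurable square-integrable representative of `f : α → L²(ν)`. -/
structure IsJointRep (μ : Measure α) (ν : Measure β) (f : α → Lp F 2 ν) (g : α × β → F) :
    Prop where
  memLp : MemLp g 2 (μ.prod ν)
  ae_eq : ∀ᵐ a ∂μ, (fun b => g (a, b)) =ᵐ[ν] f a

theorem lintegral_enorm_sq_eq {f : β → F} :
    ∫⁻ b, ‖f b‖ₑ ^ (2 : ℝ) ∂ν = eLpNorm f 2 ν ^ (2 : ℝ) := by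
  rw [eLpNorm_eq_lintegral_rpow_enorm_toReal two_ne_zero ENNReal.ofNat_ne_top, ← ENNReal.rpow_mul]
  simp

/-- By Tonelli, passing to a joint representative is an isometry; Cauchy sequences of functions thus
give Cauchy sequences of representatives. -/
theorem IsJointRep.eLpNorm_sub [SFinite ν] {f f' : α → Lp F 2 ν} {g g' : α × β → F}
    (h : IsJointRep μ ν f g) (h' : IsJointRep μ ν f' g') :
    eLpNorm (g - g') 2 (μ.prod ν) = eLpNorm (f - f') 2 μ := by
  have key : eLpNorm (g - g') 2 (μ.prod ν) ^ (2 : ℝ) = eLpNorm (f - f') 2 μ ^ (2 : ℝ) := by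
    rw [← lintegral_enorm_sq_eq, ← lintegral_enorm_sq_eq,
      lintegral_prod _ ((h.memLp.1.sub h'.memLp.1).enorm.pow_const _)]
    refine lintegral_congr_ae ?_
    filter_upwards [h.ae_eq, h'.ae_eq] with a h1 h2
    rw [Pi.sub_apply, Lp.enorm_def, ← lintegral_enorm_sq_eq]
    refine lintegral_congr_ae ?_
    filter_upwards [h1, h2, Lp.coeFn_sub (f a) (f' a)] with b h1 h2 h3
    rw [h3, Pi.sub_apply, Pi.sub_apply, h1, h2]
  exact (ENNReal.rpow_left_injective two_ne_zero) key

/-- Representatives `g n` of a convergent sequence converge to some `G` in `L²` of the product. For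
almost every `a` the distance between the slice of `G` and `f a` is controlled, for each `n`, by the
slice errors `A n a` and `B n a` of the two convergences. -/
theorem isClosed_exists_jointRep [SFinite ν] [CompleteSpace F] :
    IsClosed {f : Lp (Lp F 2 ν) 2 μ | ∃ g, IsJointRep μ ν f g} := by
  refine IsSeqClosed.isClosed fun x f hx hxf => ?_
  choose g hg using hx
  have hc : CauchySeq fun n => (hg n).memLp.toLp (g n) := by
    have hx' := hxf.cauchySeq
    rw [Metric.cauchySeq_iff] at hx' ⊢
    intro ε hε
    obtain ⟨N, hN⟩ := hx' ε hε
    refine ⟨N, fun i hi j hj => ?_⟩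
    have e : dist ((hg i).memLp.toLp (g i)) ((hg j).memLp.toLp (g j)) = dist (x i) (x j) := by
      rw [dist_edist, dist_edist, Lp.edist_toLp_toLp, Lp.edist_def, (hg i).eLpNorm_sub (hg j)]
    rw [e]
    exact hN i hi j hj
  obtain ⟨G', hG⟩ := cauchySeq_tendsto_of_complete hc
  have mG := Lp.memLp G'
  generalize hGG : (G' : α × β → F) = G at mG
  refine ⟨G, mG, ?_⟩
  have t1 : Tendsto (fun n => eLpNorm (g n - G) 2 (μ.prod ν)) atTop (𝓝 0) := by
    refine ((Lp.tendsto_Lp_iff_tendsto_eLpNorm' _ _).1 hG).congr fun n => eLpNorm_congr_ae ?_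
    filter_upwards [(hg n).memLp.coeFn_toLp] with z hz
    rw [Pi.sub_apply, Pi.sub_apply, hz, hGG]
  have t2 := (Lp.tendsto_Lp_iff_tendsto_eLpNorm' _ _).1 hxf
  set A : ℕ → α → ℝ≥0∞ := fun n a => ∫⁻ b, ‖(g n - G) (a, b)‖ₑ ^ (2 : ℝ) ∂ν
  set B : ℕ → α → ℝ≥0∞ := fun n a => ‖(x n : α → Lp F 2 ν) a - f a‖ₑ ^ (2 : ℝ)
  have mA : ∀ n, AEMeasurable (fun z => ‖(g n - G) z‖ₑ ^ (2 : ℝ)) (μ.prod ν) := fun n =>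
    ((hg n).memLp.1.sub mG.1).enorm.pow_const _
  have mA' : ∀ n, AEMeasurable (A n) μ := fun n => (mA n).lintegral_prod_right'
  have mB' : ∀ n, AEMeasurable (B n) μ := fun n =>
    ((Lp.aestronglyMeasurable (x n)).sub (Lp.aestronglyMeasurable f)).enorm.pow_const _
  have tAB : Tendsto (fun n => ∫⁻ a, A n a + B n a ∂μ) atTop (𝓝 0) := by
    have e : ∀ n, ∫⁻ a, A n a + B n a ∂μ = eLpNorm (g n - G) 2 (μ.prod ν) ^ (2 : ℝ)
        + eLpNorm ((x n : α → Lp F 2 ν) - (f : α → Lp F 2 ν)) 2 μ ^ (2 : ℝ) := by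
      intro n
      rw [lintegral_add_left' (mA' n), ← lintegral_enorm_sq_eq, lintegral_prod _ (mA n),
        ← lintegral_enorm_sq_eq]
      rfl
    simp only [e]
    simpa using (t1.ennrpow_const 2).add (t2.ennrpow_const 2)
  -- Taking the infimum over `n` replaces the choice of an almost everywhere convergent subsequence.
  have hinf : ∫⁻ a, ⨅ n, (A n a + B n a) ∂μ = 0 :=
    le_antisymm (ge_of_tendsto' tAB fun n => lintegral_mono fun a => iInf_le _ n) zero_le
  have mAB : AEMeasurable (fun a => ⨅ n, (A n a + B n a)) μ :=
    AEMeasurable.iInf fun n => (mA' n).add (mB' n)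
  rw [lintegral_eq_zero_iff' mAB] at hinf
  have hrep : ∀ᵐ a ∂μ, ∀ n, (fun b => g n (a, b)) =ᵐ[ν] x n a :=
    ae_all_iff.2 fun n => (hg n).ae_eq
  have hmeas : ∀ᵐ a ∂μ, ∀ n, AEStronglyMeasurable (fun b => (g n - G) (a, b)) ν :=
    ae_all_iff.2 fun n => ((hg n).memLp.1.sub mG.1).prodMk_left
  have hmG : ∀ᵐ a ∂μ, AEStronglyMeasurable (fun b => G (a, b)) ν := mG.1.prodMk_left
  filter_upwards [hinf, hrep, hmeas, hmG] with a h0 h1 h2 h3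
  have hle : ∀ n, ∫⁻ b, ‖G (a, b) - f a b‖ₑ ^ (2 : ℝ) ∂ν ≤ 2 * (A n a + B n a) := by
    intro n
    have hB : B n a = ∫⁻ b, ‖x n a b - f a b‖ₑ ^ (2 : ℝ) ∂ν := by
      simp only [B]
      rw [Lp.enorm_def, ← lintegral_enorm_sq_eq]
      refine lintegral_congr_ae ?_
      filter_upwards [Lp.coeFn_sub (x n a) (f a)] with b hb
      rw [hb, Pi.sub_apply]
    rw [hB, ← lintegral_add_left' ((h2 n).enorm.pow_const _),
      ← lintegral_const_mul' _ _ ENNReal.ofNat_ne_top]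
    refine lintegral_mono_ae ?_
    filter_upwards [h1 n] with b hb
    have e : G (a, b) - f a b = -((g n - G) (a, b)) + (x n a b - f a b) := by
      rw [Pi.sub_apply, hb]
      abel
    calc ‖G (a, b) - f a b‖ₑ ^ (2 : ℝ)
        ≤ (‖(g n - G) (a, b)‖ₑ + ‖x n a b - f a b‖ₑ) ^ (2 : ℝ) := by
          refine ENNReal.rpow_le_rpow ?_ (by norm_num)
          rw [e]
          exact (enorm_add_le _ _).trans_eq (by rw [enorm_neg])
      _ ≤ 2 ^ ((2 : ℝ) - 1) * (‖(g n - G) (a, b)‖ₑ ^ (2 : ℝ) + ‖x n a b - f a b‖ₑ ^ (2 : ℝ)) :=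
          ENNReal.rpow_add_le_mul_rpow_add_rpow _ _ (by norm_num)
      _ = _ := by norm_num
  have hz : ∫⁻ b, ‖G (a, b) - f a b‖ₑ ^ (2 : ℝ) ∂ν = 0 := by
    refine le_antisymm ?_ zero_le
    have : (⨅ n, 2 * (A n a + B n a)) = 0 := by
      rw [← ENNReal.mul_iInf_of_ne two_ne_zero ENNReal.ofNat_ne_top]
      rw [Pi.zero_apply] at h0
      rw [h0, mul_zero]
    rw [← this]
    exact le_iInf hle
  have h4 : AEMeasurable (fun b => ‖G (a, b) - f a b‖ₑ ^ (2 : ℝ)) ν :=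
    (h3.sub (Lp.aestronglyMeasurable (f a))).enorm.pow_const _
  rw [lintegral_eq_zero_iff' h4] at hz
  filter_upwards [hz] with b hb
  simpa [sub_eq_zero] using hb

/-- An element of `L²(ν)` comes with a representative chosen for each `a` separately, so joint
measurability is not automatic. It is evident for indicators with a constant value, survives sums
and, by the preceding lemma, limits, hence holds on all of `L²(μ; L²(ν))`. -/
theorem exists_jointRep [IsFiniteMeasure μ] [IsFiniteMeasure ν] [CompleteSpace F]
    {f : α → Lp F 2 ν} (hf : MemLp f 2 μ) : ∃ g, IsJointRep μ ν f g := by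
  refine MemLp.induction (p := 2) ENNReal.ofNat_ne_top (fun f => ∃ g, IsJointRep μ ν f g) ?_ ?_
    isClosed_exists_jointRep ?_ hf
  · intro c s hs _
    refine ⟨(s ×ˢ univ).indicator fun z => c z.2, ?_, .of_forall fun a => ?_⟩
    · exact ((Lp.memLp c).comp_snd μ).indicator (hs.prod MeasurableSet.univ)
    · by_cases ha : a ∈ s
      · simp [ha, indicator]
      · simp only [ha, indicator, mem_prod, mem_univ, and_true, if_false]
        exact (Lp.coeFn_zero F 2 ν).symm
  · rintro f f' - - - ⟨g, hg⟩ ⟨g', hg'⟩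
    · refine ⟨g + g', hg.memLp.add hg'.memLp, ?_⟩
      filter_upwards [hg.ae_eq, hg'.ae_eq] with a h1 h2
      filter_upwards [h1, h2, Lp.coeFn_add (f a) (f' a)] with b h1 h2 h3
      rw [Pi.add_apply, Pi.add_apply, h3, Pi.add_apply, h1, h2]
  · rintro f f' hff' - ⟨g, hg⟩
    refine ⟨g, hg.memLp, ?_⟩
    filter_upwards [hff', hg.ae_eq] with a h1 h2
    rw [← h1]
    exact h2

/-- An iterated integral as an integral over the product. -/
theorem hasInt_iterated [SFinite μ] [SFinite ν] {f : α → β → ℝ} {g : α × β → ℝ}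
    (hg : Integrable g (μ.prod ν))
    (h : ∀ᵐ a ∂μ, f a =ᵐ[ν] fun b => g (a, b)) :
    HasInt (μ.prod ν) g (∫ a, ∫ b, f a b ∂ν ∂μ) := by
  refine ⟨hg, ?_⟩
  rw [integral_prod _ hg]
  refine integral_congr_ae ?_
  filter_upwards [h] with a ha
  exact integral_congr_ae ha.symm

end Joint

end TwoPhase
end

noncomputable section

namespace TwoPhase

/-! ### Weak time derivatives -/

/-- The du Bois-Reymond lemma for continuous functions. -/
theorem const_of_weak_deriv_eq_zero {T : ℝ} (hT : 0 < T) {w : ℝ → ℝ}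
    (hw : ContinuousOn w (Icc 0 T))
    (h : ∀ ζ : ℝ → ℝ, ContDiff ℝ ∞ ζ → HasCompactSupport ζ → tsupport ζ ⊆ Ioo 0 T →
      ∫ t in Ioo 0 T, deriv ζ t * w t = 0) : ∀ t ∈ Icc 0 T, w t = w 0 := by
  -- The radii place the support of the bump in `[T/4, 3T/4]`, inside `(0,T)`.
  let B : ContDiffBump (T / 2) := ⟨T / 8, T / 4, by positivity, by linarith⟩
  set χ₀ : ℝ → ℝ := B.normed volume
  have hχ₀ : ContDiff ℝ ∞ χ₀ := B.contDiff_normed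
  have cχ₀ : HasCompactSupport χ₀ := B.hasCompactSupport_normed
  have sχ₀ : tsupport χ₀ ⊆ Ioo 0 T := by
    rw [B.tsupport_normed_eq, Real.closedBall_eq_Icc]
    intro x hx
    change x ∈ Icc (T / 2 - T / 4) (T / 2 + T / 4) at hx
    exact ⟨by linarith [hx.1], by linarith [hx.2]⟩
  have iχ₀ : ∫ x, χ₀ x = 1 := B.integral_normed
  set k : ℝ := ∫ t in Ioo 0 T, χ₀ t * w t
  have hwi : IntegrableOn w (Ioo 0 T) := (hw.integrableOn_Icc).mono_set Ioo_subset_Icc_self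
  have mulInt : ∀ χ : ℝ → ℝ, Continuous χ → IntegrableOn (fun t => χ t * w t) (Ioo 0 T) :=
    fun χ hχ => ((hχ.continuousOn.mul hw).integrableOn_Icc).mono_set Ioo_subset_Icc_self
  have restr : ∀ χ : ℝ → ℝ, tsupport χ ⊆ Ioo 0 T → ∀ f : ℝ → ℝ,
      ∫ t in Ioo 0 T, χ t * f t = ∫ t, χ t * f t := fun χ hχ f =>
    setIntegral_eq_integral_of_forall_compl_eq_zero fun x hx => by
      rw [image_eq_zero_of_notMem_tsupport fun h => hx (hχ h), zero_mul]
  have key : ∀ χ : ℝ → ℝ, ContDiff ℝ ∞ χ → HasCompactSupport χ → tsupport χ ⊆ Ioo 0 T →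
      ∫ t, χ t • (w t - k) = 0 := by
    intro χ hχ cχ sχ
    set I : ℝ := ∫ t, χ t
    -- Subtracting the multiple of the unit-mass bump makes the mean zero, so the primitive of `θ`
    -- is compactly supported and admissible as a test function.
    set θ : ℝ → ℝ := fun t => χ t - I * χ₀ t
    have hθ : ContDiff ℝ ∞ θ := hχ.sub (contDiff_const.mul hχ₀)
    have iχ : Integrable χ := hχ.continuous.integrable_of_hasCompactSupport cχ
    have iθ : Integrable θ :=
      iχ.sub ((hχ₀.continuous.integrable_of_hasCompactSupport cχ₀).const_mul I)
    have θ0 : ∫ t, θ t = 0 := by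
      simp only [θ]
      rw [integral_sub iχ ((hχ₀.continuous.integrable_of_hasCompactSupport cχ₀).const_mul I),
        integral_const_mul, iχ₀]
      simp [I]
    obtain ⟨a, b, ha, hb, hab⟩ : ∃ a b, 0 < a ∧ b < T ∧ ∀ t ∉ Icc a b, θ t = 0 := by
      have hne : (tsupport χ ∪ tsupport χ₀).Nonempty := by
        refine Nonempty.inr ?_
        by_contra! h0
        have : χ₀ = 0 := tsupport_eq_empty_iff.1 h0
        rw [this] at iχ₀
        simp at iχ₀
      have hcomp : IsCompact (tsupport χ ∪ tsupport χ₀) := cχ.union cχ₀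
      obtain ⟨a, ha, ha'⟩ := hcomp.exists_isLeast hne
      obtain ⟨b, hb, hb'⟩ := hcomp.exists_isGreatest hne
      refine ⟨a, b, ((union_subset sχ sχ₀) ha).1, ((union_subset sχ sχ₀) hb).2, fun t ht => ?_⟩
      have ht' : t ∉ tsupport χ ∪ tsupport χ₀ := fun h => ht ⟨ha' h, hb' h⟩
      rw [mem_union, not_or] at ht'
      simp [θ, image_eq_zero_of_notMem_tsupport ht'.1, image_eq_zero_of_notMem_tsupport ht'.2]
    set ζ : ℝ → ℝ := fun t => ∫ s in (0 : ℝ)..t, θ s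
    have dζ : ∀ t, HasDerivAt ζ (θ t) t := fun t =>
      (hθ.continuous.integral_hasStrictDerivAt 0 t).hasDerivAt
    have dζ' : deriv ζ = θ := funext fun t => (dζ t).deriv
    have ζsmooth : ContDiff ℝ ∞ ζ := by
      rw [contDiff_infty_iff_deriv, dζ']
      exact ⟨fun t => (dζ t).differentiableAt, hθ⟩
    have ζ0 : ∀ t ∉ Icc a b, ζ t = 0 := by
      intro t ht
      rw [mem_Icc, not_and_or, not_le, not_le] at ht
      rcases ht with ht | ht
      · have : ζ t = ∫ s in (0 : ℝ)..t, (0 : ℝ) := by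
          refine intervalIntegral.integral_congr fun s hs => hab s fun hs' => ?_
          have : s ≤ max 0 t := hs.2
          rcases le_total 0 t with h | h
          · rw [max_eq_right h] at this
            linarith [hs'.1]
          · rw [max_eq_left h] at this
            linarith [hs'.1]
        simpa using this
      · rcases lt_or_ge t 0 with h0 | h0
        · have : ζ t = ∫ s in (0 : ℝ)..t, (0 : ℝ) := by
            refine intervalIntegral.integral_congr fun s hs => hab s fun hs' => ?_
            rw [uIcc_of_ge h0.le] at hs
            linarith [hs'.1, hs.2]
          simpa using this
        · rw [← θ0]
          simp only [ζ]
          rw [intervalIntegral.integral_of_le h0]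
          refine setIntegral_eq_integral_of_forall_compl_eq_zero fun s hs => hab s fun hs' => ?_
          exact hs ⟨ha.trans_le hs'.1, hs'.2.trans ht.le⟩
    have sζ : tsupport ζ ⊆ Icc a b :=
      closure_minimal (fun t ht => by_contra fun h' => ht (ζ0 t h')) isClosed_Icc
    have h0 := h ζ ζsmooth (isCompact_Icc.of_isClosed_subset (isClosed_tsupport _) sζ)
      (sζ.trans fun t ht => ⟨ha.trans_le ht.1, ht.2.trans_lt hb⟩)
    rw [dζ'] at h0
    have e1 : ∫ t in Ioo 0 T, θ t * w t = (∫ t in Ioo 0 T, χ t * w t) - I * k := by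
      rw [← integral_const_mul, ← integral_sub (mulInt χ hχ.continuous)
        ((mulInt χ₀ hχ₀.continuous).const_mul I)]
      congr 1
      funext t
      ring
    have e2 : ∫ t, χ t • (w t - k) = (∫ t in Ioo 0 T, χ t * w t) - I * k := by
      simp only [smul_eq_mul]
      rw [← restr χ sχ fun t => w t - k]
      simp only [mul_sub]
      rw [integral_sub (mulInt χ hχ.continuous) (iχ.mul_const k).integrableOn,
        restr χ sχ fun _ => k, integral_mul_const]
    rw [e2, ← e1, h0]
  have hae := isOpen_Ioo.ae_eq_zero_of_integral_contDiff_smul_eq_zero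
    ((hwi.sub (integrableOn_const (by simp))).locallyIntegrableOn) key
  have hIcc : EqOn w (fun _ => k) (Icc 0 T) := by
    refine Measure.eqOn_Icc_of_ae_eq volume hT.ne ?_ hw continuousOn_const
    rw [← restrict_Ioo_eq_restrict_Icc]
    refine (ae_restrict_iff' measurableSet_Ioo).2 ?_
    filter_upwards [hae] with t ht htT
    exact sub_eq_zero.1 (ht htT)
  intro t ht
  rw [hIcc ht, hIcc ⟨le_rfl, hT.le⟩]

/-- A continuous function with integrable weak derivative is a primitive of it. -/
theorem eq_primitive_of_weak_deriv {T : ℝ} (hT : 0 < T) {f c : ℝ → ℝ}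
    (hf : IntegrableOn f (Ioo 0 T)) (hc : ContinuousOn c (Icc 0 T))
    (h : ∀ ζ : ℝ → ℝ, ContDiff ℝ ∞ ζ → HasCompactSupport ζ → tsupport ζ ⊆ Ioo 0 T →
      ∫ t in Ioo 0 T, ζ t * f t = -∫ t in Ioo 0 T, deriv ζ t * c t) :
    ∀ t ∈ Icc 0 T, c t = c 0 + ∫ s in (0 : ℝ)..t, f s := by
  have hfi : IntervalIntegrable f volume 0 T := by
    rw [intervalIntegrable_iff_integrableOn_Ioo_of_le hT.le]
    exact hf
  set F : ℝ → ℝ := fun t => ∫ s in (0 : ℝ)..t, f s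
  have acF : AbsolutelyContinuousOnInterval F 0 T :=
    hfi.absolutelyContinuousOnInterval_intervalIntegral (by simp)
  have hF : ContinuousOn F (Icc 0 T) := by
    have := acF.continuousOn
    rwa [uIcc_of_le hT.le] at this
  have dF : ∀ᵐ t, t ∈ uIcc 0 T → deriv F t = f t := by
    filter_upwards [hfi.ae_hasDerivAt_integral] with t ht h'
    exact (ht h' 0 (by simp)).deriv
  -- The difference `c - F` has zero weak derivative: `F` is absolutely continuous, so integration
  -- by parts applies, and `ζ` vanishes at both ends.
  have hconst := const_of_weak_deriv_eq_zero hT (hc.sub hF) fun ζ h1 h2 h3 => by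
    have acζ : AbsolutelyContinuousOnInterval ζ 0 T :=
      (h1.of_le (by exact_mod_cast le_top)).contDiffOn.absolutelyContinuousOnInterval
    have z0 : ζ 0 = 0 := image_eq_zero_of_notMem_tsupport fun h => (h3 h).1.false
    have zT : ζ T = 0 := image_eq_zero_of_notMem_tsupport fun h => (h3 h).2.false
    have ibp := acζ.integral_mul_deriv_eq_deriv_mul acF
    rw [z0, zT, zero_mul, zero_mul, sub_zero, zero_sub] at ibp
    have e : ∫ t in (0 : ℝ)..T, ζ t * deriv F t = ∫ t in (0 : ℝ)..T, ζ t * f t := by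
      refine intervalIntegral.integral_congr_ae ?_
      filter_upwards [dF] with t ht h'
      rw [ht (uIoc_subset_uIcc h')]
    rw [e, intervalIntegral.integral_of_le hT.le, intervalIntegral.integral_of_le hT.le,
      integral_Ioc_eq_integral_Ioo, integral_Ioc_eq_integral_Ioo, h ζ h1 h2 h3, neg_inj] at ibp
    have hd : ContinuousOn (deriv ζ) (Icc 0 T) := (h1.continuous_deriv (by simp)).continuousOn
    simp only [Pi.sub_apply, mul_sub]
    rw [integral_sub (f := fun t => deriv ζ t * c t) (g := fun t => deriv ζ t * F t)
      ((hd.mul hc).integrableOn_Icc.mono_set Ioo_subset_Icc_self)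
      ((hd.mul hF).integrableOn_Icc.mono_set Ioo_subset_Icc_self), ibp, sub_self]
  intro t ht
  have h1 := hconst t ht
  simp only [Pi.sub_apply, F, intervalIntegral.integral_same] at h1
  linarith

end TwoPhase
end

noncomputable section

namespace TwoPhase

/-! ### Families of functionals with a square-integrable weak time derivative -/

section Evolution

variable {X : Type*} [NormedAddCommGroup X] [NormedSpace ℝ X]

/-- The extension of `L`, defined on `(0,T)`, by its initial value to nonpositive times. -/
def extendInitial {α : Type*} (L : ℝ → α) (L0 : α) (t : ℝ) : α := if t ≤ 0 then L0 else L t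

/-- `ξ` is the distributional derivative of the family of functionals `L`, with initial value
`L0`. -/
structure IsEvolution (T : ℝ) (L : ℝ → X → ℝ) (L0 : X → ℝ) (ξ : ℝ → X →L[ℝ] ℝ) : Prop where
  memLp : MemLp ξ 2 (volume.restrict (Ioo 0 T))
  cont : ∀ᵐ t ∂volume.restrict (Ioo 0 T), Continuous (L t)
  cont0 : Continuous L0
  weak : ∀ ζ : ℝ → ℝ, ContDiff ℝ ∞ ζ → HasCompactSupport ζ → tsupport ζ ⊆ Ioo 0 T → ∀ ψ : X,
    ∫ t in Ioo 0 T, ζ t * ξ t ψ = -∫ t in Ioo 0 T, deriv ζ t * L t ψ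
  initial : ∀ ψ : X, ∃ c : ℝ → ℝ, ContinuousOn c (Icc 0 T) ∧
    (∀ᵐ t ∂volume.restrict (Ioo 0 T), c t = L t ψ) ∧ c 0 = L0 ψ

namespace IsEvolution

variable {T : ℝ} {L : ℝ → X → ℝ} {L0 : X → ℝ} {ξ : ℝ → X →L[ℝ] ℝ}

theorem memLp_indicator (h : IsEvolution T L L0 ξ) : MemLp ((Ioo 0 T).indicator ξ) 2 volume :=
  (memLp_indicator_iff_restrict (f := ξ) (μ := volume) measurableSet_Ioo).2 h.memLp

theorem integrable_indicator (h : IsEvolution T L L0 ξ) : Integrable ((Ioo 0 T).indicator ξ) volume :=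
  (integrable_indicator_iff (f := ξ) (μ := volume) measurableSet_Ioo).2
    (h.memLp.integrable one_le_two)

theorem integrable_apply (h : IsEvolution T L L0 ξ) (ψ : X) :
    Integrable fun s => (Ioo 0 T).indicator ξ s ψ :=
  h.integrable_indicator.apply_continuousLinearMap ψ

theorem ae_eq_primitive_apply (hT : 0 < T) (h : IsEvolution T L L0 ξ) (ψ : X) :
    ∀ᵐ t ∂volume.restrict (Ioo 0 T),
      L t ψ = L0 ψ + ∫ s in (0 : ℝ)..t, (Ioo 0 T).indicator ξ s ψ := by
  obtain ⟨c, hc, hcL, hc0⟩ := h.initial ψ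
  have key := eq_primitive_of_weak_deriv hT (h.integrable_apply ψ).integrableOn hc
    fun ζ h1 h2 h3 => by
      have e1 : ∫ t in Ioo 0 T, ζ t * (Ioo 0 T).indicator ξ t ψ
          = ∫ t in Ioo 0 T, ζ t * ξ t ψ := setIntegral_congr_fun measurableSet_Ioo fun t ht => by
        simp only [indicator_of_mem ht]
      rw [e1, h.weak ζ h1 h2 h3 ψ]
      congr 1
      refine integral_congr_ae ?_
      filter_upwards [hcL] with t ht
      rw [ht]
  filter_upwards [hcL, self_mem_ae_restrict measurableSet_Ioo] with t ht htT
  rw [← ht, key t (Ioo_subset_Icc_self htT), hc0]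

/-- The null set of times obtained above depends on `ψ`. Both sides are continuous in `ψ`, the
integral of `ξ` being itself a bounded functional, so a countable dense set of `ψ` gives a single
null set. This is what allows `ψ` to depend on time later. For `t ≤ 0` the formula persists since
`ξ` is extended by zero and `L` by its initial value. -/
theorem ae_eq_primitive [TopologicalSpace.SeparableSpace X] (hT : 0 < T)
    (h : IsEvolution T L L0 ξ) :
    ∀ᵐ t, t < T → ∀ ψ, extendInitial L L0 t ψ
      = L0 ψ + ∫ s in (0 : ℝ)..t, (Ioo 0 T).indicator ξ s ψ := by
  rcases isEmpty_or_nonempty X with hX | hX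
  · exact .of_forall fun t _ ψ => (hX.false ψ).elim
  obtain ⟨e, he⟩ := TopologicalSpace.exists_dense_seq X
  have h1 : ∀ᵐ t ∂volume.restrict (Ioo 0 T), ∀ n,
      L t (e n) = L0 (e n) + ∫ s in (0 : ℝ)..t, (Ioo 0 T).indicator ξ s (e n) :=
    ae_all_iff.2 fun n => h.ae_eq_primitive_apply hT (e n)
  filter_upwards [(ae_restrict_iff' measurableSet_Ioo).1 h1,
    (ae_restrict_iff' measurableSet_Ioo).1 h.cont] with t h1 h2 htT ψ
  rcases le_or_gt t 0 with ht | ht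
  · rw [extendInitial, if_pos ht]
    have : ∫ s in (0 : ℝ)..t, (Ioo 0 T).indicator ξ s ψ = ∫ s in (0 : ℝ)..t, (0 : ℝ) := by
      refine intervalIntegral.integral_congr fun s hs => ?_
      rw [uIcc_of_ge ht] at hs
      rw [indicator_of_notMem fun h => (h.1.trans_le hs.2).false]
      rfl
    rw [this]
    simp
  · rw [extendInitial, if_neg (not_le.2 ht)]
    have hint : IntervalIntegrable ((Ioo 0 T).indicator ξ) volume 0 t :=
      h.integrable_indicator.intervalIntegrable
    have hi : ∀ φ : X, ∫ s in (0 : ℝ)..t, (Ioo 0 T).indicator ξ s φ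
        = (∫ s in (0 : ℝ)..t, (Ioo 0 T).indicator ξ s) φ := fun φ =>
      (ContinuousLinearMap.intervalIntegral_apply hint φ).symm
    have heq : L t = fun φ => L0 φ + (∫ s in (0 : ℝ)..t, (Ioo 0 T).indicator ξ s) φ := by
      refine he.equalizer (h2 ⟨ht, htT⟩) (h.cont0.add (ContinuousLinearMap.continuous _)) ?_
      funext n
      simp only [Function.comp_apply]
      rw [h1 ⟨ht, htT⟩ n, hi]
    rw [heq, hi]

/-- The primitive formula is subtracted at `t` and `t - δ`. The extension to nonpositive times lets
one formula cover also the initial layer `t ≤ δ`. -/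
theorem ae_sub_eq [TopologicalSpace.SeparableSpace X] (hT : 0 < T)
    (h : IsEvolution T L L0 ξ) {δ : ℝ} (hδ : 0 < δ) :
    ∀ᵐ t ∂volume.restrict (Ioo 0 T), ∀ ψ, L t ψ - extendInitial L L0 (t - δ) ψ
      = ∫ r in (0 : ℝ)..δ, (Ioo 0 T).indicator ξ (t - r) ψ := by
  have h1 := h.ae_eq_primitive hT
  have h2 := (measurePreserving_sub_right (volume : Measure ℝ) δ).quasiMeasurePreserving.ae h1
  rw [ae_restrict_iff' measurableSet_Ioo]
  filter_upwards [h1, h2] with t h1 h2 ht ψ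
  have h1' := h1 ht.2 ψ
  rw [extendInitial, if_neg (not_le.2 ht.1)] at h1'
  rw [h1', h2 (by linarith [ht.2]) ψ, intervalIntegral.integral_comp_sub_left
    (fun s => (Ioo 0 T).indicator ξ s ψ), sub_zero, add_sub_add_left_eq_sub,
    intervalIntegral.integral_interval_sub_left (h.integrable_apply ψ).intervalIntegrable
      (h.integrable_apply ψ).intervalIntegrable]

/-- Difference quotients of `L`, paired with a square-integrable function, converge to the
pairing with the derivative. -/
theorem tendsto_difference_quotient [TopologicalSpace.SeparableSpace X] (hT : 0 < T)
    (h : IsEvolution T L L0 ξ) {ψ : ℝ → X} (hψ : MemLp ψ 2 (volume.restrict (Ioo 0 T))) :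
    Tendsto (fun δ => δ⁻¹ * ∫ t in Ioo 0 T, (L t (ψ t) - extendInitial L L0 (t - δ) (ψ t)))
      (𝓝[>] 0) (𝓝 (∫ t in Ioo 0 T, ξ t (ψ t))) := by
  set Ξ := (Ioo 0 T).indicator ξ
  set Ψ := (Ioo 0 T).indicator ψ
  have hΞ : MemLp Ξ 2 := h.memLp_indicator
  have hΨ : MemLp Ψ 2 := (memLp_indicator_iff_restrict measurableSet_Ioo).2 hψ
  set g : ℝ → ℝ := fun r => ∫ t, Ξ (t - r) (Ψ t)
  -- Translation is continuous in `L²`, and the pairing of `L²(X')` with `L²(X)` is continuous.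
  have hg : Continuous g := by
    let sub : ℝ → C(ℝ, ℝ) := fun r => ⟨fun t => t - r, by fun_prop⟩
    have hsub : Continuous sub := ContinuousMap.continuous_of_continuous_uncurry _ (by
      simp only [Function.uncurry_def, sub, ContinuousMap.coe_mk]
      fun_prop)
    have hmp : ∀ r, MeasurePreserving (sub r) volume volume := fun r =>
      measurePreserving_sub_right volume r
    have c1 : Continuous fun r => Lp.compMeasurePreserving (sub r) (hmp r) (hΞ.toLp Ξ) :=
      continuous_const.compMeasurePreservingLp hsub hmp ENNReal.ofNat_ne_top
    have c2 : Continuous fun r => (ContinuousLinearMap.id ℝ (X →L[ℝ] ℝ)).lpPairing volume 2 2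
        (Lp.compMeasurePreserving (sub r) (hmp r) (hΞ.toLp Ξ)) (hΨ.toLp Ψ) :=
      Continuous.clm_apply (Continuous.comp (ContinuousLinearMap.continuous _) c1)
        continuous_const
    refine c2.congr fun r => ?_
    rw [ContinuousLinearMap.lpPairing_eq_integral]
    refine integral_congr_ae ?_
    filter_upwards [Lp.coeFn_compMeasurePreserving (hΞ.toLp Ξ) (hmp r), hΨ.coeFn_toLp,
      (hmp r).quasiMeasurePreserving.ae_eq_comp hΞ.coeFn_toLp] with t h1 h2 h3
    rw [h1, h2, h3]
    rfl
  have hswap : ∀ δ : ℝ, 0 < δ → ∫ t in Ioo 0 T, (L t (ψ t) - extendInitial L L0 (t - δ) (ψ t))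
      = ∫ r in (0 : ℝ)..δ, g r := by
    intro δ hδ
    have e1 : ∫ t in Ioo 0 T, (L t (ψ t) - extendInitial L L0 (t - δ) (ψ t))
        = ∫ t, ∫ r in Ioc 0 δ, Ξ (t - r) (Ψ t) := by
      have e0 : ∫ t in Ioo 0 T, ∫ r in Ioc 0 δ, Ξ (t - r) (Ψ t)
          = ∫ t, ∫ r in Ioc 0 δ, Ξ (t - r) (Ψ t) :=
        setIntegral_eq_integral_of_forall_compl_eq_zero fun t ht => by
          simp only [Ψ, indicator_of_notMem ht, map_zero, integral_zero]
      rw [← e0]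
      refine integral_congr_ae ?_
      filter_upwards [h.ae_sub_eq hT hδ, self_mem_ae_restrict measurableSet_Ioo] with t ht htT
      rw [ht, intervalIntegral.integral_of_le hδ.le]
      simp only [Ψ, indicator_of_mem htT]
      rfl
    rw [e1, intervalIntegral.integral_of_le hδ.le]
    refine integral_integral_swap ?_
    have hone : Integrable ((Ioc 0 δ).indicator fun _ => (1 : ℝ)) :=
      (integrable_indicator_iff measurableSet_Ioc).2 (integrableOn_const (by simp))
    have hsq : Integrable fun s => ‖Ξ s‖ ^ 2 := hΞ.integrable_norm_pow two_ne_zero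
    -- For the exchange of integrals, `|Ξ(t - r)(Ψ t)|` is bounded by `‖Ξ(t - r)‖² + ‖Ψ t‖²`. The
    -- first summand is integrable as a convolution integrand of `‖Ξ‖²` with the indicator of `(0,
    -- δ]`.
    have hconv := hone.convolution_integrand (ContinuousLinearMap.mul ℝ ℝ) hsq
    have hprod : (volume : Measure ℝ).prod (volume.restrict (Ioc 0 δ))
        = ((volume : Measure ℝ).prod volume).restrict (univ ×ˢ Ioc 0 δ) := by
      rw [← Measure.prod_restrict, Measure.restrict_univ]
    have i1 : Integrable (fun p : ℝ × ℝ => ‖Ξ (p.1 - p.2)‖ ^ 2)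
        ((volume : Measure ℝ).prod (volume.restrict (Ioc 0 δ))) := by
      rw [hprod]
      refine hconv.restrict.congr ?_
      filter_upwards [self_mem_ae_restrict (MeasurableSet.univ.prod measurableSet_Ioc)] with p hp
      simp [indicator_of_mem hp.2]
    have i2 : Integrable (fun p : ℝ × ℝ => ‖Ψ p.1‖ ^ 2)
        ((volume : Measure ℝ).prod (volume.restrict (Ioc 0 δ))) :=
      (hΨ.integrable_norm_pow two_ne_zero).comp_fst _
    have m1 : AEStronglyMeasurable (fun p : ℝ × ℝ => Ξ (p.1 - p.2))
        ((volume : Measure ℝ).prod (volume.restrict (Ioc 0 δ))) := by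
      rw [hprod]
      exact (hΞ.1.comp_quasiMeasurePreserving
        (quasiMeasurePreserving_sub_of_right_invariant volume volume)).restrict
    have m2 : AEStronglyMeasurable (fun p : ℝ × ℝ => Ψ p.1)
        ((volume : Measure ℝ).prod (volume.restrict (Ioc 0 δ))) := hΨ.1.comp_fst
    refine (i1.add i2).mono'
      ((ContinuousLinearMap.id ℝ (X →L[ℝ] ℝ)).aestronglyMeasurable_comp₂ m1 m2)
      (.of_forall fun p => ?_)
    simp only [Function.uncurry, Pi.add_apply]
    refine ((Ξ (p.1 - p.2)).le_opNorm _).trans ?_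
    nlinarith [sq_nonneg (‖Ξ (p.1 - p.2)‖ - ‖Ψ p.1‖), sq_nonneg ‖Ξ (p.1 - p.2)‖,
      sq_nonneg ‖Ψ p.1‖]
  have hg0 : g 0 = ∫ t in Ioo 0 T, ξ t (ψ t) := by
    simp only [g, sub_zero]
    rw [← setIntegral_eq_integral_of_forall_compl_eq_zero (s := Ioo 0 T)]
    · refine setIntegral_congr_fun measurableSet_Ioo fun t ht => ?_
      simp only [Ξ, Ψ, indicator_of_mem ht]
    · intro t ht
      simp only [Ψ, indicator_of_notMem ht, map_zero]
  -- The difference quotient is now the mean of the continuous function `g` over `(0, δ)`, which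
  -- tends to `g 0`.
  have hderiv := (hg.integral_hasStrictDerivAt 0 0).hasDerivAt.hasDerivWithinAt (s := Ioi 0)
  rw [hasDerivWithinAt_iff_tendsto_slope' (by simp), hg0] at hderiv
  refine hderiv.congr' ?_
  filter_upwards [self_mem_nhdsWithin] with δ hδ
  rw [hswap δ hδ, slope_def_field]
  simp
  ring

end IsEvolution

end Evolution

end TwoPhase
end

noncomputable section

namespace TwoPhase

/-! ### The evolution problem -/

theorem norm_snd_le {d : ℕ} {Ω : Set (E d)} (v : L2Pair Ω) : ‖v.snd‖ ≤ ‖v‖ := by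
  refine le_of_sq_le_sq ?_ (norm_nonneg _)
  rw [WithLp.prod_norm_sq_eq_of_L2]
  linarith [sq_nonneg ‖v.fst‖]

/-- A jointly measurable representative of the gradient of a square-integrable function of time
with values in a subspace of `H¹(Ω)`. -/
theorem exists_joint_grad {d : ℕ} {Ω : Set (E d)} {W : Submodule ℝ (L2Pair Ω)} {μ : Measure ℝ}
    [IsFiniteMeasure μ] [IsFiniteMeasure (volume.restrict Ω)] {v : ℝ → W} (hv : MemLp v 2 μ) :
    ∃ g : ℝ × E d → E d, MemLp g 2 (μ.prod (volume.restrict Ω)) ∧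
      ∀ᵐ t ∂μ, grad (v t) =ᵐ[volume.restrict Ω] fun x => g (t, x) := by
  have hc : Continuous fun w : W => (w : L2Pair Ω).snd := by fun_prop
  have h : MemLp (fun t => (v t : L2Pair Ω).snd) 2 μ :=
    hv.of_le (hc.comp_aestronglyMeasurable hv.1) (.of_forall fun t => norm_snd_le _)
  obtain ⟨g, hg⟩ := exists_jointRep h
  exact ⟨g, hg.memLp, hg.ae_eq.mono fun t ht => ht.symm⟩

theorem exists_ae_bound {α F : Type*} [MeasurableSpace α] [NormedAddCommGroup F] {μ : Measure α}
    {f : α → F} (hf : MemLp f ∞ μ) : ∃ C : ℝ, ∀ᵐ x ∂μ, ‖f x‖ ≤ C := by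
  refine ⟨(eLpNorm f ∞ μ).toReal, ?_⟩
  filter_upwards [ae_le_eLpNormEssSup (f := f) (μ := μ)] with x hx
  rw [← toReal_enorm]
  exact ENNReal.toReal_mono hf.2.ne (by rwa [eLpNorm_exponent_top])

theorem continuous_integral_mul_fn {d : ℕ} {Ω : Set (E d)} {W : Submodule ℝ (L2Pair Ω)}
    {k : E d → ℝ} (hk : MemLp k 2 (volume.restrict Ω)) :
    Continuous fun v : W => ∫ x in Ω, k x * fn v x := by
  have hc : Continuous fun v : W => inner ℝ (hk.toLp k) (v : L2Pair Ω).fst := by fun_prop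
  refine hc.congr fun v => ?_
  rw [L2.inner_def]
  refine integral_congr_ae ?_
  filter_upwards [hk.coeFn_toLp] with x hx
  rw [hx]
  simp [fn, mul_comm]

namespace FlowData.Admissible

variable {d : ℕ} {m : FlowData d}

theorem isFiniteMeasure_volQ (hm : m.Admissible) : IsFiniteMeasure m.volQ := by
  have := hm.isFiniteMeasure_vol
  unfold FlowData.volQ
  infer_instance

theorem volQ_eq (hm : m.Admissible) :
    m.volQ = ((volume : Measure ℝ).prod m.vol).restrict (Ioo 0 m.T ×ˢ univ) := by
  have := hm.isFiniteMeasure_vol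
  rw [← Measure.prod_restrict, Measure.restrict_univ]
  rfl

/-- The functional `ψ ↦ ∫_Ω Φ w ψ`. -/
def massFunctional (m : FlowData d) (w : E d → ℝ) (ψ : m.VD) : ℝ :=
  ∫ x, m.Φ x * w x * fn ψ x ∂m.vol

theorem continuous_massFunctional (hm : m.Admissible) {w : E d → ℝ} (hw : MemLp w ∞ m.vol) :
    Continuous (massFunctional m w) := by
  have := hm.isFiniteMeasure_vol
  exact continuous_integral_mul_fn ((memLp_mul_of_top hm.memLp_Φ hw).mono_exponent le_top)

theorem isEvolution (hm : m.Admissible) {w : ℝ → E d → ℝ} {w0 : E d → ℝ}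
    {ξ : ℝ → m.VD →L[ℝ] ℝ} (hw : MemLp (Function.uncurry w) ∞ m.volQ) (hw0 : MemLp w0 ∞ m.vol)
    (hξ : MemLp ξ 2 m.time) (hd : m.IsWeightedTimeDeriv w ξ) (hi : m.HasWeakInitialValue w w0) :
    IsEvolution m.T (fun t => massFunctional m (w t)) (massFunctional m w0) ξ where
  memLp := hξ
  cont := by
    have := hm.isFiniteMeasure_vol
    obtain ⟨C, hC⟩ := exists_ae_bound hw
    have h1 : ∀ᵐ t ∂m.time, ∀ᵐ x ∂m.vol, ‖w t x‖ ≤ C := Measure.ae_ae_of_ae_prod hC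
    have h2 : ∀ᵐ t ∂m.time, AEStronglyMeasurable (w t) m.vol := hw.1.prodMk_left
    change ∀ᵐ t ∂m.time, _
    filter_upwards [h1, h2] with t h1 h2
    exact hm.continuous_massFunctional (MeasureTheory.memLp_top_of_bound h2 C h1)
  cont0 := hm.continuous_massFunctional hw0
  weak := hd
  initial := hi

/-- Time shifts preserve joint measurability. -/
theorem aestronglyMeasurable_shift (hm : m.Admissible) {f : ℝ → E d → ℝ} {f0 : E d → ℝ}
    (hf : AEStronglyMeasurable (Function.uncurry f) m.volQ) (hf0 : AEStronglyMeasurable f0 m.vol)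
    {δ : ℝ} (hδ : 0 < δ) :
    AEStronglyMeasurable (fun z : ℝ × E d => extendInitial f f0 (z.1 - δ) z.2) m.volQ := by
  have := hm.isFiniteMeasure_vol
  set P := (volume : Measure ℝ).prod m.vol
  have hQ : m.volQ = P.restrict (Ioo 0 m.T ×ˢ univ) := hm.volQ_eq
  have m1 : AEStronglyMeasurable ((Iic (0 : ℝ) ×ˢ univ).indicator fun z : ℝ × E d => f0 z.2) P :=
    hf0.comp_snd.indicator (measurableSet_Iic.prod MeasurableSet.univ)
  have m2 : AEStronglyMeasurable ((Ioo 0 m.T ×ˢ univ).indicator (Function.uncurry f)) P := by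
    rw [aestronglyMeasurable_indicator_iff (measurableSet_Ioo.prod MeasurableSet.univ), ← hQ]
    exact hf
  have hshift : MeasurePreserving (Prod.map (fun t : ℝ => t - δ) (id : E d → E d)) P P :=
    (measurePreserving_sub_right volume δ).prod (MeasurePreserving.id m.vol)
  have m3 := (m1.add m2).comp_measurePreserving hshift
  rw [hQ]
  refine m3.restrict.congr ?_
  filter_upwards [self_mem_ae_restrict (measurableSet_Ioo.prod MeasurableSet.univ)] with z hz
  have hz1 : z.1 - δ < m.T := by linarith [hz.1.2]
  rw [extendInitial]
  split_ifs with h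
  · simp [indicator, h, not_lt.2 h]
  · simp [indicator, h, hz1, not_le.1 h]
    rfl

theorem extendInitial_comp {α β : Type*} (F : α → β) (w : ℝ → α) (w0 : α) (t : ℝ) :
    extendInitial (fun t => F (w t)) (F w0) t = F (extendInitial w w0 t) := by
  unfold extendInitial
  split_ifs <;> rfl

theorem extendInitial_comp₂ {α β γ ι : Type*} (F : α → β → γ) (v : ℝ → ι → α) (w : ℝ → ι → β)
    (v0 : ι → α) (w0 : ι → β) (t : ℝ) (x : ι) :
    extendInitial (fun t x => F (v t x) (w t x)) (fun x => F (v0 x) (w0 x)) t x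
      = F (extendInitial v v0 t x) (extendInitial w w0 t x) := by
  unfold extendInitial
  split_ifs <;> rfl

/-- Converts differences of mass functionals, which are known only after pairing, into integrals
over `Q_T` to which pointwise inequalities apply. -/
theorem hasInt_mass (hm : m.Admissible) {w w' : ℝ → E d → ℝ} {θ : ℝ × E d → ℝ} {ψ : ℝ → m.VD}
    (hw : MemLp (Function.uncurry w) ∞ m.volQ) (hw' : MemLp (Function.uncurry w') ∞ m.volQ)
    (hθ : MemLp θ ∞ m.volQ) (hψ : ∀ᵐ t ∂m.time, fn (ψ t) =ᵐ[m.vol] fun x => θ (t, x)) :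
    HasInt m.volQ (fun z => m.Φ z.2 * (w z.1 z.2 - w' z.1 z.2) * θ z)
      (∫ t, (massFunctional m (w t) (ψ t) - massFunctional m (w' t) (ψ t)) ∂m.time) := by
  have := hm.isFiniteMeasure_vol
  have := hm.isFiniteMeasure_volQ
  have bΦ : MemLp (fun z : ℝ × E d => m.Φ z.2) ∞ m.volQ := hm.memLp_Φ.comp_snd m.time
  have key : ∀ v : ℝ → E d → ℝ, MemLp (Function.uncurry v) ∞ m.volQ →
      Integrable (fun z : ℝ × E d => m.Φ z.2 * v z.1 z.2 * θ z) (m.time.prod m.vol) ∧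
      ∀ᵐ t ∂m.time, massFunctional m (v t) (ψ t) = ∫ x, m.Φ x * v t x * θ (t, x) ∂m.vol := by
    refine fun v hv => ⟨(memLp_mul_of_top (memLp_mul_of_top bΦ hv) hθ).integrable le_top, ?_⟩
    filter_upwards [hψ] with t ht
    refine integral_congr_ae ?_
    filter_upwards [ht] with x hx
    rw [hx]
  obtain ⟨i1, e1⟩ := key w hw
  obtain ⟨i2, e2⟩ := key w' hw'
  have hs : ∫ t, (massFunctional m (w t) (ψ t) - massFunctional m (w' t) (ψ t)) ∂m.time
      = (∫ z, m.Φ z.2 * w z.1 z.2 * θ z ∂m.volQ) - ∫ z, m.Φ z.2 * w' z.1 z.2 * θ z ∂m.volQ := by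
    rw [FlowData.volQ, integral_prod _ i1, integral_prod _ i2,
      ← integral_sub i1.integral_prod_left i2.integral_prod_left]
    refine integral_congr_ae ?_
    filter_upwards [e1, e2] with t h1 h2
    rw [h1, h2]
  rw [hs]
  have h := (hasInt_of_integrable i1).sub (hasInt_of_integrable i2)
  have e : (fun z : ℝ × E d => m.Φ z.2 * (w z.1 z.2 - w' z.1 z.2) * θ z)
      = fun z => m.Φ z.2 * w z.1 z.2 * θ z - m.Φ z.2 * w' z.1 z.2 * θ z := by
    funext z
    ring
  rw [e]
  exact h

/-- A time shift by `δ > 0` does not increase the integral over `Q_T` of a nonnegative function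
which vanishes before the initial time. -/
theorem integral_shift_le (hm : m.Admissible) {κ : ℝ × E d → ℝ} (hκ : Integrable κ m.volQ)
    (h0 : ∀ᵐ z ∂m.volQ, 0 ≤ κ z) (δ : ℝ) :
    Integrable (fun z => (Ioo 0 m.T ×ˢ univ).indicator κ (z.1 - δ, z.2)) m.volQ ∧
    ∫ z, (Ioo 0 m.T ×ˢ univ).indicator κ (z.1 - δ, z.2) ∂m.volQ ≤ ∫ z, κ z ∂m.volQ := by
  have := hm.isFiniteMeasure_vol
  have hs : MeasurableSet (Ioo 0 m.T ×ˢ (univ : Set (E d))) :=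
    measurableSet_Ioo.prod MeasurableSet.univ
  set P := (volume : Measure ℝ).prod m.vol
  have hQ : m.volQ = P.restrict (Ioo 0 m.T ×ˢ univ) := hm.volQ_eq
  rw [hQ] at hκ h0 ⊢
  have hshift : MeasurePreserving (Prod.map (fun t : ℝ => t - δ) (id : E d → E d)) P P :=
    (measurePreserving_sub_right volume δ).prod (MeasurePreserving.id m.vol)
  have hemb : MeasurableEmbedding (Prod.map (fun t : ℝ => t - δ) (id : E d → E d)) :=
    ((MeasurableEquiv.subRight δ).prodCongr (MeasurableEquiv.refl (E d))).measurableEmbedding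
  have hi : Integrable ((Ioo 0 m.T ×ˢ univ).indicator κ) P := (integrable_indicator_iff hs).2 hκ
  have hi' : Integrable (fun z : ℝ × E d => (Ioo 0 m.T ×ˢ univ).indicator κ (z.1 - δ, z.2)) P :=
    hshift.integrable_comp_of_integrable hi
  have hnn : 0 ≤ᵐ[P] (Ioo 0 m.T ×ˢ univ).indicator κ := by
    filter_upwards [(ae_restrict_iff' hs).1 h0] with z hz
    by_cases h : z ∈ Ioo 0 m.T ×ˢ (univ : Set (E d))
    · rw [indicator_of_mem h]
      exact hz h
    · rw [indicator_of_notMem h]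
      rfl
  refine ⟨hi'.restrict, (setIntegral_le_integral hi' ?_).trans_eq ?_⟩
  · exact hshift.quasiMeasurePreserving.ae hnn
  · rw [← integral_indicator hs]
    exact hshift.integral_comp hemb _

end FlowData.Admissible

end TwoPhase
end

/-! ### The weighted energy and its backward time differences -/

noncomputable section

namespace TwoPhase

namespace FlowData.Admissible

variable {d : ℕ} {m : FlowData d}

theorem Φ_pos_volQ (hm : m.Admissible) : ∀ᵐ z ∂m.volQ, 0 < m.Φ z.2 := by
  have := hm.isFiniteMeasure_vol
  exact Measure.quasiMeasurePreserving_snd.ae hm.Φ_pos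

theorem D_pos_volQ (hm : m.Admissible) : ∀ᵐ z ∂m.volQ, 0 < m.D z.2 := by
  have := hm.isFiniteMeasure_vol
  exact Measure.quasiMeasurePreserving_snd.ae hm.D_pos

theorem memLp_exp_neg_time : MemLp (fun t : ℝ => Real.exp (-t)) ∞ m.time := by
  refine MeasureTheory.memLp_top_of_bound
    (by fun_prop : Continuous fun t : ℝ => Real.exp (-t)).aestronglyMeasurable 1 ?_
  filter_upwards [self_mem_ae_restrict measurableSet_Ioo] with t ht
  rw [Real.norm_eq_abs, Real.abs_exp]
  exact Real.exp_le_one_iff.2 (by linarith [ht.1])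

theorem memLp_exp_neg (hm : m.Admissible) :
    MemLp (fun z : ℝ × E d => Real.exp (-z.1)) ∞ m.volQ := by
  have := hm.isFiniteMeasure_vol
  exact memLp_exp_neg_time.comp_fst m.vol

theorem memLp_negEnergy (hm : m.Admissible) {α : Type*} [MeasurableSpace α] {μ : Measure α}
    {f : α → ℝ} (hf : AEStronglyMeasurable f μ) :
    MemLp (fun x => negEnergy (m.uhat (f x))) ∞ μ := by
  obtain ⟨c, C, hc, -, hlow, -⟩ := hm.exists_uhat_bounds
  have hu := hm.memLp_uhat hf
  have e : (fun x => negEnergy (m.uhat (f x))) = fun x =>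
      m.uhat (f x) * negPrim c (m.uhat (f x)) - negPrimSq c (m.uhat (f x)) := by
    funext x
    rw [mul_negPrim_sub_negPrimSq hc (hlow _)]
  rw [e]
  exact (memLp_mul_of_top hu ((isC1Lip_negPrim hc).memLp_comp hu)).sub
    ((isC1Lip_negPrimSq hc).memLp_comp hu)

/-- The weighted energy `e^{-t} Φ S E(u)` at the pressures `(pl, pg)`. -/
def weightedEnergy (m : FlowData d) (pl pg : ℝ → E d → ℝ) (z : ℝ × E d) : ℝ :=
  Real.exp (-z.1) * (m.Φ z.2 * (m.sat (pl z.1 z.2) (pg z.1 z.2) *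
    negEnergy (m.uhat (pg z.1 z.2))))

theorem integrable_weightedEnergy (hm : m.Admissible) {pl pg : ℝ → E d → ℝ}
    (hpl : AEStronglyMeasurable (Function.uncurry pl) m.volQ)
    (hpg : AEStronglyMeasurable (Function.uncurry pg) m.volQ) :
    Integrable (weightedEnergy m pl pg) m.volQ := by
  have := hm.isFiniteMeasure_vol
  have := hm.isFiniteMeasure_volQ
  have bΦ : MemLp (fun z : ℝ × E d => m.Φ z.2) ∞ m.volQ := hm.memLp_Φ.comp_snd m.time
  exact (memLp_mul_of_top hm.memLp_exp_neg (memLp_mul_of_top bΦ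
    (memLp_mul_of_top (hm.memLp_sat hpl hpg) (hm.memLp_negEnergy hpg)))).integrable le_top

theorem weightedEnergy_nonneg (hm : m.Admissible) (pl pg : ℝ → E d → ℝ) :
    ∀ᵐ z ∂m.volQ, 0 ≤ weightedEnergy m pl pg z := by
  filter_upwards [hm.Φ_pos_volQ] with z hz
  exact mul_nonneg (Real.exp_nonneg _) (mul_nonneg hz.le
    (mul_nonneg (hm.sat_mem _ _).1.le (negEnergy_nonneg _)))

/-- The discrete energy inequality for the backward time difference of step `δ`. -/
theorem energy_le_difference (hm : m.Admissible) {pl pg : ℝ → E d → ℝ} {pl0 pg0 : E d → ℝ}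
    (hpl : AEStronglyMeasurable (Function.uncurry pl) m.volQ)
    (hpg : AEStronglyMeasurable (Function.uncurry pg) m.volQ)
    (hpl0 : AEStronglyMeasurable pl0 m.vol) (hpg0 : AEStronglyMeasurable pg0 m.vol)
    (hpos : ∀ᵐ x ∂m.vol, 0 ≤ pg0 x) {c : ℝ} (hc : 0 ≤ c) (hlow : ∀ σ, -c ≤ m.uhat σ)
    {φ ψ : ℝ → m.VD}
    (hφ : ∀ᵐ t ∂m.time, fn (φ t) =ᵐ[m.vol] fun x =>
      Real.exp (-t) * negPrimSq c (m.uhat (pg t x)))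
    (hψ : ∀ᵐ t ∂m.time, fn (ψ t) =ᵐ[m.vol] fun x =>
      Real.exp (-t) * negPrim c (m.uhat (pg t x)))
    {δ : ℝ} (hδ : 0 < δ) :
    (1 - Real.exp (-δ)) * ∫ z, weightedEnergy m pl pg z ∂m.volQ ≤
      ∫ t, (massFunctional m (fun x => m.gasMass (pl t x) (pg t x)) (ψ t)
        - extendInitial (fun t => massFunctional m fun x => m.gasMass (pl t x) (pg t x))
          (massFunctional m fun x => m.gasMass (pl0 x) (pg0 x)) (t - δ) (ψ t)) ∂m.time
      - ∫ t, (massFunctional m (fun x => m.sat (pl t x) (pg t x)) (φ t)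
        - extendInitial (fun t => massFunctional m fun x => m.sat (pl t x) (pg t x))
          (massFunctional m fun x => m.sat (pl0 x) (pg0 x)) (t - δ) (φ t)) ∂m.time := by
  have := hm.isFiniteMeasure_vol
  have := hm.isFiniteMeasure_volQ
  set ql : ℝ → E d → ℝ := fun t x => extendInitial pl pl0 (t - δ) x
  set qg : ℝ → E d → ℝ := fun t x => extendInitial pg pg0 (t - δ) x
  have hql : AEStronglyMeasurable (Function.uncurry ql) m.volQ :=
    hm.aestronglyMeasurable_shift hpl hpl0 hδ
  have hqg : AEStronglyMeasurable (Function.uncurry qg) m.volQ :=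
    hm.aestronglyMeasurable_shift hpg hpg0 hδ
  -- Saturation and gas mass depend pointwise on the pressures, so shifting the functionals amounts
  -- to shifting the pressures.
  have ext : ∀ (k : ℝ → ℝ → ℝ) (t : ℝ), extendInitial
      (fun t => massFunctional m fun x => k (pl t x) (pg t x))
      (massFunctional m fun x => k (pl0 x) (pg0 x)) (t - δ)
      = massFunctional m fun x => k (ql t x) (qg t x) := by
    intro k t
    rw [extendInitial_comp (massFunctional m)]
    congr 1
    funext x
    exact extendInitial_comp₂ k pl pg pl0 pg0 (t - δ) x
  simp only [ext m.gasMass, ext m.sat]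
  have bE := hm.memLp_exp_neg
  have bu := hm.memLp_uhat hpg
  have hR := hm.hasInt_mass (w := fun t x => m.gasMass (pl t x) (pg t x))
    (w' := fun t x => m.gasMass (ql t x) (qg t x))
    (θ := fun z => Real.exp (-z.1) * negPrim c (m.uhat (pg z.1 z.2))) (hm.memLp_gasMass hpl hpg) (hm.memLp_gasMass hql hqg)
    (memLp_mul_of_top bE ((isC1Lip_negPrim hc).memLp_comp bu)) hψ
  have hS := hm.hasInt_mass (w := fun t x => m.sat (pl t x) (pg t x))
    (w' := fun t x => m.sat (ql t x) (qg t x))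
    (θ := fun z => Real.exp (-z.1) * negPrimSq c (m.uhat (pg z.1 z.2))) (hm.memLp_sat hpl hpg) (hm.memLp_sat hql hqg)
    (memLp_mul_of_top bE ((isC1Lip_negPrimSq hc).memLp_comp bu)) hφ
  have hE := hasInt_of_integrable (hm.integrable_weightedEnergy hpl hpg)
  obtain ⟨iκ, hκ⟩ := hm.integral_shift_le (hm.integrable_weightedEnergy hpl hpg)
    (hm.weightedEnergy_nonneg pl pg) δ
  -- The integrand is pointwise nonnegative by `negEnergy_step`. As the shifted energy has integral
  -- at most that of the energy, the factor `1 - e^{-δ}` results.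
  have tot := (hR.sub hS).sub (hE.sub ((hasInt_of_integrable iκ).const_mul (Real.exp (-δ))))
  have h0 : ∀ᵐ z ∂m.volQ, 0 ≤ pg0 z.2 := Measure.quasiMeasurePreserving_snd.ae hpos
  have hT : ∀ᵐ z ∂m.volQ, z ∈ Ioo 0 m.T ×ˢ (univ : Set (E d)) := by
    rw [hm.volQ_eq]
    exact self_mem_ae_restrict (measurableSet_Ioo.prod MeasurableSet.univ)
  have hnn : (0 : ℝ) ≤ _ := (integral_nonneg_of_ae (μ := m.volQ) ?_).trans_eq tot.eq
  · nlinarith [mul_le_mul_of_nonneg_left hκ (Real.exp_nonneg (-δ))]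
  · filter_upwards [h0, hT, hm.Φ_pos_volQ] with z h0 hT hΦ
    have hS' := hm.sat_mem (ql z.1 z.2) (qg z.1 z.2)
    have hRu : m.uhat (pg z.1 z.2) < 0 → _ := hm.gasMass_eq (pl := pl z.1 z.2) (pg := pg z.1 z.2)
    have step := negEnergy_step hc (hlow (pg z.1 z.2)) hS'.1.le hRu (hm.le_gasMass _ _)
    -- After the initial layer this is `e^{-δ} e^{-(t-δ)} = e^{-t}`. Within it both sides vanish:
    -- the left by extension by zero, the right because the initial gas pressure is nonnegative.
    have hshift : Real.exp (-δ) * (Ioo 0 m.T ×ˢ univ).indicator (weightedEnergy m pl pg)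
        (z.1 - δ, z.2) = Real.exp (-z.1) * (m.Φ z.2 * (m.sat (ql z.1 z.2) (qg z.1 z.2) *
          negEnergy (m.uhat (qg z.1 z.2)))) := by
      rcases le_or_gt (z.1 - δ) 0 with h | h
      · have hq : qg z.1 z.2 = pg0 z.2 := by simp only [qg, extendInitial, if_pos h]
        rw [indicator_of_notMem (fun h' => (h'.1.1.trans_le h).false), hq,
          negEnergy_of_nonneg (hm.uhat_nonneg h0)]
        ring
      · have hq : qg z.1 z.2 = pg (z.1 - δ) z.2 := by
          simp only [qg, extendInitial, if_neg (not_le.2 h)]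
        have hq' : ql z.1 z.2 = pl (z.1 - δ) z.2 := by
          simp only [ql, extendInitial, if_neg (not_le.2 h)]
        have hmem : (z.1 - δ, z.2) ∈ Ioo 0 m.T ×ˢ (univ : Set (E d)) :=
          ⟨⟨h, by simp only; linarith [hT.1.2]⟩, mem_univ _⟩
        rw [indicator_of_mem hmem, weightedEnergy, hq, hq', ← mul_assoc, ← Real.exp_add]
        congr 2
        simp only
        ring
    simp only [Pi.zero_apply, hshift]
    have := mul_le_mul_of_nonneg_left step (mul_nonneg (Real.exp_nonneg (-z.1)) hΦ.le)
    simp only [weightedEnergy]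
    linarith

end FlowData.Admissible

end TwoPhase
end

/-! ### The limit of vanishing time step -/

noncomputable section

namespace TwoPhase

/-- Yields the separability of `V` on which the single null set of times in `ae_eq_primitive` rests.
-/
instance secondCountableTopology_L2Pair {d : ℕ} {Ω : Set (E d)} :
    SecondCountableTopology (L2Pair Ω) := by
  have : Fact (1 ≤ (2 : ℝ≥0∞)) := ⟨one_le_two⟩
  have : Fact ((2 : ℝ≥0∞) ≠ ⊤) := ⟨ENNReal.ofNat_ne_top⟩
  have h : ∀ (F : Type) [NormedAddCommGroup F] [TopologicalSpace.SeparableSpace F],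
      SecondCountableTopology (Lp F 2 (volume.restrict Ω)) := fun F _ _ =>
    Lp.SecondCountableTopology
  have := h ℝ
  have := h (E d)
  exact (WithLp.homeomorphProd 2 _ _).secondCountableTopology

namespace FlowData.Admissible

variable {d : ℕ} {m : FlowData d}

theorem memLp_exp_smul {ψ : ℝ → m.VD} (hψ : MemLp ψ 2 m.time) :
    MemLp (fun t => Real.exp (-t) • ψ t) 2 m.time :=
  hψ.smul memLp_exp_neg_time

theorem fn_smul (a : ℝ) (v : m.VD) : fn (a • v) =ᵐ[m.vol] fun x => a * fn v x :=
  Lp.coeFn_smul a (v : L2Pair m.Ω).fst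

theorem grad_smul (a : ℝ) (v : m.VD) : grad (a • v) =ᵐ[m.vol] fun x => a • grad v x :=
  Lp.coeFn_smul a (v : L2Pair m.Ω).snd

/-- The time derivative terms, tested with `e^{-t} h(u)` and `e^{-t} H(u)`, control the weighted
energy. -/
theorem energy_le_timeDeriv (hm : m.Admissible) {pl pg : ℝ → E d → ℝ} {pl0 pg0 : E d → ℝ}
    (hpl : AEStronglyMeasurable (Function.uncurry pl) m.volQ)
    (hpg : AEStronglyMeasurable (Function.uncurry pg) m.volQ)
    (hpl0 : AEStronglyMeasurable pl0 m.vol) (hpg0 : AEStronglyMeasurable pg0 m.vol)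
    (hpos : ∀ᵐ x ∂m.vol, 0 ≤ pg0 x) {c : ℝ} (hc : 0 ≤ c) (hlow : ∀ σ, -c ≤ m.uhat σ)
    {φ ψ : ℝ → m.VD} (mφ : MemLp φ 2 m.time) (mψ : MemLp ψ 2 m.time)
    (hφ : ∀ᵐ t ∂m.time, fn (φ t) =ᵐ[m.vol] fun x =>
      Real.exp (-t) * negPrimSq c (m.uhat (pg t x)))
    (hψ : ∀ᵐ t ∂m.time, fn (ψ t) =ᵐ[m.vol] fun x =>
      Real.exp (-t) * negPrim c (m.uhat (pg t x)))
    {ξS ξR : ℝ → m.VD →L[ℝ] ℝ} (mS : MemLp ξS 2 m.time)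
    (dS : m.IsWeightedTimeDeriv (fun t x => m.sat (pl t x) (pg t x)) ξS)
    (iS : m.HasWeakInitialValue (fun t x => m.sat (pl t x) (pg t x))
      fun x => m.sat (pl0 x) (pg0 x))
    (mR : MemLp ξR 2 m.time)
    (dR : m.IsWeightedTimeDeriv (fun t x => m.gasMass (pl t x) (pg t x)) ξR)
    (iR : m.HasWeakInitialValue (fun t x => m.gasMass (pl t x) (pg t x))
      fun x => m.gasMass (pl0 x) (pg0 x)) :
    ∫ z, weightedEnergy m pl pg z ∂m.volQ
      ≤ ∫ t, ξR t (ψ t) ∂m.time - ∫ t, ξS t (φ t) ∂m.time := by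
  have := hm.isFiniteMeasure_vol
  have := hm.isFiniteMeasure_volQ
  have : TopologicalSpace.SeparableSpace m.VD := by
    have : SecondCountableTopology m.VD :=
      TopologicalSpace.Subtype.secondCountableTopology (m.VD : Set (L2Pair m.Ω))
    infer_instance
  have eS := hm.isEvolution (w := fun t x => m.sat (pl t x) (pg t x))
    (w0 := fun x => m.sat (pl0 x) (pg0 x)) (hm.memLp_sat hpl hpg) (hm.memLp_sat hpl0 hpg0) mS dS iS
  have eR := hm.isEvolution (w := fun t x => m.gasMass (pl t x) (pg t x))
    (w0 := fun x => m.gasMass (pl0 x) (pg0 x)) (hm.memLp_gasMass hpl hpg) (hm.memLp_gasMass hpl0 hpg0) mR dR iR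
  have tS := eS.tendsto_difference_quotient hm.T_pos mφ
  have tR := eR.tendsto_difference_quotient hm.T_pos mψ
  -- The weight pays off here: `(1 - e^{-δ}) / δ → 1`, so the full space-time energy survives in the
  -- limit.
  have tE : Tendsto (fun δ : ℝ => δ⁻¹ * ((1 - Real.exp (-δ)) *
      ∫ z, weightedEnergy m pl pg z ∂m.volQ)) (𝓝[>] 0)
      (𝓝 (∫ z, weightedEnergy m pl pg z ∂m.volQ)) := by
    have h1 : HasDerivAt (fun δ : ℝ => 1 - Real.exp (-δ)) 1 0 := by
      have := ((hasDerivAt_neg (0 : ℝ)).exp).const_sub 1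
      simpa using this
    have h2 := h1.hasDerivWithinAt (s := Ioi 0)
    rw [hasDerivWithinAt_iff_tendsto_slope' (by simp)] at h2
    have h3 := h2.mul_const (∫ z, weightedEnergy m pl pg z ∂m.volQ)
    rw [one_mul] at h3
    refine h3.congr fun δ => ?_
    rw [slope_def_field]
    simp
    ring
  refine le_of_tendsto_of_tendsto tE (tR.sub tS) ?_
  filter_upwards [self_mem_nhdsWithin] with δ hδ
  rw [← mul_sub]
  exact mul_le_mul_of_nonneg_left
    (hm.energy_le_difference hpl hpg hpl0 hpg0 hpos hc hlow hφ hψ hδ) (inv_nonneg.2 (le_of_lt hδ))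

end FlowData.Admissible

end TwoPhase
end

/-! ### Test functions and spatial terms on `Q_T` -/

noncomputable section

namespace TwoPhase

namespace FlowData.Admissible

variable {d : ℕ} {m : FlowData d}

/-- A jointly measurable representative on `Q_T` of the gradient of a square-integrable function of
time. -/
theorem exists_gradQ (hm : m.Admissible) {W : Submodule ℝ (L2Pair m.Ω)} {v : ℝ → W}
    (hv : MemLp v 2 m.time) : ∃ g : ℝ × E d → E d, MemLp g 2 m.volQ ∧
      ∀ᵐ t ∂m.time, grad (v t) =ᵐ[m.vol] fun x => g (t, x) := by
  have : IsFiniteMeasure (volume.restrict m.Ω) := hm.isFiniteMeasure_vol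
  exact exists_joint_grad hv

/-- The test function `e^{-t} G(u)`, for a primitive `G` of a bounded continuous function `g`. -/
theorem exists_test {G g : ℝ → ℝ} {C : ℝ} (h : IsC1Lip G g C) {u : ℝ → m.VD}
    (mu : MemLp u 2 m.time) {w : ℝ → E d → ℝ} (hu : ∀ᵐ t ∂m.time, fn (u t) =ᵐ[m.vol] w t)
    {GU : ℝ × E d → E d} (rU : ∀ᵐ t ∂m.time, grad (u t) =ᵐ[m.vol] fun x => GU (t, x)) :
    ∃ ψ : ℝ → m.VD, MemLp ψ 2 m.time ∧
      (∀ᵐ t ∂m.time, fn (ψ t) =ᵐ[m.vol] fun x => Real.exp (-t) * G (w t x)) ∧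
      ∀ᵐ t ∂m.time, grad (ψ t) =ᵐ[m.vol] fun x => Real.exp (-t) • g (w t x) • GU (t, x) := by
  refine ⟨fun t => Real.exp (-t) • superpositionV h (u t),
    memLp_exp_smul (memLp_superpositionV h mu), ?_, ?_⟩
  · filter_upwards [hu] with t hu
    filter_upwards [fn_smul (Real.exp (-t)) (superpositionV h (u t)), fn_superpositionV h (u t),
      hu] with x h1 h2 h3
    rw [h1, h2, h3]
  · filter_upwards [hu, rU] with t hu rU
    filter_upwards [grad_smul (Real.exp (-t)) (superpositionV h (u t)),
      grad_superpositionV h (u t), hu, rU] with x h1 h2 h3 h4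
    rw [h1, h2, h3, h4]

theorem hasInt_inner_grad (hm : m.Admissible) {F : ℝ → E d → E d} {v : ℝ → m.VD}
    {f g : ℝ × E d → E d} (hf : MemLp f 2 m.volQ) (hg : MemLp g 2 m.volQ)
    (hF : ∀ᵐ t ∂m.time, ∀ᵐ x ∂m.vol, F t x = f (t, x))
    (hv : ∀ᵐ t ∂m.time, grad (v t) =ᵐ[m.vol] fun x => g (t, x)) :
    HasInt m.volQ (fun z => inner ℝ (f z) (g z))
      (∫ t, ∫ x, inner ℝ (F t x) (grad (v t) x) ∂m.vol ∂m.time) := by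
  have := hm.isFiniteMeasure_vol
  refine hasInt_iterated (integrable_inner hf hg) ?_
  filter_upwards [hF, hv] with t h1 h2
  filter_upwards [h1, h2] with x h1 h2
  rw [h1, h2]

theorem hasInt_mul_fn (hm : m.Admissible) {F : ℝ → E d → ℝ} {v : ℝ → m.VD}
    {g : ℝ × E d → ℝ} (hF : MemLp (Function.uncurry F) 2 m.volQ) (hg : MemLp g ∞ m.volQ)
    (hv : ∀ᵐ t ∂m.time, fn (v t) =ᵐ[m.vol] fun x => g (t, x)) :
    HasInt m.volQ (fun z => F z.1 z.2 * g z)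
      (∫ t, ∫ x, F t x * fn (v t) x ∂m.vol ∂m.time) := by
  have := hm.isFiniteMeasure_vol
  have := hm.isFiniteMeasure_volQ
  refine hasInt_iterated ((memLp_mul_of_top_right hF hg).integrable one_le_two) ?_
  filter_upwards [hv] with t h
  filter_upwards [h] with x h
  rw [h]

/-- The pointwise estimate behind `evolution_nonneg`. -/
theorem difference_nonneg (hm : m.Admissible) {c : ℝ} (hc : 0 ≤ c) (hlow : ∀ σ, -c ≤ m.uhat σ)
    {a D e fp fi : ℝ} (ha : 0 ≤ a) (hD : 0 ≤ D) (he : 0 ≤ e) (hfp : 0 ≤ fp) (hfi : 0 ≤ fi)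
    (pl pg : ℝ) (JL JG GU g : E d) :
    0 ≤ (inner ℝ (m.uhat pg • JL + m.ρhat pg • JG
          + (a * m.sat pl pg * (m.ρstd / m.ρl pg) * D) • GU)
          (e • truncNeg c (m.uhat pg) • GU)
        + m.gasMass pl pg * fp * (e * negPrim c (m.uhat pg))
        - inner ℝ ((m.ρl pg * m.uhat pg * m.mobL (m.sat pl pg)
          + m.ρhat pg ^ 2 * m.mobG (m.sat pl pg)) • g) (e • truncNeg c (m.uhat pg) • GU))
      - (inner ℝ (JL - (a * m.sat pl pg * (m.ρl pg)⁻¹ * D) • GU)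
          (e • (-truncNeg c (m.uhat pg) ^ 2) • GU)
        + m.sat pl pg * fp * (e * negPrimSq c (m.uhat pg))
        - fi * (e * negPrimSq c (m.uhat pg))
        - inner ℝ ((m.ρl pg * m.mobL (m.sat pl pg)) • g)
          (e • (-truncNeg c (m.uhat pg) ^ 2) • GU)) := by
  have hS := hm.sat_mem pl pg
  have hU := hlow pg
  have s2 := negEnergy_step (S' := 0) (R' := 0) (u' := 0) hc hU le_rfl
    (hm.gasMass_eq (pl := pl)) (by simp)
  -- As at the discrete step, gravity is absorbed into the two fluxes.
  have s3 := flux_difference_nonneg (ρL := m.ρl pg) hc hU hm.ρhat_eq_zero rfl (hm.ρl_pos pg)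
    (mul_nonneg (mul_nonneg ha hS.1.le) hD)
    (JL - (m.ρl pg * m.mobL (m.sat pl pg)) • g)
    (JG - (m.ρhat pg * m.mobG (m.sat pl pg)) • g) GU
  have n1 := mul_nonneg hS.1.le (negEnergy_nonneg (m.uhat pg))
  have t2 := mul_nonneg hfp (by linarith : (0 : ℝ) ≤ m.gasMass pl pg * negPrim c (m.uhat pg)
    - m.sat pl pg * negPrimSq c (m.uhat pg))
  have t3 := mul_nonneg hfi (negPrimSq_nonneg hc hU)
  refine (mul_nonneg he (add_nonneg (add_nonneg s3 t2) t3)).trans_eq ?_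
  simp only [inner_add_left, inner_sub_left, real_inner_smul_left, real_inner_smul_right]
  ring

end FlowData.Admissible

end TwoPhase
end

/-! ### The sign of the gas pressure for weak solutions -/

noncomputable section

namespace TwoPhase

namespace FlowData.Admissible

variable {d : ℕ} {m : FlowData d}

/-- Nonnegativity of the gas pressure for weak solutions of the evolution problem. -/
theorem evolution_nonneg (hm : m.Admissible) {pl0 pg0 : E d → ℝ} (hpl0 : MemLp pl0 2 m.vol)
    (hpg0 : MemLp pg0 2 m.vol) (hpos : ∀ᵐ x ∂m.vol, 0 ≤ pg0 x) {pl pg : ℝ → E d → ℝ}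
    (hsol : m.IsWeakSolution pl0 pg0 pl pg) : ∀ᵐ z ∂m.volQ, 0 ≤ pg z.1 z.2 := by
  have := hm.isFiniteMeasure_vol
  have := hm.isFiniteMeasure_volQ
  obtain ⟨c, C, hc, hcρ, hlow, -⟩ := hm.exists_uhat_bounds
  obtain ⟨p, u, b, ξS, ξR, ml, mg, mp, mu, mb, -, hu, -, mS, dS, mR, dR, hL, hG, iS, iR⟩ := hsol
  have h := isC1Lip_negPrim hc
  have H := isC1Lip_negPrimSq hc
  obtain ⟨GP, mGP, rP⟩ := hm.exists_gradQ mp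
  obtain ⟨GU, mGU, rU⟩ := hm.exists_gradQ mu
  obtain ⟨GB, mGB, rB⟩ := hm.exists_gradQ mb
  obtain ⟨ψ, mψ, eψ, gψ⟩ := exists_test h mu hu rU
  obtain ⟨φ, mφ, eφ, gφ⟩ := exists_test H mu hu rU
  have hL := hL φ mφ
  have hG := hG ψ mψ
  have time := hm.energy_le_timeDeriv ml.1 mg.1 hpl0.1 hpg0.1 hpos hc hlow mφ mψ eφ eψ mS dS iS
    mR dR iR
  let S : ℝ × E d → ℝ := fun z => m.sat (pl z.1 z.2) (pg z.1 z.2)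
  let R : ℝ × E d → ℝ := fun z => m.gasMass (pl z.1 z.2) (pg z.1 z.2)
  let U : ℝ × E d → ℝ := fun z => m.uhat (pg z.1 z.2)
  let ρL : ℝ × E d → ℝ := fun z => m.ρl (pg z.1 z.2)
  let ρG : ℝ × E d → ℝ := fun z => m.ρhat (pg z.1 z.2)
  have bS : MemLp S ∞ m.volQ := hm.memLp_sat ml.1 mg.1
  have bR : MemLp R ∞ m.volQ := hm.memLp_gasMass ml.1 mg.1
  have bU : MemLp U ∞ m.volQ := hm.memLp_uhat mg.1
  have bρL : MemLp ρL ∞ m.volQ := hm.memLp_ρl mg.1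
  have bρL' : MemLp (fun z => (ρL z)⁻¹) ∞ m.volQ := hm.memLp_ρl_inv mg.1
  have bρG : MemLp ρG ∞ m.volQ := hm.memLp_ρhat mg.1
  have sS : ∀ z, S z ∈ Icc (0 : ℝ) 1 := fun z => Ioc_subset_Icc_self (hm.sat_mem _ _)
  have bL := memLp_comp_of_continuousOn hm.continuousOn_mobL bS.1 sS
  have bG := memLp_comp_of_continuousOn hm.continuousOn_mobG bS.1 sS
  have bγ := memLp_comp_of_continuousOn hm.continuousOn_γ bS.1 sS
  have bΦ : MemLp (fun z : ℝ × E d => m.Φ z.2) ∞ m.volQ := hm.memLp_Φ.comp_snd m.time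
  have bD : MemLp (fun z : ℝ × E d => m.D z.2) ∞ m.volQ := hm.D_mem.comp_snd m.time
  have bK : MemLp (fun z : ℝ × E d => m.K z.2) ∞ m.volQ := hm.K_mem.comp_snd m.time
  have bE : MemLp (fun z : ℝ × E d => Real.exp (-z.1)) ∞ m.volQ := hm.memLp_exp_neg
  have bh := memLp_mul_of_top bE (h.memLp_comp bU)
  have bH := memLp_mul_of_top bE (H.memLp_comp bU)
  have bgh : MemLp (fun z => Real.exp (-z.1) • truncNeg c (U z) • GU z) 2 m.volQ :=
    memLp_smul_of_top bE (h.memLp_smul bU.1 mGU)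
  have bgH : MemLp (fun z => Real.exp (-z.1) • (-truncNeg c (U z) ^ 2) • GU z) 2 m.volQ :=
    memLp_smul_of_top bE (H.memLp_smul bU.1 mGU)
  have fL : MemLp (fun z => m.mobL (S z) • GP z + m.γ (S z) • GB z) 2 m.volQ :=
    (memLp_smul_of_top bL mGP).add (memLp_smul_of_top bγ mGB)
  have fG : MemLp (fun z => m.mobG (S z) • GP z - m.γ (S z) • GB z) 2 m.volQ :=
    (memLp_smul_of_top bG mGP).sub (memLp_smul_of_top bγ mGB)
  -- Of the degenerate fluxes only square-integrability matters: they drop out of the difference of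
  -- the tested equations.
  let JL : ℝ × E d → E d := fun z => m.K z.2 (m.mobL (S z) • GP z + m.γ (S z) • GB z)
  let JG : ℝ × E d → E d := fun z => m.K z.2 (m.mobG (S z) • GP z - m.γ (S z) • GB z)
  have KL : MemLp JL 2 m.volQ := memLp_clm_apply bK fL
  have KG : MemLp JG 2 m.volQ := memLp_clm_apply bK fG
  have Kv : MemLp (fun z : ℝ × E d => m.K z.2 m.gravity) 2 m.volQ :=
    memLp_clm_apply bK (memLp_const m.gravity)
  have bdiff : MemLp (fun z => m.Φ z.2 * S z * (ρL z)⁻¹ * m.D z.2) ∞ m.volQ :=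
    memLp_mul_of_top (memLp_mul_of_top (memLp_mul_of_top bΦ bS) bρL') bD
  have bdiff' : MemLp (fun z => m.Φ z.2 * S z * (m.ρstd / ρL z) * m.D z.2) ∞ m.volQ := by
    simp only [div_eq_mul_inv]
    exact memLp_mul_of_top (memLp_mul_of_top (memLp_mul_of_top bΦ bS)
      (memLp_mul_of_top (memLp_const m.ρstd) bρL')) bD
  have L1 := hm.hasInt_inner_grad (KL.sub (memLp_smul_of_top bdiff mGU)) bgH
    (F := fun t x => m.K x (m.mobL (S (t, x)) • grad (p t) x + m.γ (S (t, x)) • grad (b t) x)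
      - (m.Φ x * S (t, x) * (ρL (t, x))⁻¹ * m.D x) • grad (u t) x) (by
      filter_upwards [rP, rU, rB] with t h1 h2 h3
      filter_upwards [h1, h2, h3] with x h1 h2 h3
      rw [h1, h2, h3]
      rfl) gφ
  have L2 := hm.hasInt_mul_fn (F := fun t x => S (t, x) * m.FP t x)
    (memLp_mul_of_top bS hm.FP_mem) bH eφ
  have L3 := hm.hasInt_mul_fn (F := fun t x => m.FI t x) hm.FI_mem bH eφ
  have L4 := hm.hasInt_inner_grad (memLp_smul_of_top (memLp_mul_of_top bρL bL) Kv) bgH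
    (F := fun t x => (ρL (t, x) * m.mobL (S (t, x))) • m.K x m.gravity)
    (.of_forall fun t => .of_forall fun x => rfl) gφ
  have G1 := hm.hasInt_inner_grad (((memLp_smul_of_top bU KL).add
    (memLp_smul_of_top bρG KG)).add (memLp_smul_of_top bdiff' mGU)) bgh
    (F := fun t x => fn (u t) x • m.K x (m.mobL (S (t, x)) • grad (p t) x
        + m.γ (S (t, x)) • grad (b t) x)
      + ρG (t, x) • m.K x (m.mobG (S (t, x)) • grad (p t) x - m.γ (S (t, x)) • grad (b t) x)
      + (m.Φ x * S (t, x) * (m.ρstd / ρL (t, x)) * m.D x) • grad (u t) x) (by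
      filter_upwards [rP, rU, rB, hu] with t h1 h2 h3 h4
      filter_upwards [h1, h2, h3, h4] with x h1 h2 h3 h4
      rw [h1, h2, h3, h4]
      rfl) gψ
  have G2 := hm.hasInt_mul_fn (F := fun t x => R (t, x) * m.FP t x)
    (memLp_mul_of_top bR hm.FP_mem) bh eψ
  have G3 := hm.hasInt_inner_grad (memLp_smul_of_top ((memLp_mul_of_top
    (memLp_mul_of_top bρL bU) bL).add (memLp_mul_of_top (memLp_mul_of_top bρG bρG) bG)) Kv) bgh
    (F := fun t x => (ρL (t, x) * fn (u t) x * m.mobL (S (t, x))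
        + ρG (t, x) ^ 2 * m.mobG (S (t, x))) • m.K x m.gravity) (by
      filter_upwards [hu] with t h
      filter_upwards [h] with x h
      rw [h, sq]
      rfl) gψ
  have T0 := hasInt_of_integrable (hm.integrable_weightedEnergy ml.1 mg.1)
  -- Spatial gas terms minus spatial liquid terms, plus the energy. The equations turn the spatial
  -- part into minus the time terms, which outweigh the energy by `energy_le_timeDeriv`; the total
  -- integral is thus nonpositive, while its integrand dominates the energy density.
  have tot := (((G1.add G2).sub G3).sub (((L1.add L2).sub L3).sub L4)).add T0
  have zero := tot.ae_eq_zero (e := weightedEnergy m pl pg) ?_ ?_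
  · filter_upwards [zero, hm.Φ_pos_volQ] with z hz hΦ
    have hS := (hm.sat_mem (pl z.1 z.2) (pg z.1 z.2)).1
    refine hm.nonneg_of_uhat_nonneg (nonneg_of_negEnergy_eq_zero ?_)
    simpa [weightedEnergy, hΦ.ne', hS.ne'] using hz
  · simp only at hL hG
    simp only [S, R, ρL, ρG]
    linarith
  · filter_upwards [hm.weightedEnergy_nonneg pl pg, hm.Φ_pos_volQ, hm.D_pos_volQ, hm.FP_nonneg,
      hm.FI_nonneg] with z hE hΦ hD nP nI
    have key := hm.difference_nonneg hc hlow hΦ.le hD.le (Real.exp_nonneg (-z.1)) nP nI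
      (pl z.1 z.2) (pg z.1 z.2) (JL z) (JG z) (GU z) (m.K z.2 m.gravity)
    refine ⟨hE, le_add_of_nonneg_left ?_⟩
    rw [sq (m.ρhat _)] at key
    exact key

end FlowData.Admissible

end TwoPhase
end

theorem mainTheorem5 {d : ℕ} (hd : 1 ≤ d) (m : TwoPhase.FlowData d) (hm : m.Admissible) :
    (∀ (η : ℝ), 0 < η → ∀ (M k : ℕ), 1 ≤ k → k ≤ M →
      ∀ (plPrev pgPrev : TwoPhase.E d → ℝ), MemLp plPrev 2 m.vol → MemLp pgPrev 2 m.vol →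
      (∀ᵐ x ∂m.vol, 0 ≤ pgPrev x) →
      ∀ (pl pg : m.VD), m.IsDiscreteSolution η (m.T / M) k plPrev pgPrev pl pg →
        ∀ᵐ x ∂m.vol, 0 ≤ TwoPhase.fn pg x) ∧
    (∀ (pl0 pg0 : TwoPhase.E d → ℝ), MemLp pl0 2 m.vol → MemLp pg0 2 m.vol →
      (∀ᵐ x ∂m.vol, 0 ≤ pg0 x) →
      ∀ (pl pg : ℝ → TwoPhase.E d → ℝ), m.IsWeakSolution pl0 pg0 pl pg →
        ∀ᵐ z ∂m.volQ, 0 ≤ pg z.1 z.2) := by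
  refine ⟨?_, ?_⟩
  · intro η _ M k hk hkM plPrev pgPrev hpl hpg hpos pl pg hsol
    exact hm.discrete_nonneg hk hkM hpl hpg hpos hsol
  · intro pl0 pg0 hpl0 hpg0 hpos pl pg hsol
    exact hm.evolution_nonneg hpl0 hpg0 hpos hsol
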